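/- For complex parameters consider the Fuchsian equation $$u''+\Big(\frac{\gamma}{z}+\frac{\delta}{z-1}+\frac{\varepsilon}{z-a}+\frac{\varepsilon_1}{z-a_1}\Big)u'+\frac{\alpha\beta z^2-\theta_1 z-\theta_0}{z(z-1)(z-a)(z-a_1)}\,u=0,\qquad 1+\alpha+\beta=\gamma+\delta+\varepsilon+\varepsilon_1. \tag{1}$$ For $N\ge 0$ and $e_1,\dots,e_N\in\mathbb C$ put $$u_e(z)={}_{N+2}F_{N+1}(\alpha,\beta,1+e_1,\dots,1+e_N;\ \gamma,e_1,\dots,e_N;\ z).$$ Say that $e=(e_1,\dots,e_N)$ gives a hypergeometric solution of (1) if none of $\gamma,e_1,\dots,e_N$ is a non-positive integer and $u_e$ (whose series converges for $|z|<1$) satisfies (1) at all points of the unit disc other than $0,a,a_1$. (i) Let $0,1,a,a_1$ be pairwise distinct and let none of $\alpha,\beta,\gamma-\alpha,\gamma-\beta$ be an integer. If $e=(e_1,\dots,e_N)$ gives a hypergeometric solution of (1), then $\varepsilon$ and $\varepsilon_1$ are non-positive integers with $\varepsilon+\varepsilon_1=-N$, and $$\theta_0=-a a_1\,\alpha\beta\prod_{k=1}^N\frac{1+e_k}{e_k}.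 \tag{2}$$ (ii) Conversely, let $k,l\ge 0$ be integers, $N=k+l$, $\varepsilon=-k$, $\varepsilon_1=-l$. There is a polynomial $T$ in one variable, of degree $(k+1)(l+1)=(1-\varepsilon)(1-\varepsilon_1)$, with coefficients in $\mathbb C[\alpha,\beta,\gamma,a,a_1]$ (so the degree is $N+1$ if $\varepsilon$ or $\varepsilon_1$ vanishes), such that for all $(\alpha,\beta,\gamma,a,a_1)\in\mathbb C^5$ outside a countable union of zero sets of nonzero polynomials the following hold, with $\delta=1+\alpha+\beta-\gamma+k+l$. The specialization of $T$ at $(\alpha,\beta,\gamma,a,a_1)$ still has degree $(k+1)(l+1)$ and has no multiple roots. A number $\theta_1$ is a root of it if and only if for some $\theta_0$ and some $e=(e_1,\dots,e_N)$, $e$ gives a hypergeometric solution of (1). In that case $\theta_0$ is given by (2), the root $\theta_1$ determines $\theta_0$ uniquely and $e_1,\dots,e_N$ uniquely up to order, the points $0,1,a,a_1$ are pairwise distinct, and, if $k,l\ge 1$, equation (1) has five irreducible singularities: each of $0,1,a,a_1,\infty$ is a regular singular point and not an ordinary point, and all other points are ordinary. (iii) In particular, for all integers $k,l\ge 1$ there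 are infinitely many choices of the parameters of (1) with $\varepsilon=-k$, $\varepsilon_1=-l$ for which (1) has five irreducible singularities and some $e=(e_1,\dots,e_{k+l})$ gives a hypergeometric solution. -/

import Mathlib

open Filter Topology

/-- The coefficient of `z ^ n` in the generalized hypergeometric series `rFs(A; B; z)`:
`(A 1)_n ⋯ (A r)_n / ((B 1)_n ⋯ (B s)_n n!)`, with `(x)_n` the rising factorial. -/
noncomputable def genHypCoeff {r s : ℕ} (A : Fin r → ℂ) (B : Fin s → ℂ) (n : ℕ) : ℂ :=
  (∏ i, (ascPochhammer ℂ n).eval (A i)) /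
    ((∏ j, (ascPochhammer ℂ n).eval (B j)) * (n.factorial : ℂ))

/-- The generalized hypergeometric function `rFs(A; B; z)`, as the sum of its series. -/
noncomputable def genHyp {r s : ℕ} (A : Fin r → ℂ) (B : Fin s → ℂ) (z : ℂ) : ℂ :=
  ∑' n : ℕ, genHypCoeff A B n * z ^ n

/-- The point `z₀` is an ordinary point of `u'' + p u' + q u = 0`: both coefficients extend
analytically to `z₀`. -/
def IsOrdinaryPoint (p q : ℂ → ℂ) (z₀ : ℂ) : Prop :=
  ∃ P Q : ℂ → ℂ, AnalyticAt ℂ P z₀ ∧ AnalyticAt ℂ Q z₀ ∧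
    (∀ᶠ z in 𝓝[≠] z₀, p z = P z) ∧ (∀ᶠ z in 𝓝[≠] z₀, q z = Q z)

/-- The point `z₀` is a regular singular point of `u'' + p u' + q u = 0`: it is not an ordinary
point, while `(z - z₀) p` and `(z - z₀)² q` extend analytically to `z₀`. -/
def IsRegularSingularPoint (p q : ℂ → ℂ) (z₀ : ℂ) : Prop :=
  ¬ IsOrdinaryPoint p q z₀ ∧
  ∃ P Q : ℂ → ℂ, AnalyticAt ℂ P z₀ ∧ AnalyticAt ℂ Q z₀ ∧
    (∀ᶠ z in 𝓝[≠] z₀, (z - z₀) * p z = P z) ∧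
    (∀ᶠ z in 𝓝[≠] z₀, (z - z₀) ^ 2 * q z = Q z)

/-- The point at infinity is a regular singular point of `u'' + p u' + q u = 0`: the substitution
`z = 1 / w` turns the equation into
`v'' + (2 / w - p (1 / w) / w²) v' + (q (1 / w) / w⁴) v = 0`, which is examined at `w = 0`. -/
def IsRegularSingularAtInfinity (p q : ℂ → ℂ) : Prop :=
  IsRegularSingularPoint (fun w => 2 / w - p (1 / w) / w ^ 2) (fun w => q (1 / w) / w ^ 4) 0

/-- The parameters of the equation
`u'' + (γ/z + δ/(z-1) + ε/(z-a) + ε₁/(z-a₁)) u'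
  + (αβz² - θ₁z - θ₀) / (z(z-1)(z-a)(z-a₁)) u = 0`. -/
@[ext]
structure FuchsianParams where
  (α β γ δ ε ε₁ a a₁ θ₀ θ₁ : ℂ)

namespace FuchsianParams

/-- The coefficient of `u'`. -/
noncomputable def p (P : FuchsianParams) (z : ℂ) : ℂ :=
  P.γ / z + P.δ / (z - 1) + P.ε / (z - P.a) + P.ε₁ / (z - P.a₁)

/-- The coefficient of `u`. -/
noncomputable def q (P : FuchsianParams) (z : ℂ) : ℂ :=
  (P.α * P.β * z ^ 2 - P.θ₁ * z - P.θ₀) / (z * (z - 1) * (z - P.a) * (z - P.a₁))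

/-- The Fuchsian condition. -/
def FuchsRelation (P : FuchsianParams) : Prop :=
  1 + P.α + P.β = P.γ + P.δ + P.ε + P.ε₁

/-- The points `0, 1, a, a₁` are pairwise distinct. -/
def DistinctPoints (P : FuchsianParams) : Prop :=
  P.a ≠ 0 ∧ P.a ≠ 1 ∧ P.a₁ ≠ 0 ∧ P.a₁ ≠ 1 ∧ P.a ≠ P.a₁

/-- None of the five points `0, 1, a, a₁, ∞` coincides with another one or disappears as a
singularity of the equation, and all of them are regular singular points. -/
def HasFiveRegularSingularPoints (P : FuchsianParams) : Prop :=
  P.DistinctPoints ∧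
  IsRegularSingularPoint P.p P.q 0 ∧ IsRegularSingularPoint P.p P.q 1 ∧
  IsRegularSingularPoint P.p P.q P.a ∧ IsRegularSingularPoint P.p P.q P.a₁ ∧
  IsRegularSingularAtInfinity P.p P.q ∧
  ∀ z : ℂ, z ≠ 0 → z ≠ 1 → z ≠ P.a → z ≠ P.a₁ → IsOrdinaryPoint P.p P.q z

/-- `u` is holomorphic in the unit disc and solves the equation at every point of the disc other
than `0`, `a`, `a₁`. -/
def SolvedOnUnitDisc (P : FuchsianParams) (u : ℂ → ℂ) : Prop :=
  DifferentiableOn ℂ u (Metric.ball 0 1) ∧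
  ∀ z ∈ Metric.ball (0 : ℂ) 1, z ≠ 0 → z ≠ P.a → z ≠ P.a₁ →
    deriv (deriv u) z + P.p z * deriv u z + P.q z * u z = 0

/-- The upper parameters `α, β, 1 + e_1, …, 1 + e_N`. -/
def upper (P : FuchsianParams) {N : ℕ} (e : Fin N → ℂ) : Fin (N + 2) → ℂ :=
  Matrix.vecCons P.α (Matrix.vecCons P.β fun i => 1 + e i)

/-- The lower parameters `γ, e_1, …, e_N`. -/
def lower (P : FuchsianParams) {N : ℕ} (e : Fin N → ℂ) : Fin (N + 1) → ℂ :=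
  Matrix.vecCons P.γ e

/-- The function `F(α, β, 1 + e_1, …, 1 + e_N; γ, e_1, …, e_N; z)` with `N + 2` upper and `N + 1`
lower parameters is well defined (no lower parameter is a non-positive integer, and its series
converges in the unit disc) and is a solution of the equation. -/
def IsHypergeometricSolution (P : FuchsianParams) {N : ℕ} (e : Fin N → ℂ) : Prop :=
  (∀ (j : Fin (N + 1)) (m : ℕ), P.lower e j ≠ -(m : ℂ)) ∧
  (∀ z ∈ Metric.ball (0 : ℂ) 1,
    Summable fun n : ℕ => genHypCoeff (P.upper e) (P.lower e) n * z ^ n) ∧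
  P.SolvedOnUnitDisc (genHyp (P.upper e) (P.lower e))

/-- The formula `θ₀ = -a a₁ α β ∏ (1 + e_k) / ∏ e_k`. -/
def Theta0Formula (P : FuchsianParams) {N : ℕ} (e : Fin N → ℂ) : Prop :=
  P.θ₀ = -(P.a * P.a₁) * P.α * P.β * ((∏ i, (1 + e i)) / ∏ i, e i)

end FuchsianParams

/-- The parameters with `ε = -k`, `ε₁ = -l`, and `δ` fixed by the Fuchsian condition. -/
noncomputable def fuchsianCase (k l : ℕ) (α β γ a a₁ θ₀ θ₁ : ℂ) : FuchsianParams where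
  α := α
  β := β
  γ := γ
  δ := 1 + α + β - γ + k + l
  ε := -(k : ℂ)
  ε₁ := -(l : ℂ)
  a := a
  a₁ := a₁
  θ₀ := θ₀
  θ₁ := θ₁

/-! Since `(1 + e)_n / (e)_n = 1 + n / e`, the series `u_e` has coefficients `h_n R(n)`, where the
`h_n` belong to `₂F₁(α, β; γ; z)` and `R(x) = ∏ (1 + x / e_i)`. That such a series solves (1)
amounts to one polynomial identity, `recurrencePoly R = 0`.

Necessity. The identity does not refer to the point 0. It says that `R(z d/dz)`, applied to any
local solution of Gauss' equation at `a`, solves (1) (`fuchsOp_eulerOp_eq_zero`). Irreducibility of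
Gauss' equation makes this map injective (`eq_zero_of_aeval_eulerOp`), so all solutions of (1) at
`a` are power series. Hence the second exponent `1 - ε` is a positive integer and no logarithm
occurs; the same holds at `a₁`. The two leading coefficients of the identity give `ε + ε₁ = -N`, and
the first coefficient of the equation at 0 gives (2).

Existence. Conversely, let `a` and `a₁` be free of logarithms. Put `Δ = (z - a)^k (z - a₁)^l` and
consider `f = Δ⁻¹ (Q₀ u + Q₁ z u')` with polynomials `Q₀`, `Q₁` of degree about `N / 2`, chosen by a
dimension count so that the quotient has no poles at `a` and `a₁`. A pair of smaller degree must
vanish: its Wronskian with its derivative is divisible by `Δ` and too small, so it spans an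
invariant line, which the nonintegrality of the exponents forbids. This forces `f` to satisfy Gauss'
equation with parameters `α + n`, `β + n`, `γ` (`ApparentData.gaussComb_eq_zero`). Cramer's rule
recovers `u` from `f` and `f'` with polynomial coefficients, and this puts the coefficients of `u`
in the form `h_m R(m)` (`ApparentData.exists_gaussClass`).

Counting. In the accessory variables `Y`, `Y₁` (the numerator of `q` at `a` and at `a₁`) the absence
of logarithms is given by two plane curves with leading forms `Y^(k+1)` and `Y₁^(l+1)`. They have at
most `(k+1)(l+1)` common points, and `Y - Y₁` is affine in `θ₁`, so `T` is the resultant along the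
lines `Y - Y₁ = x`. To see that its roots are generically simple and of full number, replace `α`,
`γ` by `h α`, `h γ` with a homogenizing parameter `h`. At `h = 0` the equation has order one and
both curves split into lines that can be listed (`isApparentPair_basePoint_iff`).

Nonvanishing. No `e_i` is a non-positive integer if and only if no coefficient of `u` vanishes. At
the base point the solution is an explicit product with positive coefficients
(`originRec_basePoint_ne_zero`). The common points form a finite scheme over the parameters, so by
Nakayama's lemma each coefficient stays nonzero off the zero set of one polynomial
(`exists_generic_ne_zero`). There is one polynomial for each coefficient, hence a countable
exceptional union. -/

/-! ### Elimination over a base ring -/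

/-- If a finite family of equations has no solution over one point of the base, then an element of
the base ring that does not vanish at that point belongs to the ideal of the equations. -/
theorem exists_C_mem_ideal_of_no_zero {P σ : Type} [CommRing P] [Algebra ℂ P] [Finite σ]
    (I : Ideal (MvPolynomial σ P)) [Module.Finite P (MvPolynomial σ P ⧸ I)] (φ : P →ₐ[ℂ] ℂ)
    (h : ∀ x : σ → ℂ, ∃ p ∈ I, MvPolynomial.eval₂ (φ : P →+* ℂ) x p ≠ 0) :
    ∃ G : P, φ G = 1 ∧ MvPolynomial.C G ∈ I := by
  have hsurj : Function.Surjective (φ : P →+* ℂ) := fun c =>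
    ⟨algebraMap ℂ P c, by simp⟩
  have hmap := MvPolynomial.map_surjective (σ := σ) (φ : P →+* ℂ) hsurj
  -- Nullstellensatz in the fibre over `φ`: the specialized ideal has no zeros.
  have htop : I.map (MvPolynomial.map (σ := σ) (φ : P →+* ℂ)) = ⊤ := by
    rw [← Ideal.radical_eq_top, ← MvPolynomial.vanishingIdeal_zeroLocus_eq_radical (K := ℂ)]
    convert MvPolynomial.vanishingIdeal_empty (k := ℂ) (K := ℂ) (σ := σ)
    rw [Set.eq_empty_iff_forall_notMem]
    intro x hx
    obtain ⟨p, hp, hne⟩ := h x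
    apply hne
    have := hx _ (Ideal.mem_map_of_mem _ hp)
    simpa [MvPolynomial.aeval_def, MvPolynomial.eval₂_map] using this
  obtain ⟨p, hpI, hp1⟩ := (Ideal.mem_map_iff_of_surjective _ hmap).1
    ((Ideal.eq_top_iff_one _).1 htop)
  set m : Ideal P := RingHom.ker (φ : P →+* ℂ) with hm
  have hker : ∀ q : MvPolynomial σ P, ∀ d, ((1 - p) * q).coeff d ∈ m := by
    intro q d
    have h0 : MvPolynomial.map (φ : P →+* ℂ) ((1 - p) * q) = 0 := by simp [hp1]
    have := congrArg (MvPolynomial.coeff d) h0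
    rwa [MvPolynomial.coeff_map, MvPolynomial.coeff_zero] at this
  -- `p` acts as zero on the quotient and `1 - p` has coefficients in `m`, so the quotient equals
  -- `m` times itself. Nakayama's lemma then provides `r`, congruent to 1 modulo `m`, that kills it.
  have hle : (⊤ : Submodule P (MvPolynomial σ P ⧸ I)) ≤ m • ⊤ := by
    rintro x -
    obtain ⟨q, rfl⟩ := Ideal.Quotient.mk_surjective x
    have h1 : Ideal.Quotient.mk I q = Ideal.Quotient.mk I ((1 - p) * q) := by
      rw [Ideal.Quotient.eq]
      have : q - (1 - p) * q = p * q := by ring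
      rw [this]
      exact I.mul_mem_right _ hpI
    rw [h1, MvPolynomial.as_sum ((1 - p) * q), map_sum]
    refine Submodule.sum_mem _ fun d _ => ?_
    have h2 : Ideal.Quotient.mk I (MvPolynomial.monomial d (((1 - p) * q).coeff d)) =
        ((1 - p) * q).coeff d • Ideal.Quotient.mk I (MvPolynomial.monomial d (1 : P)) := by
      rw [← Ideal.Quotient.mkₐ_eq_mk P, ← map_smul, MvPolynomial.smul_monomial, smul_eq_mul,
        mul_one]
    rw [h2]
    exact Submodule.smul_mem_smul (hker q d) trivial
  obtain ⟨r, hr1, hr⟩ := Submodule.exists_sub_one_mem_and_smul_eq_zero_of_fg_of_le_smul m ⊤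
    Module.Finite.fg_top hle
  refine ⟨r, ?_, ?_⟩
  · rw [hm, RingHom.mem_ker, map_sub, map_one, sub_eq_zero] at hr1
    exact hr1
  · have := hr (Ideal.Quotient.mk I 1) trivial
    rw [← Ideal.Quotient.mkₐ_eq_mk P, ← map_smul, Ideal.Quotient.mkₐ_eq_mk,
      Ideal.Quotient.eq_zero_iff_mem] at this
    rwa [MvPolynomial.smul_eq_C_mul, mul_one] at this

/-- Modulo two polynomials in two variables with leading forms `X₀ ^ m` and `X₁ ^ n`, every
polynomial is a combination of the monomials `X₀ ^ i * X₁ ^ j` with `i < m`, `j < n`. -/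
theorem span_monomials_quotient_eq_top {P : Type} [CommRing P] (m n : ℕ)
    (f g : MvPolynomial (Fin 2) P) (I : Ideal (MvPolynomial (Fin 2) P)) (hfI : f ∈ I) (hgI : g ∈ I)
    (hf : ∀ d ∈ (f - MvPolynomial.X 0 ^ m).support, d.degree < m)
    (hg : ∀ d ∈ (g - MvPolynomial.X 1 ^ n).support, d.degree < n) :
    Submodule.span P (Set.range fun p : Fin m × Fin n =>
      Ideal.Quotient.mk I (MvPolynomial.X 0 ^ (p.1 : ℕ) * MvPolynomial.X 1 ^ (p.2 : ℕ))) = ⊤ := by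
  set S := Submodule.span P (Set.range fun p : Fin m × Fin n =>
      Ideal.Quotient.mk I (MvPolynomial.X 0 ^ (p.1 : ℕ) * MvPolynomial.X 1 ^ (p.2 : ℕ))) with hS
  have hsmul : ∀ (d : Fin 2 →₀ ℕ) (c : P),
      Ideal.Quotient.mk I (MvPolynomial.monomial d c) =
        c • Ideal.Quotient.mk I (MvPolynomial.monomial d (1 : P)) := by
    intro d c
    rw [← Ideal.Quotient.mkₐ_eq_mk P, ← map_smul, MvPolynomial.smul_monomial, smul_eq_mul, mul_one]
  have key : ∀ (N : ℕ) (d : Fin 2 →₀ ℕ), d.degree = N →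
      Ideal.Quotient.mk I (MvPolynomial.monomial d (1 : P)) ∈ S := by
    intro N
    induction N using Nat.strong_induction_on with
    | _ N ih =>
      intro d hd
      have hdeg : ∀ d : Fin 2 →₀ ℕ, d.degree = d 0 + d 1 := fun d => by
        simp [Finsupp.degree_eq_sum]
      -- A monomial divisible by the leading form of a curve is rewritten into terms of smaller
      -- total degree, so the induction on the degree applies.
      have red : ∀ (i : Fin 2) (r : ℕ) (w : MvPolynomial (Fin 2) P), w ∈ I → r ≤ d i →
          (∀ e ∈ (w - MvPolynomial.X i ^ r).support, e.degree < r) →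
          Ideal.Quotient.mk I (MvPolynomial.monomial d (1 : P)) ∈ S := by
        intro i r w hw hr hlt
        set d' : Fin 2 →₀ ℕ := d - Finsupp.single i r with hd'
        have hdd : d' + Finsupp.single i r = d := by
          rw [hd']
          exact tsub_add_cancel_of_le (by simpa using hr)
        have hdegd : d'.degree + r = N := by
          rw [← hd, ← hdd, map_add, Finsupp.degree_single]
        have h1 : Ideal.Quotient.mk I (MvPolynomial.monomial d (1 : P)) =
            Ideal.Quotient.mk I
              (-(MvPolynomial.monomial d' 1 * (w - MvPolynomial.X i ^ r))) := by
          rw [Ideal.Quotient.eq]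
          have h2 : (MvPolynomial.monomial d (1 : P)) =
              MvPolynomial.monomial d' 1 * MvPolynomial.X i ^ r := by
            rw [MvPolynomial.X_pow_eq_monomial, MvPolynomial.monomial_mul, hdd, one_mul]
          rw [h2]
          have h3 : MvPolynomial.monomial d' 1 * MvPolynomial.X i ^ r -
              -(MvPolynomial.monomial d' 1 * (w - MvPolynomial.X i ^ r)) =
              MvPolynomial.monomial d' 1 * w := by ring
          rw [h3]
          exact I.mul_mem_left _ hw
        rw [h1, map_neg, MvPolynomial.as_sum (w - MvPolynomial.X i ^ r), Finset.mul_sum, map_sum]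
        refine Submodule.neg_mem _ (Submodule.sum_mem _ fun e he => ?_)
        rw [MvPolynomial.monomial_mul, one_mul, hsmul]
        refine Submodule.smul_mem _ _ (ih (d' + e).degree ?_ _ rfl)
        have := hlt e he
        rw [map_add]
        omega
      by_cases h0 : m ≤ d 0
      · exact red 0 m f hfI h0 hf
      by_cases h1 : n ≤ d 1
      · exact red 1 n g hgI h1 hg
      push Not at h0 h1
      refine Submodule.subset_span ⟨(⟨d 0, h0⟩, ⟨d 1, h1⟩), ?_⟩
      simp only
      congr 1
      rw [MvPolynomial.monomial_eq, Finsupp.prod_fintype _ _ (by simp)]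
      simp
  rw [eq_top_iff]
  rintro x -
  obtain ⟨q, rfl⟩ := Ideal.Quotient.mk_surjective x
  rw [MvPolynomial.as_sum q, map_sum]
  refine Submodule.sum_mem _ fun d _ => ?_
  rw [hsmul]
  exact Submodule.smul_mem _ _ (key _ d rfl)

/-- Two plane curves with leading forms `X₀ ^ m` and `X₁ ^ n` have at most `m * n` common points. -/
theorem card_common_zeros_le (m n : ℕ) (f g : MvPolynomial (Fin 2) ℂ)
    (hf : ∀ d ∈ (f - MvPolynomial.X 0 ^ m).support, d.degree < m)
    (hg : ∀ d ∈ (g - MvPolynomial.X 1 ^ n).support, d.degree < n)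
    (Z : Finset (Fin 2 → ℂ))
    (hZ : ∀ x ∈ Z, MvPolynomial.eval x f = 0 ∧ MvPolynomial.eval x g = 0) :
    Z.card ≤ m * n := by
  set I : Ideal (MvPolynomial (Fin 2) ℂ) := Ideal.span {f, g} with hI
  have hfI : f ∈ I := Ideal.subset_span (by simp)
  have hgI : g ∈ I := Ideal.subset_span (by simp)
  have hspan := span_monomials_quotient_eq_top m n f g I hfI hgI hf hg
  have hfin : Module.Finite ℂ (MvPolynomial (Fin 2) ℂ ⧸ I) :=
    ⟨(hspan ▸ Submodule.fg_span (Set.finite_range _))⟩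
  have hrank : Module.finrank ℂ (MvPolynomial (Fin 2) ℂ ⧸ I) ≤ m * n := by
    rw [← finrank_top ℂ, ← hspan]
    refine (finrank_range_le_card _).trans ?_
    simp
  -- Common zeros are distinct characters of the quotient algebra, and there are at most as many of
  -- these as its dimension.
  let ev : Z → (MvPolynomial (Fin 2) ℂ ⧸ I →ₐ[ℂ] ℂ) := fun x =>
    Ideal.Quotient.liftₐ I (MvPolynomial.aeval (x : Fin 2 → ℂ)) (by
      intro a ha
      have hle : I ≤ RingHom.ker (MvPolynomial.aeval (R := ℂ) (x : Fin 2 → ℂ)).toRingHom := by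
        rw [hI, Ideal.span_le]
        intro p hp
        rcases hp with rfl | hp
        · exact (hZ x x.2).1
        · rw [Set.mem_singleton_iff.1 hp]
          exact (hZ x x.2).2
      exact hle ha)
  have hinj : Function.Injective ev := by
    intro x y hxy
    apply Subtype.ext
    funext i
    have hev : ∀ (x : Z) (i : Fin 2),
        ev x (Ideal.Quotient.mk I (MvPolynomial.X i)) = (x : Fin 2 → ℂ) i :=
      fun x i => MvPolynomial.aeval_X (R := ℂ) (x : Fin 2 → ℂ) i
    rw [← hev x i, ← hev y i, hxy]
  have hcard := Nat.card_le_card_of_injective ev hinj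
  have h2 : Nat.card (MvPolynomial (Fin 2) ℂ ⧸ I →ₐ[ℂ] ℂ) ≤
      Module.finrank ℂ (MvPolynomial (Fin 2) ℂ ⧸ I) := by
    exact card_algHom_le_finrank ℂ _ ℂ
  rw [Nat.card_eq_fintype_card, Fintype.card_coe] at hcard
  omega

/-! ### Recurrences that detect logarithms -/

/-- The solution with `u 0 = 1` of a linear recurrence of order three with empty initial terms. -/
def rec3 {S : Type*} [CommRing S] (p q r : ℕ → S) : ℕ → S
  | 0 => 1
  | 1 => p 0
  | 2 => p 1 * p 0 + q 1
  | n + 3 => p (n + 2) * rec3 p q r (n + 2) + q (n + 2) * rec3 p q r (n + 1)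
      + r (n + 2) * rec3 p q r n

theorem rec3_induction {motive : ℕ → Prop} (h0 : motive 0) (h1 : motive 1) (h2 : motive 2)
    (h : ∀ n, motive n → motive (n + 1) → motive (n + 2) → motive (n + 3)) (n : ℕ) : motive n := by
  have : motive n ∧ motive (n + 1) ∧ motive (n + 2) := by
    induction n with
    | zero => exact ⟨h0, h1, h2⟩
    | succ n ih => exact ⟨ih.2.1, ih.2.2, h n ih.1 ih.2.1 ih.2.2⟩
  exact this.1

theorem map_rec3 {S S' : Type*} [CommRing S] [CommRing S'] (φ : S →+* S') (p q r : ℕ → S) (n : ℕ) :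
    φ (rec3 p q r n) = rec3 (fun i => φ (p i)) (fun i => φ (q i)) (fun i => φ (r i)) n := by
  induction n using rec3_induction with
  | h0 => simp [rec3]
  | h1 => simp [rec3]
  | h2 => simp [rec3]
  | h n h0 h1 h2 => simp [rec3, h0, h1, h2]

/-- With weights 1, 2, 3 on the three coefficients, term `n` has weight `n`. Both the homogeneity in
the accessory variables and the rescaling by `h` come from this. -/
theorem rec3_scale {S : Type*} [CommRing S] (t : S) (p q r : ℕ → S) (n : ℕ) :
    rec3 (fun i => t * p i) (fun i => t ^ 2 * q i) (fun i => t ^ 3 * r i) n =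
      t ^ n * rec3 p q r n := by
  induction n using rec3_induction with
  | h0 => simp [rec3]
  | h1 => simp [rec3]
  | h2 => simp only [rec3]; ring
  | h n h0 h1 h2 => simp only [rec3, h0, h1, h2]; ring

/-- This is the shape of the recurrence on the hyperplane `h = 0`. -/
theorem rec3_eq_prod {S : Type*} [CommRing S] (p : ℕ → S) (n : ℕ) :
    rec3 p (fun _ => 0) (fun _ => 0) n = ∏ i ∈ Finset.range n, p i := by
  induction n using rec3_induction with
  | h0 => simp [rec3]
  | h1 => simp [rec3]
  | h2 => simp [rec3, Finset.prod_range_succ, mul_comm]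
  | h n h0 h1 h2 => simp [rec3, h2, Finset.prod_range_succ _ (n + 2), mul_comm]

/-- The scaled value of `δ`. -/
def scaledDelta {S : Type*} [CommRing S] (k l : ℕ) (v : Fin 6 → S) : S :=
  v 5 + v 0 + v 5 * v 1 - v 2 + v 5 * (k + l)

/-- The recursion at the point `a`; the parameters are
`v = (h α, β, h γ, a, a₁, h)`, and `s` makes the terms homogeneous in `(s, Y, Y₁)`. -/
def apparentRec {S : Type*} [CommRing S] (k l : ℕ) (v : Fin 6 → S) (s Y Y₁ : S) : ℕ → S :=
  rec3
    (fun n => s * (v 5 * (v 3 * (v 3 - 1) + (2 * v 3 - 1) * (v 3 - v 4)) * (n * (n - 1 - k))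
      + (v 2 * (v 3 - 1) * (v 3 - v 4) + scaledDelta k l v * v 3 * (v 3 - v 4)
        - v 5 * l * v 3 * (v 3 - 1)) * n) + Y)
    (fun n => n * (k + 1 - n) * (v 3 * (v 3 - 1)) * v 5 * s *
      (s * ((v 3 - v 4) * (v 5 * (3 * v 3 - 1 - v 4) * ((n - 1) * (n - 2 - k))
        + (v 2 * (2 * v 3 - 1 - v 4) + scaledDelta k l v * (2 * v 3 - v 4)
          - v 5 * l * (2 * v 3 - 1)) * (n - 1)) + v 0 * v 1 * (v 3 - v 4) ^ 2) + (Y - Y₁)))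
    (fun n => s ^ 3 * v 5 ^ 2 * (v 3 * (v 3 - 1) * (v 3 - v 4)) ^ 2 *
      (n * (k + 1 - n) * ((n - 1) * (k + 2 - n))) * ((v 5 * (n - 2) + v 0) * (n - 2 + v 1)))

/-- The recursion for the coefficients of the power series solution at `0`, with the conventions of
`apparentRec`. -/
def originRec {S : Type*} [CommRing S] (k l : ℕ) (v : Fin 6 → S) (Y Y₁ : S) : ℕ → S :=
  rec3
    (fun n => (v 3 - v 4) * (v 5 * (v 3 + v 4 + v 3 * v 4) * (n * (n - 1))
      + (v 2 * (v 3 + v 4 + v 3 * v 4) + scaledDelta k l v * v 3 * v 4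
        - v 5 * k * v 4 - v 5 * l * v 3) * n)
      + (v 3 - v 4) * v 0 * v 1 * v 3 * v 4 - (v 4 * Y - v 3 * Y₁))
    (fun n => (v 3 - v 4) * v 3 * v 4 * n * (v 5 * (n - 1) + v 2) *
      ((v 3 - v 4) * (-v 5 * (1 + v 3 + v 4) * ((n - 1) * (n - 2))
        - (v 2 * (1 + v 3 + v 4) + scaledDelta k l v * (v 3 + v 4)
          - v 5 * k * (1 + v 4) - v 5 * l * (1 + v 3)) * (n - 1))
        - ((v 3 - v 4) * v 0 * v 1 * (v 3 + v 4) - (Y - Y₁))))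
    (fun n => ((v 3 - v 4) * v 3 * v 4) ^ 2 * (n * (v 5 * (n - 1) + v 2)) *
      ((n - 1) * (v 5 * (n - 2) + v 2)) * (v 3 - v 4) * ((v 5 * (n - 2) + v 0) * (n - 2 + v 1)))

/-- The parameters with `a` and `a₁` exchanged. -/
def swapPoints {S : Type*} (v : Fin 6 → S) : Fin 6 → S := ![v 0, v 1, v 2, v 4, v 3, v 5]

theorem map_apparentRec {S S' : Type*} [CommRing S] [CommRing S'] (φ : S →+* S') (k l : ℕ)
    (v : Fin 6 → S) (s Y Y₁ : S) (n : ℕ) :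
    φ (apparentRec k l v s Y Y₁ n) = apparentRec k l (φ ∘ v) (φ s) (φ Y) (φ Y₁) n := by
  simp [apparentRec, map_rec3, scaledDelta, map_ofNat]

theorem map_originRec {S S' : Type*} [CommRing S] [CommRing S'] (φ : S →+* S') (k l : ℕ)
    (v : Fin 6 → S) (Y Y₁ : S) (n : ℕ) :
    φ (originRec k l v Y Y₁ n) = originRec k l (φ ∘ v) (φ Y) (φ Y₁) n := by
  simp [originRec, map_rec3, scaledDelta, map_ofNat]

theorem comp_swapPoints {S S' : Type*} (φ : S → S') (v : Fin 6 → S) :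
    φ ∘ swapPoints v = swapPoints (φ ∘ v) := by
  funext i
  fin_cases i <;> rfl

theorem apparentRec_homogeneous {S : Type*} [CommRing S] (k l : ℕ) (v : Fin 6 → S)
    (t s Y Y₁ : S) (n : ℕ) :
    apparentRec k l v (t * s) (t * Y) (t * Y₁) n = t ^ n * apparentRec k l v s Y Y₁ n := by
  rw [apparentRec, apparentRec, ← rec3_scale]
  congr 1 <;> funext n <;> ring

/-- The parameters `(h α, β, h γ, a, a₁, h)`. -/
def scaledParams {S : Type*} [CommRing S] (h α β γ a a₁ : S) : Fin 6 → S :=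
  ![h * α, β, h * γ, a, a₁, h]

/-- The parameter `h` only rescales the equation, so every `h ≠ 0` describes the original problem.
The value `h = 0` is a new, degenerate point, where the equation drops to order one. -/
theorem apparentRec_scaledParams {S : Type*} [CommRing S] (k l : ℕ) (h α β γ a a₁ Y Y₁ : S)
    (n : ℕ) :
    apparentRec k l (scaledParams h α β γ a a₁) 1 (h * Y) (h * Y₁) n =
      h ^ n * apparentRec k l (scaledParams 1 α β γ a a₁) 1 Y Y₁ n := by
  rw [apparentRec, apparentRec, ← rec3_scale]
  congr 1 <;> funext n <;> simp [scaledParams, scaledDelta] <;> ring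

theorem originRec_scaledParams {S : Type*} [CommRing S] (k l : ℕ) (h α β γ a a₁ Y Y₁ : S)
    (n : ℕ) :
    originRec k l (scaledParams h α β γ a a₁) (h * Y) (h * Y₁) n =
      h ^ n * originRec k l (scaledParams 1 α β γ a a₁) Y Y₁ n := by
  rw [originRec, originRec, ← rec3_scale]
  congr 1 <;> funext n <;> simp [scaledParams, scaledDelta] <;> ring

theorem swapPoints_scaledParams {S : Type*} [CommRing S] (h α β γ a a₁ : S) :
    swapPoints (scaledParams h α β γ a a₁) = scaledParams h α β γ a₁ a := by
  funext i
  fin_cases i <;> rfl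

/-- `F n a` stands for "`a` has degree at most `n`". Only `p` reaches its weight, with leading part
`x`; `q` and `r` stay below the weights 2 and 3, so the leading part of the solution is a power of
`x`. The abstract filtration serves both the total degree and the degree in one variable. -/
theorem rec3_filtered {S : Type*} [CommRing S] (F : ℕ → S → Prop) (hF1 : F 0 1)
    (hadd : ∀ {n a b}, F n a → F n b → F n (a + b))
    (hmul : ∀ {m n a b}, F m a → F n b → F (m + n) (a * b))
    (hmono : ∀ {n a}, F n a → F (n + 1) a)
    (p q r : ℕ → S) (x : S) (hx : F 1 x) (hp : ∀ n, F 0 (p n - x)) (hq : ∀ n, F 1 (q n))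
    (hr : ∀ n, F 0 (r n)) (n : ℕ) :
    F n (rec3 p q r n) ∧ F n (rec3 p q r (n + 1) - x ^ (n + 1)) := by
  have hmul' : ∀ {m n N a b}, F m a → F n b → m + n = N → F N (a * b) := by
    rintro m n N a b ha hb rfl
    exact hmul ha hb
  have hp1 : ∀ n, F 1 (p n) := fun n => by
    simpa using hadd (hmono (hp n)) hx
  have h2 : F 2 (rec3 p q r 2) := by
    simp only [rec3]
    exact hadd (hmul (hp1 1) (hp1 0)) (hmono (hq 1))
  have h1 : F 1 (rec3 p q r 2 - x ^ 2) := by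
    have : rec3 p q r 2 - x ^ 2 = (p 1 - x) * p 0 + (p 0 - x) * x + q 1 := by
      simp only [rec3]; ring
    rw [this]
    exact hadd (hadd (hmul' (hp 1) (hp1 0) rfl) (hmul' (hp 0) hx rfl)) (hq 1)
  have step : ∀ n, F n (rec3 p q r n) → F (n + 1) (rec3 p q r (n + 1)) →
      F (n + 2) (rec3 p q r (n + 2)) → F (n + 1) (rec3 p q r (n + 2) - x ^ (n + 2)) →
      F (n + 3) (rec3 p q r (n + 3)) ∧ F (n + 2) (rec3 p q r (n + 3) - x ^ (n + 3)) := by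
    intro n i0 i1 i2 i3
    have h4 : F (n + 2) (q (n + 2) * rec3 p q r (n + 1) + r (n + 2) * rec3 p q r n) :=
      hadd (hmul' (hq _) i1 (by ring)) (hmono (hmono (hmul' (hr _) i0 (by ring))))
    constructor
    · rw [rec3, add_assoc]
      exact hadd (hmul' (hp1 _) i2 (by ring)) (hmono h4)
    · have : rec3 p q r (n + 3) - x ^ (n + 3) = (p (n + 2) - x) * rec3 p q r (n + 2) +
          x * (rec3 p q r (n + 2) - x ^ (n + 2)) +
          (q (n + 2) * rec3 p q r (n + 1) + r (n + 2) * rec3 p q r n) := by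
        rw [rec3]; ring
      rw [this]
      exact hadd (hadd (hmul' (hp _) i2 (by ring)) (hmul' hx i3 (by ring))) h4
  have main : ∀ n, F n (rec3 p q r n) ∧ F (n + 1) (rec3 p q r (n + 1)) ∧
      F (n + 2) (rec3 p q r (n + 2)) ∧ F n (rec3 p q r (n + 1) - x ^ (n + 1)) ∧
      F (n + 1) (rec3 p q r (n + 2) - x ^ (n + 2)) := by
    intro n
    induction n with
    | zero => exact ⟨hF1, hp1 0, h2, by simpa [rec3] using hp 0, h1⟩
    | succ n ih =>
      have := step n ih.1 ih.2.1 ih.2.2.1 ih.2.2.2.2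
      exact ⟨ih.2.1, ih.2.2.1, this.1, ih.2.2.2.2, this.2⟩
  exact ⟨(main n).1, (main n).2.2.2.1⟩

theorem apparentRec_filtered {P S : Type*} [CommRing P] [CommRing S] (φ : P →+* S)
    (F : ℕ → S → Prop) (hF : ∀ c, F 0 (φ c))
    (hadd : ∀ {n a b}, F n a → F n b → F n (a + b))
    (hmul : ∀ {m n a b}, F m a → F n b → F (m + n) (a * b))
    (hmono : ∀ {n a}, F n a → F (n + 1) a) (k l : ℕ) (v : Fin 6 → P) (s : P) (Y Y₁ : S)
    (hY : F 1 Y) (hYY : F 1 (Y - Y₁)) (n : ℕ) :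
    F n (apparentRec k l (φ ∘ v) (φ s) Y Y₁ (n + 1) - Y ^ (n + 1)) := by
  rw [apparentRec]
  refine (rec3_filtered F (by simpa using hF 1) hadd hmul hmono _ _ _ Y hY ?_ ?_ ?_ n).2
  · intro n
    rw [add_sub_cancel_right]
    simp only [Function.comp, ← map_natCast φ, ← map_ofNat φ, ← map_one φ, scaledDelta, ← map_sub,
      ← map_add, ← map_mul]
    exact hF _
  · intro n
    simp only [Function.comp, ← map_natCast φ, ← map_ofNat φ, ← map_one φ, scaledDelta, ← map_sub,
      ← map_add, ← map_mul, ← map_pow]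
    exact hmul (hF _) (hadd (hmono (hF _)) hYY)
  · intro n
    simp only [Function.comp, ← map_natCast φ, ← map_ofNat φ, ← map_one φ, ← map_sub,
      ← map_add, ← map_mul, ← map_pow]
    exact hF _

/-- The equation of the parameters with a non-logarithmic point `a`, in the accessory
variables. -/
noncomputable def apparentPoly {P : Type} [CommRing P] (k l : ℕ) (v : Fin 6 → P) :
    MvPolynomial (Fin 2) P :=
  apparentRec k l (MvPolynomial.C ∘ v) 1 (MvPolynomial.X 0) (MvPolynomial.X 1) (k + 1)

/-- The equation of the parameters with a non-logarithmic point `a₁`, in the accessory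
variables. -/
noncomputable def apparentPoly₁ {P : Type} [CommRing P] (k l : ℕ) (v : Fin 6 → P) :
    MvPolynomial (Fin 2) P :=
  apparentRec l k (MvPolynomial.C ∘ swapPoints v) 1 (MvPolynomial.X 1) (MvPolynomial.X 0) (l + 1)

/-- A pure power as leading form keeps intersection points from escaping to infinity, uniformly in
the parameters. -/
theorem apparentRec_support {P : Type} [CommRing P] (k l : ℕ) (v : Fin 6 → P) (i j : Fin 2)
    (n : ℕ) : ∀ d ∈ (apparentRec k l (MvPolynomial.C ∘ v) 1 (MvPolynomial.X i : MvPolynomial _ P)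
      (MvPolynomial.X j) (n + 1) - MvPolynomial.X i ^ (n + 1)).support, d.degree < n + 1 := by
  have hX : ∀ i : Fin 2, (MvPolynomial.X i : MvPolynomial (Fin 2) P).totalDegree ≤ 1 := fun i => by
    refine (MvPolynomial.totalDegree_monomial_le _ _).trans ?_
    simp
  have := apparentRec_filtered (MvPolynomial.C (σ := Fin 2) (R := P))
    (fun n (p : MvPolynomial (Fin 2) P) => p.totalDegree ≤ n) (by simp)
    (fun ha hb => (MvPolynomial.totalDegree_add _ _).trans (max_le ha hb))
    (fun ha hb => (MvPolynomial.totalDegree_mul _ _).trans (add_le_add ha hb))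
    (fun h => h.trans (Nat.le_succ _)) k l v 1 (MvPolynomial.X i) (MvPolynomial.X j) (hX i)
    ((MvPolynomial.totalDegree_sub _ _).trans (max_le (hX _) (hX _))) n
  intro d hd
  rw [← map_one (MvPolynomial.C (σ := Fin 2) (R := P))] at hd
  exact Nat.lt_succ_of_le ((MvPolynomial.le_totalDegree hd).trans this)

theorem eval₂_apparentPoly {P R : Type} [CommRing P] [CommRing R] (φ : P →+* R) (k l : ℕ)
    (v : Fin 6 → P) (x : Fin 2 → R) :
    MvPolynomial.eval₂ φ x (apparentPoly k l v) =
      apparentRec k l (φ ∘ v) 1 (x 0) (x 1) (k + 1) := by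
  rw [apparentPoly, ← MvPolynomial.coe_eval₂Hom, map_apparentRec, ← Function.comp_assoc]
  congr 1 <;> simp [Function.comp_def]

theorem eval₂_apparentPoly₁ {P R : Type} [CommRing P] [CommRing R] (φ : P →+* R) (k l : ℕ)
    (v : Fin 6 → P) (x : Fin 2 → R) :
    MvPolynomial.eval₂ φ x (apparentPoly₁ k l v) =
      apparentRec l k (swapPoints (φ ∘ v)) 1 (x 1) (x 0) (l + 1) := by
  rw [apparentPoly₁, ← MvPolynomial.coe_eval₂Hom, map_apparentRec, ← Function.comp_assoc,
    ← comp_swapPoints]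
  congr 1 <;> simp [Function.comp_def]

/-- The two conditions of a common point of the two curves. -/
def IsApparentPair (k l : ℕ) (v : Fin 6 → ℂ) (y y₁ : ℂ) : Prop :=
  apparentRec k l v 1 y y₁ (k + 1) = 0 ∧ apparentRec l k (swapPoints v) 1 y₁ y (l + 1) = 0

/-- The quotient by the two curves and `g` is finite over `P`. If it is trivial over the point `φ`,
Nakayama's lemma puts an element `G` of the base into the ideal, and wherever `G` is nonzero there
is no common zero. -/
theorem exists_generic_ne_zero {P : Type} [CommRing P] [Algebra ℂ P] (k l : ℕ) (v : Fin 6 → P)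
    (g : MvPolynomial (Fin 2) P) (φ : P →ₐ[ℂ] ℂ)
    (h : ∀ y y₁ : ℂ, IsApparentPair k l (φ ∘ v) y y₁ →
      MvPolynomial.eval₂ (φ : P →+* ℂ) ![y, y₁] g ≠ 0) :
    ∃ G : P, φ G = 1 ∧ ∀ ψ : P →+* ℂ, ψ G ≠ 0 → ∀ y y₁ : ℂ, IsApparentPair k l (ψ ∘ v) y y₁ →
      MvPolynomial.eval₂ ψ ![y, y₁] g ≠ 0 := by
  set I : Ideal (MvPolynomial (Fin 2) P) :=
    Ideal.span {apparentPoly k l v, apparentPoly₁ k l v, g} with hI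
  have h0 : apparentPoly k l v ∈ I := Ideal.subset_span (by simp)
  have h1 : apparentPoly₁ k l v ∈ I := Ideal.subset_span (by simp)
  have h2 : g ∈ I := Ideal.subset_span (by simp)
  have hspan := span_monomials_quotient_eq_top (k + 1) (l + 1) _ _ I h0 h1
    (apparentRec_support k l v 0 1 k) (apparentRec_support l k (swapPoints v) 1 0 l)
  have hfin : Module.Finite P (MvPolynomial (Fin 2) P ⧸ I) :=
    ⟨hspan ▸ Submodule.fg_span (Set.finite_range _)⟩
  obtain ⟨G, hG1, hG⟩ := exists_C_mem_ideal_of_no_zero I φ (by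
    intro x
    have hx : x = ![x 0, x 1] := by
      funext i
      fin_cases i <;> rfl
    by_contra hcon
    push Not at hcon
    refine h (x 0) (x 1) ⟨?_, ?_⟩ (hx ▸ hcon g h2)
    · rw [← hcon _ h0, eval₂_apparentPoly]
      rfl
    · rw [← hcon _ h1, eval₂_apparentPoly₁]
      rfl)
  refine ⟨G, hG1, fun ψ hψ y y₁ hy hg => hψ ?_⟩
  have hle : I ≤ RingHom.ker (MvPolynomial.eval₂Hom ψ ![y, y₁]) := by
    rw [hI, Ideal.span_le]
    rintro p (rfl | rfl | rfl)
    · simp only [SetLike.mem_coe, RingHom.mem_ker, MvPolynomial.coe_eval₂Hom, eval₂_apparentPoly]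
      exact hy.1
    · simp only [SetLike.mem_coe, RingHom.mem_ker, MvPolynomial.coe_eval₂Hom, eval₂_apparentPoly₁]
      exact hy.2
    · exact hg
  have := hle hG
  rwa [RingHom.mem_ker, MvPolynomial.coe_eval₂Hom, MvPolynomial.eval₂_C] at this

theorem card_apparentPairs_le (k l : ℕ) (v : Fin 6 → ℂ) (Z : Finset (Fin 2 → ℂ))
    (hZ : ∀ x ∈ Z, IsApparentPair k l v (x 0) (x 1)) : Z.card ≤ (k + 1) * (l + 1) := by
  refine card_common_zeros_le (k + 1) (l + 1) (apparentPoly k l v) (apparentPoly₁ k l v)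
    (apparentRec_support k l v 0 1 k) (apparentRec_support l k (swapPoints v) 1 0 l) Z ?_
  intro x hx
  rw [MvPolynomial.eval, MvPolynomial.coe_eval₂Hom, eval₂_apparentPoly, eval₂_apparentPoly₁]
  exact hZ x hx

/-! ### Elimination along the lines `Y - Y₁ = x` -/

/-- The first curve on the line `Y - Y₁ = x`, as a polynomial in `Y`. -/
noncomputable def lineCurve {R : Type*} [CommRing R] (k l : ℕ) (v : Fin 6 → R) (s x : R) :
    Polynomial R :=
  apparentRec k l (Polynomial.C ∘ v) (Polynomial.C s) Polynomial.X
    (Polynomial.X - Polynomial.C x) (k + 1)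

/-- The second curve on the line `Y - Y₁ = x`, as a polynomial in `Y`. -/
noncomputable def lineCurve₁ {R : Type*} [CommRing R] (k l : ℕ) (v : Fin 6 → R) (s x : R) :
    Polynomial R :=
  apparentRec l k (Polynomial.C ∘ swapPoints v) (Polynomial.C s)
    (Polynomial.X - Polynomial.C x) Polynomial.X (l + 1)

theorem monic_of_natDegree_sub_pow_le {R : Type*} [CommRing R] [Nontrivial R] {p : Polynomial R}
    {c : R} {n : ℕ} (h : (p - (Polynomial.X - Polynomial.C c) ^ (n + 1)).natDegree ≤ n) :
    p.Monic ∧ p.natDegree = n + 1 := by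
  have hm := (Polynomial.monic_X_sub_C c).pow (n + 1)
  have hd : ((Polynomial.X - Polynomial.C c) ^ (n + 1)).natDegree = n + 1 := by
    rw [Polynomial.natDegree_pow' (by simp), Polynomial.natDegree_X_sub_C, mul_one]
  have hlt : (p - (Polynomial.X - Polynomial.C c) ^ (n + 1)).degree <
      ((Polynomial.X - Polynomial.C c) ^ (n + 1)).degree := by
    rw [Polynomial.degree_eq_natDegree hm.ne_zero, hd]
    exact Polynomial.degree_le_natDegree.trans_lt (by exact_mod_cast Nat.lt_succ_of_le h)
  have hp : p = (Polynomial.X - Polynomial.C c) ^ (n + 1) +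
      (p - (Polynomial.X - Polynomial.C c) ^ (n + 1)) := by ring
  constructor
  · rw [hp]
    exact hm.add_of_left hlt
  · rw [hp, Polynomial.natDegree_add_eq_left_of_degree_lt hlt, hd]

theorem apparentRec_natDegree {R : Type*} [CommRing R] (k l : ℕ) (v : Fin 6 → R)
    (s x x' : R) (n : ℕ) :
    (apparentRec k l (Polynomial.C ∘ v) (Polynomial.C s) (Polynomial.X - Polynomial.C x)
      (Polynomial.X - Polynomial.C x') (n + 1) -
        (Polynomial.X - Polynomial.C x) ^ (n + 1)).natDegree ≤ n :=
  apparentRec_filtered (Polynomial.C : R →+* Polynomial R)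
    (fun n (p : Polynomial R) => p.natDegree ≤ n) (by simp)
    (fun ha hb => (Polynomial.natDegree_add_le _ _).trans (max_le ha hb))
    (fun ha hb => Polynomial.natDegree_mul_le.trans (add_le_add ha hb))
    (fun h => h.trans (Nat.le_succ _)) k l v s _ _ (Polynomial.natDegree_X_sub_C_le x)
    ((Polynomial.natDegree_sub_le _ _).trans
      (max_le (Polynomial.natDegree_X_sub_C_le x) (Polynomial.natDegree_X_sub_C_le x'))) n

theorem lineCurve_monic {R : Type*} [CommRing R] [Nontrivial R] (k l : ℕ) (v : Fin 6 → R)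
    (s x : R) : (lineCurve k l v s x).Monic ∧ (lineCurve k l v s x).natDegree = k + 1 := by
  refine monic_of_natDegree_sub_pow_le (c := 0) ?_
  have := apparentRec_natDegree k l v s 0 x k
  rw [map_zero, sub_zero] at this ⊢
  exact this

theorem lineCurve₁_monic {R : Type*} [CommRing R] [Nontrivial R] (k l : ℕ) (v : Fin 6 → R)
    (s x : R) : (lineCurve₁ k l v s x).Monic ∧ (lineCurve₁ k l v s x).natDegree = l + 1 := by
  refine monic_of_natDegree_sub_pow_le (c := x) ?_
  have := apparentRec_natDegree l k (swapPoints v) s x 0 l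
  rw [map_zero, sub_zero] at this
  exact this

theorem map_lineCurve {R R' : Type*} [CommRing R] [CommRing R'] (φ : R →+* R') (k l : ℕ)
    (v : Fin 6 → R) (s x : R) :
    (lineCurve k l v s x).map φ = lineCurve k l (φ ∘ v) (φ s) (φ x) := by
  rw [lineCurve, ← Polynomial.coe_mapRingHom, map_apparentRec]
  simp [lineCurve, ← Function.comp_assoc]
  congr 1
  funext i
  simp

theorem map_lineCurve₁ {R R' : Type*} [CommRing R] [CommRing R'] (φ : R →+* R') (k l : ℕ)
    (v : Fin 6 → R) (s x : R) :
    (lineCurve₁ k l v s x).map φ = lineCurve₁ k l (φ ∘ v) (φ s) (φ x) := by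
  rw [lineCurve₁, ← Polynomial.coe_mapRingHom, map_apparentRec]
  simp [lineCurve₁, ← Function.comp_assoc, ← comp_swapPoints]
  congr 1
  funext i
  simp

theorem eval_lineCurve {R : Type*} [CommRing R] (k l : ℕ) (v : Fin 6 → R) (s x y : R) :
    (lineCurve k l v s x).eval y = apparentRec k l v s y (y - x) (k + 1) := by
  rw [lineCurve, ← Polynomial.coe_evalRingHom, map_apparentRec]
  simp [← Function.comp_assoc]
  congr 1
  funext i
  simp

theorem eval_lineCurve₁ {R : Type*} [CommRing R] (k l : ℕ) (v : Fin 6 → R) (s x y : R) :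
    (lineCurve₁ k l v s x).eval y = apparentRec l k (swapPoints v) s (y - x) y (l + 1) := by
  rw [lineCurve₁, ← Polynomial.coe_evalRingHom, map_apparentRec]
  simp [← Function.comp_assoc]
  congr 1
  funext i
  simp

/-- The resultant of the two curves on the line `Y - Y₁ = x`. -/
noncomputable def lineResultant {R : Type*} [CommRing R] (k l : ℕ) (v : Fin 6 → R) (s x : R) : R :=
  Polynomial.resultant (lineCurve k l v s x) (lineCurve₁ k l v s x) (k + 1) (l + 1)

theorem map_lineResultant {R R' : Type*} [CommRing R] [CommRing R'] (φ : R →+* R') (k l : ℕ)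
    (v : Fin 6 → R) (s x : R) :
    φ (lineResultant k l v s x) = lineResultant k l (φ ∘ v) (φ s) (φ x) := by
  rw [lineResultant, ← Polynomial.resultant_map_map, map_lineCurve, map_lineCurve₁, lineResultant]

/-- On each line both curves are monic in `Y`, so no common root is lost at infinity. -/
theorem lineResultant_eq_zero_iff (k l : ℕ) (v : Fin 6 → ℂ) (x : ℂ) :
    lineResultant k l v 1 x = 0 ↔ ∃ y, IsApparentPair k l v y (y - x) := by
  have h1 := lineCurve_monic k l v 1 x
  have h2 := lineCurve₁_monic k l v 1 x
  have h3 : lineResultant k l v 1 x =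
      Polynomial.resultant (lineCurve k l v 1 x) (lineCurve₁ k l v 1 x) := by
    rw [lineResultant, h1.2, h2.2]
  rw [h3, Polynomial.resultant_eq_zero_iff,
    Polynomial.isCoprime_iff_aeval_ne_zero_of_isAlgClosed ℂ ℂ]
  push Not
  simp only [Polynomial.coe_aeval_eq_eval, eval_lineCurve, eval_lineCurve₁, IsApparentPair]
  exact ⟨fun h => h.2, fun h => ⟨Or.inl h1.1.ne_zero, h⟩⟩

/-- Homogeneity in `(s, Y, Y₁)` moves the line at `x` with `s = 1` to the line at `1` with `s =
x⁻¹`. -/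
theorem lineCurve_eq_scaleRoots (k l : ℕ) (v : Fin 6 → ℂ) (x : ℂ) (hx : x ≠ 0) :
    lineCurve k l v 1 x = (lineCurve k l v x⁻¹ 1).scaleRoots x := by
  refine Polynomial.funext fun y => ?_
  obtain ⟨t, rfl⟩ : ∃ t, y = x * t := ⟨x⁻¹ * y, by field_simp⟩
  have := Polynomial.scaleRoots_eval₂_mul (p := lineCurve k l v x⁻¹ 1) (RingHom.id ℂ) t x
  simp only [RingHom.id_apply, Polynomial.eval₂_id] at this
  rw [this, (lineCurve_monic k l v x⁻¹ 1).2, eval_lineCurve, eval_lineCurve,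
    ← apparentRec_homogeneous]
  congr 1
  · field_simp
  · ring

theorem lineCurve₁_eq_scaleRoots (k l : ℕ) (v : Fin 6 → ℂ) (x : ℂ) (hx : x ≠ 0) :
    lineCurve₁ k l v 1 x = (lineCurve₁ k l v x⁻¹ 1).scaleRoots x := by
  refine Polynomial.funext fun y => ?_
  obtain ⟨t, rfl⟩ : ∃ t, y = x * t := ⟨x⁻¹ * y, by field_simp⟩
  have := Polynomial.scaleRoots_eval₂_mul (p := lineCurve₁ k l v x⁻¹ 1) (RingHom.id ℂ) t x
  simp only [RingHom.id_apply, Polynomial.eval₂_id] at this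
  rw [this, (lineCurve₁_monic k l v x⁻¹ 1).2, eval_lineCurve₁, eval_lineCurve₁,
    ← apparentRec_homogeneous]
  congr 1
  · field_simp
  · ring

theorem lineResultant_scale (k l : ℕ) (v : Fin 6 → ℂ) (x : ℂ) (hx : x ≠ 0) :
    lineResultant k l v 1 x = x ^ ((k + 1) * (l + 1)) * lineResultant k l v x⁻¹ 1 := by
  have := Polynomial.resultant_scaleRoots (lineCurve k l v x⁻¹ 1) (lineCurve₁ k l v x⁻¹ 1) x
  rw [← lineCurve_eq_scaleRoots k l v x hx, ← lineCurve₁_eq_scaleRoots k l v x hx,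
    (lineCurve_monic _ _ _ _ _).2, (lineCurve_monic _ _ _ _ _).2, (lineCurve₁_monic _ _ _ _ _).2,
    (lineCurve₁_monic _ _ _ _ _).2] at this
  exact this

/-- `p` is `x ^ d` times a polynomial in `x⁻¹`. Clearing the denominator with the reverse of `q` and
comparing degrees gives the bound. -/
theorem natDegree_le_of_eval_eq {p q : Polynomial ℂ} {d : ℕ}
    (h : ∀ x : ℂ, x ≠ 0 → p.eval x = x ^ d * q.eval x⁻¹) : p.natDegree ≤ d := by
  by_cases hp : p = 0
  · simp [hp]
  have hq : p * Polynomial.X ^ q.natDegree = Polynomial.X ^ d * q.reverse := by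
    refine Polynomial.eq_of_infinite_eval_eq _ _ (Set.Infinite.mono ?_
      (Set.infinite_univ.sdiff (Set.finite_singleton (0 : ℂ))))
    intro x hx
    have hx0 : x ≠ 0 := by simpa using hx
    have := invertibleOfNonzero (inv_ne_zero hx0)
    have h1 := Polynomial.eval₂_reverse_mul_pow (RingHom.id ℂ) x⁻¹ q
    rw [invOf_eq_inv, inv_inv, Polynomial.eval₂_id, Polynomial.eval₂_id] at h1
    simp only [Set.mem_ofPred_eq, Polynomial.eval_mul, Polynomial.eval_pow, Polynomial.eval_X]
    have h2 : x⁻¹ ^ q.natDegree * x ^ q.natDegree = 1 := by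
      rw [← mul_pow, inv_mul_cancel₀ hx0, one_pow]
    rw [h x hx0, ← h1]
    linear_combination (x ^ d * Polynomial.eval x q.reverse) * h2
  have hd := congrArg Polynomial.natDegree hq
  rw [Polynomial.natDegree_mul_X_pow (hp := hp)] at hd
  have h2 : (Polynomial.X ^ d * q.reverse).natDegree ≤ d + q.natDegree :=
    Polynomial.natDegree_mul_le.trans (add_le_add (Polynomial.natDegree_X_pow_le d)
      (Polynomial.reverse_natDegree_le q))
  omega

/-- The polynomial in `x` of the lines `Y - Y₁ = x` that contain a common point of the curves. -/
noncomputable def eliminant {P : Type*} [CommRing P] (k l : ℕ) (v : Fin 6 → P) : Polynomial P :=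
  lineResultant k l (Polynomial.C ∘ v) 1 Polynomial.X

theorem eval_map_eliminant {P : Type*} [CommRing P] (φ : P →+* ℂ) (k l : ℕ) (v : Fin 6 → P)
    (x : ℂ) : ((eliminant k l v).map φ).eval x = lineResultant k l (φ ∘ v) 1 x := by
  rw [Polynomial.eval_map, ← Polynomial.coe_eval₂RingHom, eliminant, map_lineResultant]
  simp [← Function.comp_assoc]
  congr 1
  funext i
  simp

/-- After scaling, `x` enters only through `x ^ ((k+1)(l+1))` and a polynomial in `x⁻¹`. This yields
the Bézout degree without expanding the resultant. -/
theorem natDegree_map_eliminant_le {P : Type*} [CommRing P] (φ : P →+* ℂ) (k l : ℕ)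
    (v : Fin 6 → P) : ((eliminant k l v).map φ).natDegree ≤ (k + 1) * (l + 1) := by
  refine natDegree_le_of_eval_eq
    (q := lineResultant k l (Polynomial.C ∘ φ ∘ v) Polynomial.X 1) fun x hx => ?_
  rw [eval_map_eliminant, lineResultant_scale k l _ x hx, ← Polynomial.coe_evalRingHom x⁻¹,
    map_lineResultant]
  simp [← Function.comp_assoc]
  left
  congr 1
  funext i
  simp

/-- `D` distinct roots at `φ` force degree `D` and separability there. Both properties are detected
by `G`, the coefficient in degree `D` times the resultant of `T` with its derivative. -/
theorem exists_separable_specialization {P : Type*} [CommRing P] (T : Polynomial P) (D : ℕ)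
    (hT : ∀ ψ : P →+* ℂ, (T.map ψ).natDegree ≤ D) (φ : P →+* ℂ)
    (hφ : T.map φ ≠ 0) (Z : Finset ℂ) (hZ : ∀ x ∈ Z, (T.map φ).IsRoot x) (hcard : D ≤ Z.card)
    (hD : 0 < D) :
    ∃ G : P, φ G ≠ 0 ∧ ∀ ψ : P →+* ℂ, ψ G ≠ 0 →
      (T.map ψ).natDegree = D ∧ (T.map ψ).Separable := by
  have hsub : Z.val ≤ (T.map φ).roots :=
    (Multiset.le_iff_subset Z.nodup).2 fun x hx => (Polynomial.mem_roots hφ).2 (hZ x hx)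
  have hroots : Multiset.card (T.map φ).roots ≤ (T.map φ).natDegree := Polynomial.card_roots' _
  have hle : Z.card ≤ Multiset.card (T.map φ).roots := Multiset.card_le_card hsub
  have hdeg : (T.map φ).natDegree = D := le_antisymm (hT φ) (hcard.trans (hle.trans hroots))
  have hsep : (T.map φ).Separable := by
    rw [← Polynomial.nodup_roots_iff_of_splits hφ (IsAlgClosed.splits _)]
    have : Z.val = (T.map φ).roots := Multiset.eq_of_le_of_card_le hsub (by
      have := Finset.card_val Z
      omega)
    rw [← this]
    exact Z.nodup
  have hres : ∀ ψ : P →+* ℂ, (T.map ψ).natDegree = D →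
      (ψ (Polynomial.resultant T T.derivative D (D - 1)) = 0 ↔ ¬ (T.map ψ).Separable) := by
    intro ψ hψ
    have h1 : (T.map ψ).derivative.natDegree = D - 1 := by
      rw [Polynomial.natDegree_derivative, hψ]
    have h0 : T.map ψ ≠ 0 := by
      intro h
      rw [h, Polynomial.natDegree_zero] at hψ
      omega
    rw [← Polynomial.resultant_map_map, ← Polynomial.derivative_map, Polynomial.Separable]
    have := Polynomial.resultant_eq_zero_iff (f := T.map ψ) (g := (T.map ψ).derivative)
    rw [hψ, h1] at this
    rw [this]
    simp [h0]
  refine ⟨T.coeff D * Polynomial.resultant T T.derivative D (D - 1), ?_, ?_⟩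
  · rw [map_mul, mul_ne_zero_iff]
    refine ⟨?_, ?_⟩
    · rw [← Polynomial.coeff_map]
      nth_rw 1 [← hdeg]
      rw [Polynomial.coeff_natDegree]
      exact Polynomial.leadingCoeff_ne_zero.2 hφ
    · rw [Ne, hres φ hdeg, not_not]
      exact hsep
  · intro ψ hψ
    rw [map_mul, mul_ne_zero_iff] at hψ
    have hd : (T.map ψ).natDegree = D := by
      refine le_antisymm (hT ψ) (Polynomial.le_natDegree_of_ne_zero ?_)
      rw [Polynomial.coeff_map]
      exact hψ.1
    refine ⟨hd, ?_⟩
    have := hψ.2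
    rwa [Ne, hres ψ hd, not_not] at this

/-! ### The base point with `h = 0` -/

/-- A point on the hyperplane `h = 0` at which the curves split into lines. -/
def basePoint (k : ℕ) : Fin 6 → ℂ := ![1, 1, 1, -1, -(2 * k + 3), 0]

/-- For `h = 0` the lower coefficients of both recurrences vanish and the scaled `δ` is 0. What
remains are products of linear factors with steps `(a - 1)(a - a₁) = -4(k+1)` and `(a₁ - 1)(a₁ - a)
= 4(k+1)(k+2)`. -/
theorem isApparentPair_basePoint_iff (k l : ℕ) (y y₁ : ℂ) :
    IsApparentPair k l (basePoint k) y y₁ ↔ ∃ i ≤ k, ∃ j ≤ l,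
      y = 4 * (k + 1) * i ∧ y₁ = -(4 * (k + 1) * (k + 2) * j) := by
  have e1 : apparentRec k l (basePoint k) 1 y y₁ (k + 1) =
      ∏ n ∈ Finset.range (k + 1), (y - 4 * (k + 1) * n) := by
    rw [← rec3_eq_prod, apparentRec]
    congr 1 <;> funext n <;> simp [basePoint, scaledDelta] <;> ring
  have e2 : apparentRec l k (swapPoints (basePoint k)) 1 y₁ y (l + 1) =
      ∏ n ∈ Finset.range (l + 1), (y₁ + 4 * (k + 1) * (k + 2) * n) := by
    rw [← rec3_eq_prod, apparentRec]
    congr 1 <;> funext n <;> simp [basePoint, scaledDelta, swapPoints] <;> ring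
  rw [IsApparentPair, e1, e2, Finset.prod_eq_zero_iff, Finset.prod_eq_zero_iff]
  simp only [Finset.mem_range, Nat.lt_succ_iff, sub_eq_zero, add_eq_zero_iff_eq_neg]
  constructor
  · rintro ⟨⟨i, hi, h1⟩, ⟨j, hj, h2⟩⟩
    exact ⟨i, hi, j, hj, h1, h2⟩
  · rintro ⟨i, hi, j, hj, h1, h2⟩
    exact ⟨⟨i, hi, h1⟩, ⟨j, hj, h2⟩⟩

/-- The choice `a₁ = -(2k+3)` separates the lines: at the base point `Y - Y₁ = 4(k+1)(i + (k+2)j)`,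
and `i ≤ k` is a digit in base `k+2`, so the `(k+1)(l+1)` values are distinct. -/
theorem eliminant_generic {P : Type*} [CommRing P] (k l : ℕ) (v : Fin 6 → P) (φ : P →+* ℂ)
    (hφ : φ ∘ v = basePoint k) :
    ∃ G : P, φ G ≠ 0 ∧ ∀ ψ : P →+* ℂ, ψ G ≠ 0 →
      ((eliminant k l v).map ψ).natDegree = (k + 1) * (l + 1) ∧
      ((eliminant k l v).map ψ).Separable := by
  set f : ℕ × ℕ → ℂ := fun p => 4 * (k + 1) * (p.1 + (k + 2) * p.2) with hf
  set Z : Finset ℂ := (Finset.range (k + 1) ×ˢ Finset.range (l + 1)).image f with hZ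
  have hroot : ∀ x, ((eliminant k l v).map φ).IsRoot x ↔ x ∈ Z := by
    intro x
    rw [Polynomial.IsRoot, eval_map_eliminant, hφ, lineResultant_eq_zero_iff]
    simp only [isApparentPair_basePoint_iff, hZ, Finset.mem_image, Finset.mem_product,
      Finset.mem_range, Prod.exists, Nat.lt_succ_iff, hf]
    constructor
    · rintro ⟨y, i, hi, j, hj, h1, h2⟩
      exact ⟨i, j, ⟨hi, hj⟩, by linear_combination -h1 + h2⟩
    · rintro ⟨i, j, ⟨hi, hj⟩, h⟩
      exact ⟨4 * (k + 1) * i, i, hi, j, hj, rfl, by rw [← h]; ring⟩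
  have hinj : Set.InjOn f (Finset.range (k + 1) ×ˢ Finset.range (l + 1) : Finset (ℕ × ℕ)) := by
    rintro ⟨i, j⟩ hij ⟨i', j'⟩ hij' h
    simp only [Finset.coe_product, Finset.coe_range, Set.mem_prod, Set.mem_Iio] at hij hij'
    have hk : (4 * ((k : ℂ) + 1)) ≠ 0 := by
      exact_mod_cast (by positivity : 4 * (k + 1) ≠ 0)
    have h1 := mul_left_cancel₀ hk h
    have h2 : i + (k + 2) * j = i' + (k + 2) * j' := by exact_mod_cast h1
    have h3 : i % (k + 2) = i' % (k + 2) := by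
      have := congrArg (· % (k + 2)) h2
      simpa [Nat.add_mul_mod_self_left] using this
    rw [Nat.mod_eq_of_lt (by omega), Nat.mod_eq_of_lt (by omega)] at h3
    subst h3
    have h4 := Nat.eq_of_mul_eq_mul_left (by omega : 0 < k + 2) (Nat.add_left_cancel h2)
    rw [h4]
  refine exists_separable_specialization _ _ (fun ψ => natDegree_map_eliminant_le ψ k l v) φ ?_ Z
    (fun x hx => (hroot x).2 hx) ?_ (by positivity)
  · intro h0
    obtain ⟨x, hx⟩ := Infinite.exists_notMem_finset Z
    exact hx ((hroot x).1 (by rw [h0]; simp))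
  · rw [hZ, Finset.card_image_of_injOn hinj]
    simp

/-! ### Four-term recurrences and formal Euler operators -/

/-- The terms of a linear recurrence of order three, with `b n = 0` for negative `n`. -/
def fourTerm {S : Type*} [CommRing S] (K₀ K₁ K₂ K₃ : ℕ → S) (b : ℕ → S) : ℕ → S
  | 0 => K₀ 0 * b 0
  | 1 => K₀ 1 * b 1 + K₁ 0 * b 0
  | 2 => K₀ 2 * b 2 + K₁ 1 * b 1 + K₂ 0 * b 0
  | n + 3 => K₀ (n + 3) * b (n + 3) + K₁ (n + 2) * b (n + 2) + K₂ (n + 1) * b (n + 1) + K₃ n * b n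

/-- Multiplying by the product of the leading coefficients `w` removes all divisions, so the formula
survives where some `w` vanishes. At such an index it becomes the obstruction to a solution without
logarithm. -/
theorem mul_prod_eq_rec3 {S : Type*} [CommRing S] (p q r w K₁ K₂ K₃ b : ℕ → S) (hp : p = K₁)
    (hq : ∀ n, q (n + 1) = w (n + 1) * K₂ n)
    (hr : ∀ n, r (n + 2) = w (n + 2) * w (n + 1) * K₃ n) (m : ℕ)
    (h : ∀ n < m, fourTerm (fun n => -w n) K₁ K₂ K₃ b (n + 1) = 0) (n : ℕ) (hn : n ≤ m) :
    b n * ∏ j ∈ Finset.range n, w (j + 1) = b 0 * rec3 p q r n := by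
  subst hp
  induction n using rec3_induction with
  | h0 => simp [rec3]
  | h1 =>
    have h1 := h 0 hn
    simp only [fourTerm] at h1
    simp only [Finset.prod_range_succ, Finset.prod_range_zero, rec3, one_mul]
    linear_combination -h1
  | h2 =>
    have h1 := h 0 (by omega)
    have h2 := h 1 hn
    simp only [fourTerm] at h1 h2
    simp only [Finset.prod_range_succ, Finset.prod_range_zero, rec3, one_mul, zero_add, hq 0,
      Nat.reduceAdd] at h1 h2 ⊢
    linear_combination -h1 * p 1 - w 1 * h2
  | h n ih0 ih1 ih2 =>
    have h3 := h (n + 2) (by omega)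
    have i0 := ih0 (by omega)
    have i1 := ih1 (by omega)
    have i2 := ih2 (by omega)
    simp only [fourTerm] at h3
    simp only [Finset.prod_range_succ, rec3, hq, hr] at i0 i1 i2 ⊢
    linear_combination p (n + 2) * i2 + w (n + 2) * K₂ (n + 1) * i1 +
      w (n + 2) * w (n + 1) * K₃ n * i0 -
      (∏ j ∈ Finset.range n, w (j + 1)) * w (n + 1) * w (n + 2) * h3

theorem fourTerm_eq_of_mul_prod_eq_rec3 {S : Type*} [CommRing S] (p q r w K₁ K₂ K₃ b : ℕ → S)
    (hp : p = K₁) (hq : ∀ n, q (n + 1) = w (n + 1) * K₂ n)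
    (hr : ∀ n, r (n + 2) = w (n + 2) * w (n + 1) * K₃ n) (m : ℕ)
    (h : ∀ n ≤ m + 1, b n * ∏ j ∈ Finset.range n, w (j + 1) = b 0 * rec3 p q r n) :
    (∏ j ∈ Finset.range m, w (j + 1)) * fourTerm (fun n => -w n) K₁ K₂ K₃ b (m + 1) = 0 := by
  subst hp
  match m with
  | 0 =>
    have h1 := h 1 (by omega)
    simp only [Finset.prod_range_succ, Finset.prod_range_zero, rec3, fourTerm] at h1 ⊢
    linear_combination -h1
  | 1 =>
    have h1 := h 1 (by omega)
    have h2 := h 2 (by omega)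
    simp only [Finset.prod_range_succ, Finset.prod_range_zero, rec3, fourTerm, hq] at h1 h2 ⊢
    linear_combination p 1 * h1 - h2
  | n + 2 =>
    have i0 := h n (by omega)
    have i1 := h (n + 1) (by omega)
    have i2 := h (n + 2) (by omega)
    have i3 := h (n + 3) (by omega)
    simp only [Finset.prod_range_succ, rec3, fourTerm, hq, hr] at i0 i1 i2 i3 ⊢
    linear_combination p (n + 2) * i2 + w (n + 2) * K₂ (n + 1) * i1 +
      w (n + 2) * w (n + 1) * K₃ n * i0 - i3

/-- The zeros of `K₀` are the integral exponents, and a formal solution is determined by its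
coefficients there. -/
theorem eq_zero_of_fourTerm {K₀ K₁ K₂ K₃ b : ℕ → ℂ} (h : ∀ n, fourTerm K₀ K₁ K₂ K₃ b n = 0)
    (hK : ∀ n, b n = 0 ∨ K₀ n ≠ 0) (n : ℕ) : b n = 0 := by
  induction n using Nat.strong_induction_on with
  | _ n ih =>
    rcases hK n with h0 | h0
    · exact h0
    refine (mul_eq_zero.1 ?_).resolve_left h0
    have h1 := h n
    match n with
    | 0 => simpa [fourTerm] using h1
    | 1 => simpa [fourTerm, ih 0] using h1
    | 2 => simpa [fourTerm, ih 0, ih 1] using h1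
    | n + 3 =>
      simpa [fourTerm, ih n (by omega), ih (n + 1) (by omega), ih (n + 2) (by omega)] using h1

open PowerSeries in
/-- `κ X² u'' + μ X u' + ν u`. -/
noncomputable def eulerQuad (κ μ ν : ℂ) (u : ℂ⟦X⟧) : ℂ⟦X⟧ :=
  C κ * (X ^ 2 * d⁄dX ℂ (d⁄dX ℂ u)) + C μ * (X * d⁄dX ℂ u) + C ν * u

open PowerSeries in
theorem coeff_eulerQuad (κ μ ν : ℂ) (u : ℂ⟦X⟧) (n : ℕ) :
    coeff n (eulerQuad κ μ ν u) = (κ * (n * (n - 1)) + μ * n + ν) * coeff n u := by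
  have h1 : coeff n (X * d⁄dX ℂ u) = n * coeff n u := by
    cases n with
    | zero => simp
    | succ n =>
      rw [coeff_succ_X_mul, coeff_derivative]
      push_cast
      ring
  have h2 : coeff n (X ^ 2 * d⁄dX ℂ (d⁄dX ℂ u)) = n * (n - 1) * coeff n u := by
    match n with
    | 0 => simp
    | 1 => simp [coeff_X_pow_mul']
    | n + 2 =>
      rw [coeff_X_pow_mul, coeff_derivative, coeff_derivative]
      push_cast
      ring
  rw [eulerQuad, map_add, map_add, coeff_C_mul, coeff_C_mul, coeff_C_mul, h1, h2]
  ring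

open PowerSeries in
theorem coeff_fourTerm (K₀ K₁ K₂ K₃ : ℕ → ℂ) (u g₀ g₁ g₂ g₃ : ℂ⟦X⟧)
    (h₀ : ∀ n, coeff n g₀ = K₀ n * coeff n u) (h₁ : ∀ n, coeff n g₁ = K₁ n * coeff n u)
    (h₂ : ∀ n, coeff n g₂ = K₂ n * coeff n u) (h₃ : ∀ n, coeff n g₃ = K₃ n * coeff n u) (n : ℕ) :
    coeff n (g₀ + X * g₁ + X ^ 2 * g₂ + X ^ 3 * g₃) =
      fourTerm K₀ K₁ K₂ K₃ (fun n => coeff n u) n := by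
  rw [map_add, map_add, map_add]
  have e1 := coeff_X_pow_mul' g₁ 1 n
  rw [pow_one] at e1
  rw [e1, coeff_X_pow_mul', coeff_X_pow_mul']
  match n with
  | 0 => simpa [fourTerm] using h₀ 0
  | 1 =>
    have := h₁ 0
    simp only [coeff_zero_eq_constantCoeff] at this
    simp [fourTerm, ← h₀, this]
  | 2 =>
    have := h₂ 0
    simp only [coeff_zero_eq_constantCoeff] at this
    simp [fourTerm, ← h₀, ← h₁, this]
  | n + 3 => simp [fourTerm, ← h₀, ← h₁, ← h₂, ← h₃]

/-- The left side of the equation, multiplied by `z (z - 1) (z - a) (z - a₁)`, in a ring with a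
derivation. -/
noncomputable def fuchsOp {S : Type*} [CommRing S] [Algebra ℂ S] (P : FuchsianParams)
    (D : Derivation ℂ S S) (z u : S) : S :=
  z * (z - 1) * (z - algebraMap ℂ S P.a) * (z - algebraMap ℂ S P.a₁) * D (D u) +
  (algebraMap ℂ S P.γ * ((z - 1) * (z - algebraMap ℂ S P.a) * (z - algebraMap ℂ S P.a₁)) +
    algebraMap ℂ S P.δ * (z * (z - algebraMap ℂ S P.a) * (z - algebraMap ℂ S P.a₁)) +
    algebraMap ℂ S P.ε * (z * (z - 1) * (z - algebraMap ℂ S P.a₁)) +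
    algebraMap ℂ S P.ε₁ * (z * (z - 1) * (z - algebraMap ℂ S P.a))) * D u +
  (algebraMap ℂ S P.α * algebraMap ℂ S P.β * z ^ 2 - algebraMap ℂ S P.θ₁ * z -
    algebraMap ℂ S P.θ₀) * u

theorem map_fuchsOp {S S' : Type*} [CommRing S] [Algebra ℂ S] [CommRing S'] [Algebra ℂ S']
    (f : S →ₐ[ℂ] S') (P : FuchsianParams) (D : Derivation ℂ S S) (D' : Derivation ℂ S' S')
    (hD : ∀ x, f (D x) = D' (f x)) (z u : S) :
    f (fuchsOp P D z u) = fuchsOp P D' (f z) (f u) := by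
  simp [fuchsOp, hD]

namespace FuchsianParams

/-- The same equation with the two points `a`, `a₁` exchanged. -/
def swap (P : FuchsianParams) : FuchsianParams :=
  { P with ε := P.ε₁, ε₁ := P.ε, a := P.a₁, a₁ := P.a }

/-- The value of the numerator of `q` at `a`. -/
def accessory (P : FuchsianParams) : ℂ := P.α * P.β * P.a ^ 2 - P.θ₁ * P.a - P.θ₀

theorem FuchsRelation.swap {P : FuchsianParams} (h : P.FuchsRelation) : P.swap.FuchsRelation := by
  simp only [FuchsRelation, FuchsianParams.swap] at h ⊢
  rw [h]
  ring

theorem DistinctPoints.swap {P : FuchsianParams} (h : P.DistinctPoints) :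
    P.swap.DistinctPoints :=
  ⟨h.2.2.1, h.2.2.2.1, h.1, h.2.1, h.2.2.2.2.symm⟩

end FuchsianParams

theorem fuchsOp_swap {S : Type*} [CommRing S] [Algebra ℂ S] (P : FuchsianParams)
    (D : Derivation ℂ S S) (z u : S) : fuchsOp P.swap D z u = fuchsOp P D z u := by
  simp only [fuchsOp, FuchsianParams.swap]
  ring

/-! ### The recurrences at `a` and at `0` -/

section Local

open PowerSeries

variable (P : FuchsianParams)

/-- The indicial polynomial at `a`. -/
def localK₀ (n : ℕ) : ℂ := P.a * (P.a - 1) * (P.a - P.a₁) * (n * (n - 1 + P.ε))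

/-- The coefficient of the second term of the recurrence at `a`. -/
def localK₁ (n : ℕ) : ℂ :=
  (P.a * (P.a - 1) + (2 * P.a - 1) * (P.a - P.a₁)) * (n * (n - 1 + P.ε)) +
  (P.γ * (P.a - 1) * (P.a - P.a₁) + P.δ * P.a * (P.a - P.a₁) + P.ε₁ * P.a * (P.a - 1)) * n +
  P.accessory

/-- The coefficient of the third term of the recurrence at `a`. -/
def localK₂ (n : ℕ) : ℂ :=
  (3 * P.a - 1 - P.a₁) * (n * (n - 1 + P.ε)) +
  (P.γ * (2 * P.a - 1 - P.a₁) + P.δ * (2 * P.a - P.a₁) + P.ε₁ * (2 * P.a - 1)) * n +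
  (2 * P.α * P.β * P.a - P.θ₁)

/-- The coefficient of the last term of the recurrence at `a` and at `0`. -/
def lastK (n : ℕ) : ℂ := (n + P.α) * (n + P.β)

/-- The indicial polynomial at `0`. -/
def originK₀ (n : ℕ) : ℂ := -(P.a * P.a₁) * (n * (n - 1 + P.γ))

/-- The coefficient of the second term of the recurrence at `0`. -/
def originK₁ (n : ℕ) : ℂ :=
  (P.a + P.a₁ + P.a * P.a₁) * (n * (n - 1)) +
  (P.γ * (P.a + P.a₁ + P.a * P.a₁) + P.δ * (P.a * P.a₁) + P.ε * P.a₁ + P.ε₁ * P.a) * n - P.θ₀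

/-- The coefficient of the third term of the recurrence at `0`. -/
def originK₂ (n : ℕ) : ℂ :=
  -(1 + P.a + P.a₁) * (n * (n - 1)) -
  (P.γ * (1 + P.a + P.a₁) + P.δ * (P.a + P.a₁) + P.ε * (1 + P.a₁) + P.ε₁ * (1 + P.a)) * n - P.θ₁

/-- Expand the coefficients of the equation in powers of the local parameter; each power carries one
Euler operator. The Fuchs relation matters only for the last one, which it turns into `(n + α)(n +
β)`. -/
theorem coeff_X_mul_fuchsOp_local (hP : P.FuchsRelation) (u : ℂ⟦X⟧) (n : ℕ) :
    coeff n (X * fuchsOp P (d⁄dX ℂ) (C P.a + X) u) =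
      fourTerm (localK₀ P) (localK₁ P) (localK₂ P) (lastK P) (fun n => coeff n u) n := by
  rw [← coeff_fourTerm (localK₀ P) (localK₁ P) (localK₂ P) (lastK P) u
    (eulerQuad (P.a * (P.a - 1) * (P.a - P.a₁)) (P.ε * (P.a * (P.a - 1) * (P.a - P.a₁))) 0 u)
    (eulerQuad (P.a * (P.a - 1) + (2 * P.a - 1) * (P.a - P.a₁))
      (P.ε * (P.a * (P.a - 1) + (2 * P.a - 1) * (P.a - P.a₁)) +
        (P.γ * (P.a - 1) * (P.a - P.a₁) + P.δ * P.a * (P.a - P.a₁) + P.ε₁ * P.a * (P.a - 1)))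
      P.accessory u)
    (eulerQuad (3 * P.a - 1 - P.a₁) (P.ε * (3 * P.a - 1 - P.a₁) +
        (P.γ * (2 * P.a - 1 - P.a₁) + P.δ * (2 * P.a - P.a₁) + P.ε₁ * (2 * P.a - 1)))
      (2 * P.α * P.β * P.a - P.θ₁) u)
    (eulerQuad 1 (P.ε + (P.γ + P.δ + P.ε₁)) (P.α * P.β) u)]
  · congr 1
    simp only [fuchsOp, eulerQuad, FuchsianParams.accessory, PowerSeries.algebraMap_apply,
      Algebra.algebraMap_self, RingHom.id_apply, map_add, map_sub, map_mul, map_pow, map_one,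
      map_ofNat, map_zero]
    ring
  · intro n
    rw [coeff_eulerQuad, localK₀]
    ring
  · intro n
    rw [coeff_eulerQuad, localK₁]
    ring
  · intro n
    rw [coeff_eulerQuad, localK₂]
    ring
  · intro n
    rw [coeff_eulerQuad, lastK]
    simp only [FuchsianParams.FuchsRelation] at hP
    linear_combination -n * coeff n u * hP

theorem coeff_X_mul_fuchsOp_origin (hP : P.FuchsRelation) (u : ℂ⟦X⟧) (n : ℕ) :
    coeff n (X * fuchsOp P (d⁄dX ℂ) X u) =
      fourTerm (originK₀ P) (originK₁ P) (originK₂ P) (lastK P) (fun n => coeff n u) n := by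
  rw [← coeff_fourTerm (originK₀ P) (originK₁ P) (originK₂ P) (lastK P) u
    (eulerQuad (-(P.a * P.a₁)) (-(P.a * P.a₁) * P.γ) 0 u)
    (eulerQuad (P.a + P.a₁ + P.a * P.a₁)
      (P.γ * (P.a + P.a₁ + P.a * P.a₁) + P.δ * (P.a * P.a₁) + P.ε * P.a₁ + P.ε₁ * P.a)
      (-P.θ₀) u)
    (eulerQuad (-(1 + P.a + P.a₁))
      (-(P.γ * (1 + P.a + P.a₁) + P.δ * (P.a + P.a₁) + P.ε * (1 + P.a₁) + P.ε₁ * (1 + P.a)))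
      (-P.θ₁) u)
    (eulerQuad 1 (P.γ + P.δ + P.ε + P.ε₁) (P.α * P.β) u)]
  · congr 1
    simp only [fuchsOp, eulerQuad, PowerSeries.algebraMap_apply,
      Algebra.algebraMap_self, RingHom.id_apply, map_add, map_mul, map_neg, map_one, map_zero]
    ring
  · intro n
    rw [coeff_eulerQuad, originK₀]
    ring
  · intro n
    rw [coeff_eulerQuad, originK₁]
    ring
  · intro n
    rw [coeff_eulerQuad, originK₂]
    ring
  · intro n
    rw [coeff_eulerQuad, lastK]
    simp only [FuchsianParams.FuchsRelation] at hP
    linear_combination -n * coeff n u * hP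

theorem fourTerm_local_eq_zero (hP : P.FuchsRelation) (u : ℂ⟦X⟧) (n : ℕ)
    (h : coeff n (fuchsOp P (d⁄dX ℂ) (C P.a + X) u) = 0) :
    fourTerm (localK₀ P) (localK₁ P) (localK₂ P) (lastK P) (fun n => coeff n u) (n + 1) = 0 := by
  rw [← coeff_X_mul_fuchsOp_local P hP, coeff_succ_X_mul, h]

theorem eq_zero_of_fuchsOp_local (hP : P.FuchsRelation) (u : ℂ⟦X⟧)
    (h : fuchsOp P (d⁄dX ℂ) (C P.a + X) u = 0)
    (hK : ∀ n, coeff n u = 0 ∨ localK₀ P n ≠ 0) : u = 0 := by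
  ext n
  rw [map_zero]
  refine eq_zero_of_fourTerm (K₀ := localK₀ P) (K₁ := localK₁ P) (K₂ := localK₂ P)
    (K₃ := lastK P) (b := fun n => coeff n u) (fun n => ?_) hK n
  rw [← coeff_X_mul_fuchsOp_local P hP, h, mul_zero, map_zero]

end Local

/-! ### Formal solutions at `a` and at `0` -/

section Series

open PowerSeries

variable (P : FuchsianParams) (k l : ℕ)

/-- The unscaled parameters of the equation. -/
def FuchsianParams.vec : Fin 6 → ℂ := scaledParams 1 P.α P.β P.γ P.a P.a₁

theorem FuchsianParams.swap_vec : P.swap.vec = swapPoints P.vec := by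
  rw [FuchsianParams.vec, FuchsianParams.vec, swapPoints_scaledParams]
  rfl

variable {P k l}

/-- In the accessory variables `θ₁` enters only through `Y - Y₁ = (a - a₁)(αβ(a + a₁) - θ₁)`. The
surplus factor `a - a₁` in the third coefficient is taken from the leading one. -/
theorem apparentRec_vec (hP : P.FuchsRelation) (hε : P.ε = -k) (hε₁ : P.ε₁ = -l) :
    ∃ p q r : ℕ → ℂ, (∀ n, apparentRec k l P.vec 1 P.accessory P.swap.accessory n = rec3 p q r n) ∧
      p = localK₁ P ∧ (∀ n, q (n + 1) = -localK₀ P (n + 1) * localK₂ P n) ∧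
      (∀ n, r (n + 2) = -localK₀ P (n + 2) * -localK₀ P (n + 1) * lastK P n) := by
  have hδ : P.δ = scaledDelta k l P.vec := by
    simp only [FuchsianParams.FuchsRelation, hε, hε₁] at hP
    simp [scaledDelta, FuchsianParams.vec, scaledParams]
    linear_combination -hP
  refine ⟨_, _, _, fun n => rfl, ?_, ?_, ?_⟩
  · funext n
    rw [localK₁, hδ, hε, hε₁]
    simp [FuchsianParams.vec, scaledParams]
    ring
  · intro n
    rw [localK₀, localK₂, hδ, hε, hε₁]
    simp [FuchsianParams.vec, scaledParams, FuchsianParams.accessory, FuchsianParams.swap]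
    ring
  · intro n
    rw [localK₀, localK₀, lastK, hε]
    simp [FuchsianParams.vec, scaledParams]
    left
    ring

theorem localK₀_self_succ (hε : P.ε = -k) : localK₀ P (k + 1) = 0 := by
  simp [localK₀, hε]

theorem localK₀_ne_zero (hd : P.DistinctPoints) (hε : P.ε = -k) {n : ℕ} (h0 : n ≠ 0)
    (h1 : n ≠ k + 1) : localK₀ P n ≠ 0 := by
  obtain ⟨ha0, ha1, -, -, haa⟩ := hd
  rw [localK₀, hε]
  refine mul_ne_zero (mul_ne_zero (mul_ne_zero ha0 (sub_ne_zero.2 ha1)) (sub_ne_zero.2 haa))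
    (mul_ne_zero (Nat.cast_ne_zero.2 h0) ?_)
  intro h
  apply h1
  have : (n : ℂ) = (k + 1 : ℕ) := by
    push_cast
    linear_combination h
  exact_mod_cast this

/-- A formal solution at `a` that does not vanish there excludes logarithms. -/
theorem apparentRec_eq_zero_of_fuchsOp_local (hP : P.FuchsRelation) (hε : P.ε = -k)
    (hε₁ : P.ε₁ = -l) (u : ℂ⟦X⟧) (hu : fuchsOp P (d⁄dX ℂ) (C P.a + X) u = 0)
    (h0 : coeff 0 u ≠ 0) :
    apparentRec k l P.vec 1 P.accessory P.swap.accessory (k + 1) = 0 := by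
  obtain ⟨p, q, r, h, hp, hq, hr⟩ := apparentRec_vec hP hε hε₁
  have := mul_prod_eq_rec3 p q r (fun n => -localK₀ P n) (localK₁ P) (localK₂ P) (lastK P)
    (fun n => coeff n u) hp hq hr (k + 1) (fun n _ => by
      simp only [neg_neg]
      exact fourTerm_local_eq_zero P hP u n (by rw [hu, map_zero])) (k + 1) le_rfl
  -- The last factor of the product belongs to the second exponent `k + 1`, where the indicial
  -- polynomial is zero.
  rw [Finset.prod_range_succ, localK₀_self_succ hε, neg_zero, mul_zero, mul_zero, ← h] at this
  exact (mul_eq_zero.1 this.symm).resolve_left h0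

/-- The Taylor expansion of a polynomial at `c`. -/
noncomputable def taylorSeries (c : ℂ) : Polynomial ℂ →ₐ[ℂ] ℂ⟦X⟧ :=
  Polynomial.aeval (C c + X)

theorem taylorSeries_eq (c : ℂ) (p : Polynomial ℂ) :
    taylorSeries c p = ((p.comp (Polynomial.X + Polynomial.C c) : Polynomial ℂ) : ℂ⟦X⟧) := by
  induction p using Polynomial.induction_on' with
  | add p q hp hq => simp [hp, hq]
  | monomial n r =>
    simp [taylorSeries, Polynomial.aeval_monomial, add_comm]

theorem coeff_taylorSeries (c : ℂ) (p : Polynomial ℂ) (n : ℕ) :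
    coeff n (taylorSeries c p) = (p.comp (Polynomial.X + Polynomial.C c)).coeff n := by
  rw [taylorSeries_eq, Polynomial.coeff_coe]

theorem coeff_zero_taylorSeries (c : ℂ) (p : Polynomial ℂ) :
    coeff 0 (taylorSeries c p) = p.eval c := by
  rw [coeff_taylorSeries, Polynomial.coeff_zero_eq_eval_zero, Polynomial.eval_comp]
  simp

/-- The derivation of the ring of polynomials. -/
noncomputable abbrev polyD : Derivation ℂ (Polynomial ℂ) (Polynomial ℂ) := Polynomial.derivative'

theorem taylorSeries_derivative (c : ℂ) (p : Polynomial ℂ) :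
    taylorSeries c (polyD p) = d⁄dX ℂ (taylorSeries c p) := by
  have : polyD p = Polynomial.derivative p := rfl
  rw [this, taylorSeries_eq, taylorSeries_eq, derivative_coe, Polynomial.derivative_comp]
  simp

theorem sub_pow_dvd_iff_taylorSeries (c : ℂ) (p : Polynomial ℂ) (n : ℕ) :
    (Polynomial.X - Polynomial.C c) ^ n ∣ p ↔ ∀ m < n, coeff m (taylorSeries c p) = 0 := by
  rw [Polynomial.X_sub_C_pow_dvd_iff, Polynomial.X_pow_dvd_iff]
  simp only [coeff_taylorSeries]

theorem taylorSeries_fuchsOp (P : FuchsianParams) (c : ℂ) (p : Polynomial ℂ) :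
    taylorSeries c (fuchsOp P polyD Polynomial.X p) =
      fuchsOp P (d⁄dX ℂ) (C c + X) (taylorSeries c p) := by
  rw [map_fuchsOp (taylorSeries c) P polyD (d⁄dX ℂ) (taylorSeries_derivative c), taylorSeries,
    Polynomial.aeval_X]

/-- The truncation of a formal solution at a non-logarithmic point. -/
theorem exists_truncated_solution (hP : P.FuchsRelation) (hd : P.DistinctPoints) (hε : P.ε = -k)
    (hε₁ : P.ε₁ = -l)
    (h : apparentRec k l P.vec 1 P.accessory P.swap.accessory (k + 1) = 0) :
    ∃ U : Polynomial ℂ, U.eval P.a = 1 ∧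
      (Polynomial.X - Polynomial.C P.a) ^ (k + 1) ∣ fuchsOp P polyD Polynomial.X U := by
  obtain ⟨p, q, r, hrec, hp, hq, hr⟩ := apparentRec_vec hP hε hε₁
  set w : ℕ → ℂ := fun n => -localK₀ P n with hw
  have hw0 : ∀ n ≤ k, ∏ j ∈ Finset.range n, w (j + 1) ≠ 0 := fun n hn =>
    Finset.prod_ne_zero_iff.2 fun j hj => neg_ne_zero.2 <|
      localK₀_ne_zero hd hε (by omega) (by have := Finset.mem_range.1 hj; omega)
  -- Beyond `k` the coefficients are set to zero. The equation of index `k + 1` does not involve the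
  -- coefficient `b (k + 1)`, and it is exactly the hypothesis `h`.
  set b : ℕ → ℂ := fun n => if n ≤ k then rec3 p q r n / ∏ j ∈ Finset.range n, w (j + 1) else 0
    with hb
  set V : Polynomial ℂ := ∑ n ∈ Finset.range (k + 1), Polynomial.monomial n (b n) with hV
  have hVc : ∀ n, V.coeff n = b n := by
    intro n
    simp only [hV, Polynomial.finsetSum_coeff, Polynomial.coeff_monomial, Finset.sum_ite_eq',
      Finset.mem_range]
    split_ifs with h1
    · rfl
    · simp only [hb]
      rw [if_neg (by omega)]
  have hUV : taylorSeries P.a (V.comp (Polynomial.X - Polynomial.C P.a)) = V := by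
    rw [taylorSeries_eq, Polynomial.comp_assoc]
    simp
  have hc : (fun n => coeff n (taylorSeries P.a (V.comp (Polynomial.X - Polynomial.C P.a)))) = b := by
    funext n
    rw [hUV, Polynomial.coeff_coe, hVc]
  have hb0 : b 0 = 1 := by simp [hb, rec3]
  refine ⟨V.comp (Polynomial.X - Polynomial.C P.a), ?_, ?_⟩
  · rw [← coeff_zero_taylorSeries]
    exact (congrFun hc 0).trans hb0
  · rw [sub_pow_dvd_iff_taylorSeries]
    intro m hm
    rw [taylorSeries_fuchsOp, ← coeff_succ_X_mul, coeff_X_mul_fuchsOp_local P hP, hc]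
    have := fourTerm_eq_of_mul_prod_eq_rec3 p q r w (localK₁ P) (localK₂ P) (lastK P) b hp hq hr m
      (fun n hn => ?_)
    · simp only [hw, neg_neg] at this
      exact (mul_eq_zero.1 this).resolve_left (hw0 m (by omega))
    · rw [hb0, one_mul]
      by_cases hnk : n ≤ k
      · simp only [hb]
        rw [if_pos hnk, div_mul_cancel₀ _ (hw0 n hnk)]
      · have : n = k + 1 := by omega
        subst this
        rw [← hrec, h]
        simp [hb]

theorem fourTerm_smul (c : ℂ) (K₀ K₁ K₂ K₃ b : ℕ → ℂ) (n : ℕ) :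
    fourTerm (fun n => c * K₀ n) (fun n => c * K₁ n) (fun n => c * K₂ n) (fun n => c * K₃ n) b n =
      c * fourTerm K₀ K₁ K₂ K₃ b n := by
  match n with
  | 0 => simp [fourTerm]; ring
  | 1 => simp [fourTerm]; ring
  | 2 => simp [fourTerm]; ring
  | n + 3 => simp [fourTerm]; ring

/-- Recovering `θ₀` and `θ₁` from `Y` and `Y₁` divides by `a - a₁`, so every coefficient of the
recurrence at 0 is multiplied by it. -/
theorem originRec_vec (hP : P.FuchsRelation) (hε : P.ε = -k) (hε₁ : P.ε₁ = -l) :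
    ∃ p q r : ℕ → ℂ, (∀ n, originRec k l P.vec P.accessory P.swap.accessory n = rec3 p q r n) ∧
      p = (fun n => (P.a - P.a₁) * originK₁ P n) ∧
      (∀ n, q (n + 1) = -((P.a - P.a₁) * originK₀ P (n + 1)) * ((P.a - P.a₁) * originK₂ P n)) ∧
      (∀ n, r (n + 2) = -((P.a - P.a₁) * originK₀ P (n + 2)) *
        -((P.a - P.a₁) * originK₀ P (n + 1)) * ((P.a - P.a₁) * lastK P n)) := by
  have hδ : P.δ = scaledDelta k l P.vec := by
    simp only [FuchsianParams.FuchsRelation, hε, hε₁] at hP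
    simp [scaledDelta, FuchsianParams.vec, scaledParams]
    linear_combination -hP
  refine ⟨_, _, _, fun n => rfl, ?_, ?_, ?_⟩
  · funext n
    rw [originK₁, hδ, hε, hε₁]
    simp [FuchsianParams.vec, scaledParams, FuchsianParams.accessory, FuchsianParams.swap]
    ring
  · intro n
    rw [originK₀, originK₂, hδ, hε, hε₁]
    simp [FuchsianParams.vec, scaledParams, FuchsianParams.accessory, FuchsianParams.swap]
    ring
  · intro n
    rw [originK₀, originK₀, lastK]
    simp [FuchsianParams.vec, scaledParams]
    ring

/-- The product of the leading coefficients of the recurrence at `0`. -/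
noncomputable def originProd (P : FuchsianParams) (n : ℕ) : ℂ :=
  ∏ j ∈ Finset.range n, -((P.a - P.a₁) * originK₀ P (j + 1))

theorem originProd_ne_zero (hd : P.DistinctPoints) (hγ : ∀ m : ℕ, P.γ ≠ -m) (n : ℕ) :
    originProd P n ≠ 0 := by
  obtain ⟨ha0, -, ha₁0, -, haa⟩ := hd
  refine Finset.prod_ne_zero_iff.2 fun j _ => neg_ne_zero.2 (mul_ne_zero (sub_ne_zero.2 haa) ?_)
  rw [originK₀]
  refine mul_ne_zero (neg_ne_zero.2 (mul_ne_zero ha0 ha₁0)) (mul_ne_zero ?_ ?_)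
  · exact Nat.cast_ne_zero.2 (by omega)
  · intro h
    apply hγ j
    push_cast at h
    linear_combination h

/-- As `originProd` does not vanish for admissible `γ` and distinct points, the vanishing of a
coefficient of the solution with constant term 1 becomes a polynomial condition. -/
theorem coeff_mul_originProd (hP : P.FuchsRelation) (hε : P.ε = -k) (hε₁ : P.ε₁ = -l) (u : ℂ⟦X⟧)
    (hu : fuchsOp P (d⁄dX ℂ) X u = 0) (n : ℕ) :
    coeff n u * originProd P n =
      coeff 0 u * originRec k l P.vec P.accessory P.swap.accessory n := by
  obtain ⟨p, q, r, hrec, hp, hq, hr⟩ := originRec_vec hP hε hε₁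
  rw [hrec]
  refine mul_prod_eq_rec3 p q r (fun n => -((P.a - P.a₁) * originK₀ P n)) _ _ _
    (fun n => coeff n u) hp hq hr n (fun j _ => ?_) n le_rfl
  simp only [neg_neg]
  rw [fourTerm_smul, ← coeff_X_mul_fuchsOp_origin P hP, hu]
  simp

theorem exists_origin_solution (hP : P.FuchsRelation) (hd : P.DistinctPoints) (hε : P.ε = -k)
    (hε₁ : P.ε₁ = -l) (hγ : ∀ m : ℕ, P.γ ≠ -m) :
    ∃ u : ℂ⟦X⟧, coeff 0 u = 1 ∧ fuchsOp P (d⁄dX ℂ) X u = 0 := by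
  obtain ⟨p, q, r, hrec, hp, hq, hr⟩ := originRec_vec hP hε hε₁
  refine ⟨PowerSeries.mk fun n => rec3 p q r n / originProd P n, ?_, ?_⟩
  · simp [rec3, originProd]
  ext n
  rw [← coeff_succ_X_mul, coeff_X_mul_fuchsOp_origin P hP, map_zero]
  have := fourTerm_eq_of_mul_prod_eq_rec3 p q r (fun n => -((P.a - P.a₁) * originK₀ P n)) _ _ _
    (fun n => rec3 p q r n / originProd P n) hp hq hr n (fun j _ => ?_)
  · simp only [neg_neg] at this
    rw [fourTerm_smul, ← mul_assoc] at this
    simp only [coeff_mk]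
    exact (mul_eq_zero.1 this).resolve_left
      (mul_ne_zero (originProd_ne_zero hd hγ n) (sub_ne_zero.2 hd.2.2.2.2))
  · have h0 : rec3 p q r 0 / originProd P 0 = 1 := by simp [rec3, originProd]
    rw [h0, one_mul]
    exact div_mul_cancel₀ _ (originProd_ne_zero hd hγ j)

end Series

/-! ### The two leading coefficients of a polynomial -/

section TopTwo

open Polynomial

/-- The coefficients of `X ^ m` and `X ^ (m - 1)` of a polynomial of degree at most `m`. -/
def TopTwo (m : ℕ) (p : ℂ[X]) (a b : ℂ) : Prop :=
  p.natDegree ≤ m ∧ (reflect m p).coeff 0 = a ∧ (reflect m p).coeff 1 = b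

theorem TopTwo.add {m : ℕ} {p q : ℂ[X]} {a b c d : ℂ} (hp : TopTwo m p a b)
    (hq : TopTwo m q c d) : TopTwo m (p + q) (a + c) (b + d) := by
  refine ⟨natDegree_add_le_of_degree_le hp.1 hq.1, ?_, ?_⟩
  · rw [reflect_add, coeff_add, hp.2.1, hq.2.1]
  · rw [reflect_add, coeff_add, hp.2.2, hq.2.2]

theorem TopTwo.mul {m n : ℕ} {p q : ℂ[X]} {a b c d : ℂ} (hp : TopTwo m p a b)
    (hq : TopTwo n q c d) : TopTwo (m + n) (p * q) (a * c) (a * d + b * c) := by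
  refine ⟨natDegree_mul_le_of_le hp.1 hq.1, ?_, ?_⟩
  · rw [reflect_mul _ _ hp.1 hq.1, mul_coeff_zero, hp.2.1, hq.2.1]
  · rw [reflect_mul _ _ hp.1 hq.1, mul_coeff_one, hp.2.1, hq.2.1, hp.2.2, hq.2.2]

theorem TopTwo.C_mul {m : ℕ} {p : ℂ[X]} {a b : ℂ} (c : ℂ) (hp : TopTwo m p a b) :
    TopTwo m (C c * p) (c * a) (c * b) := by
  refine ⟨(natDegree_C_mul_le c p).trans hp.1, ?_, ?_⟩
  · rw [reflect_C_mul, coeff_C_mul, hp.2.1]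
  · rw [reflect_C_mul, coeff_C_mul, hp.2.2]

theorem TopTwo.linear (c : ℂ) : TopTwo 1 (X + C c) 1 c := by
  refine ⟨natDegree_X_add_C c |>.le, ?_, ?_⟩ <;> simp [reflect_add, coeff_X, coeff_C, coeff_one]

theorem TopTwo.quadratic (a b c : ℂ) : TopTwo 2 (C a * X ^ 2 + C b * X + C c) a b := by
  refine ⟨natDegree_quadratic_le, ?_, ?_⟩ <;>
    simp [reflect_add, coeff_reflect, revAt_le, coeff_X, coeff_C]

theorem TopTwo.comp {m : ℕ} {p : ℂ[X]} {a b : ℂ} (hp : TopTwo m p a b) (c : ℂ) :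
    TopTwo m (p.comp (X + C c)) a (b + c * m * a) := by
  obtain ⟨hd, ha, hb⟩ := hp
  simp only [coeff_reflect] at ha hb
  have hd' : (p.comp (X + C c)).natDegree ≤ m := by
    rw [natDegree_comp, natDegree_X_add_C, mul_one]
    exact hd
  refine ⟨hd', ?_, ?_⟩
  · rw [coeff_reflect]
    rw [revAt_le (Nat.zero_le m), Nat.sub_zero] at ha ⊢
    rw [← taylor_apply, taylor_coeff, eval_eq_sum_range' (n := 1)]
    · simp [hasseDeriv_coeff, ha]
    · exact (natDegree_hasseDeriv_le _ _).trans_lt (by omega)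
  · rw [coeff_reflect]
    cases m with
    | zero =>
      rw [revAt_eq_self_of_lt (by omega)] at hb ⊢
      rw [coeff_eq_zero_of_natDegree_lt (by omega)] at hb ⊢
      simp [← hb]
    | succ m =>
      rw [revAt_le (by omega), Nat.add_sub_cancel] at hb ⊢
      rw [revAt_le (Nat.zero_le _), Nat.sub_zero] at ha
      rw [← taylor_apply, taylor_coeff, eval_eq_sum_range' (n := 2)]
      · simp [hasseDeriv_coeff, ha, hb, Finset.sum_range_succ, add_comm 1 m]
        ring
      · exact (natDegree_hasseDeriv_le _ _).trans_lt (by omega)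

end TopTwo

/-! ### The equation written in the operator `z d/dz` -/

section Euler

open Polynomial

/-- The operator `z d/dz`. -/
noncomputable def eulerOp {S : Type*} [CommRing S] [Algebra ℂ S] (D : Derivation ℂ S S) (z : S) :
    Module.End ℂ S := LinearMap.mulLeft ℂ z ∘ₗ D.toLinearMap

variable {S : Type*} [CommRing S] [Algebra ℂ S] {D : Derivation ℂ S S} {z : S}

theorem eulerOp_apply (u : S) : eulerOp D z u = z * D u := rfl

theorem aeval_mul_end (f : Module.End ℂ S) (p q : ℂ[X]) (u : S) :
    aeval f (p * q) u = aeval f p (aeval f q u) := by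
  rw [aeval_mul]
  rfl

theorem aeval_quadratic_end (f : Module.End ℂ S) (a b c : ℂ) (u : S) :
    aeval f (C a * X ^ 2 + C b * X + C c) u =
      algebraMap ℂ S a * f (f u) + algebraMap ℂ S b * f u + algebraMap ℂ S c * u := by
  simp [Algebra.smul_def, pow_two]

/-- The commutation rule `θ z = z (θ + 1)` for `θ = z d/dz`. -/
theorem aeval_eulerOp_mul (hz : D z = 1) (p : ℂ[X]) (u : S) :
    aeval (eulerOp D z) p (z * u) = z * aeval (eulerOp D z) (p.comp (X + C 1)) u := by
  induction p using Polynomial.induction_on' generalizing u with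
  | add p q hp hq => simp only [map_add, add_comp, LinearMap.add_apply, hp, hq, mul_add]
  | monomial n r =>
    rw [← C_mul_X_pow_eq_monomial]
    have : ∀ (n : ℕ) (u : S), (aeval (eulerOp D z) (X ^ n : ℂ[X])) (z * u) =
        z * (aeval (eulerOp D z) ((X + C 1) ^ n : ℂ[X])) u := by
      intro n
      induction n with
      | zero => intro u; simp
      | succ n ih =>
        intro u
        have h1 : eulerOp D z (z * u) = z * (aeval (eulerOp D z) (X + C 1 : ℂ[X]) u) := by
          simp only [eulerOp_apply, Derivation.leibniz, hz, smul_eq_mul, map_add, aeval_X,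
            LinearMap.add_apply, map_one, Module.End.one_apply]
          ring
        rw [pow_succ, pow_succ, aeval_mul_end, aeval_mul_end, aeval_X, h1, ih]
    rw [mul_comp, C_comp, pow_comp, X_comp, aeval_mul_end, aeval_mul_end, aeval_C, this,
      Module.algebraMap_end_apply, Module.algebraMap_end_apply, mul_smul_comm]

theorem aeval_eulerOp_comp_mul (hz : D z = 1) (p : ℂ[X]) (u : S) :
    aeval (eulerOp D z) (p.comp (X - C 1)) (z * u) = z * aeval (eulerOp D z) p u := by
  rw [aeval_eulerOp_mul hz, comp_assoc]
  simp

namespace FuchsianParams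

variable (P : FuchsianParams)

/-- The indicial polynomial at `0`. -/
noncomputable def indicial : ℂ[X] := X * (X + C (P.γ - 1))

/-- The indicial polynomial at infinity, shifted. -/
noncomputable def indicialInf : ℂ[X] := (X + C (P.α - 1)) * (X + C (P.β - 1))

/-- The coefficient of `z ^ 2` in the equation written with Euler operators. -/
noncomputable def eulerA : ℂ[X] :=
  C (-(1 + P.a + P.a₁)) * X ^ 2 + C ((1 + P.a + P.a₁) -
    (P.γ * (1 + P.a + P.a₁) + P.δ * (P.a + P.a₁) + P.ε * (1 + P.a₁) + P.ε₁ * (1 + P.a))) * X +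
  C (-P.θ₁)

/-- The coefficient of `z` in the equation written with Euler operators. -/
noncomputable def eulerB : ℂ[X] :=
  C (P.a + P.a₁ + P.a * P.a₁) * X ^ 2 + C (P.γ * (P.a + P.a₁ + P.a * P.a₁) + P.δ * (P.a * P.a₁) +
    P.ε * P.a₁ + P.ε₁ * P.a - (P.a + P.a₁ + P.a * P.a₁)) * X + C (-P.θ₀)

/-- This polynomial vanishes if and only if `∑ hₙ R(n) zⁿ`, with the coefficients `hₙ` of
`₂F₁(α, β; γ; z)`, is a formal solution. -/
noncomputable def recurrencePoly (R : ℂ[X]) : ℂ[X] :=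
  P.indicial * ((P.indicial * R.comp (X - C 1)).comp (X - C 1) + (P.eulerA * R).comp (X - C 1)) +
  P.indicialInf * (P.eulerB * R - C (P.a * P.a₁) * (P.indicialInf * R).comp (X + C 1))

/-- This carries every conclusion at `a` over to `a₁`. -/
theorem recurrencePoly_swap (R : ℂ[X]) : P.swap.recurrencePoly R = P.recurrencePoly R := by
  have hA : P.swap.eulerA = P.eulerA := by
    simp only [eulerA, swap]
    congr 4 <;> ring
  have hB : P.swap.eulerB = P.eulerB := by
    simp only [eulerB, swap]
    congr 4 <;> ring
  simp only [recurrencePoly, hA, hB]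
  simp only [indicial, indicialInf, swap, mul_comm P.a]

variable {P}

theorem mul_fuchsOp_eq (hP : P.FuchsRelation) (hz : D z = 1) (u : S) :
    z * fuchsOp P D z u = z ^ 3 * aeval (eulerOp D z) (P.indicialInf.comp (X + C 1)) u +
      z ^ 2 * aeval (eulerOp D z) P.eulerA u + z * aeval (eulerOp D z) P.eulerB u -
      algebraMap ℂ S (P.a * P.a₁) * aeval (eulerOp D z) P.indicial u := by
  have h1 : (eulerOp D z) (eulerOp D z u) = z * D u + z ^ 2 * D (D u) := by
    simp only [eulerOp_apply, Derivation.leibniz, hz, smul_eq_mul]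
    ring
  have h0 : eulerOp D z u = z * D u := rfl
  have hP' : algebraMap ℂ S P.δ = 1 + algebraMap ℂ S P.α + algebraMap ℂ S P.β -
      algebraMap ℂ S P.γ - algebraMap ℂ S P.ε - algebraMap ℂ S P.ε₁ := by
    have : P.δ = 1 + P.α + P.β - P.γ - P.ε - P.ε₁ := by
      rw [hP]
      ring
    rw [this]
    simp
  have e1 : P.indicialInf.comp (X + C 1) =
      C 1 * X ^ 2 + C (P.α + P.β) * X + C (P.α * P.β) := by
    simp only [indicialInf, mul_comp, add_comp, X_comp, C_comp]
    simp only [C_sub, C_add, C_mul, C_1]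
    ring
  have e2 : P.indicial = C 1 * X ^ 2 + C (P.γ - 1) * X + C 0 := by
    simp only [indicial, C_1, C_0]
    ring
  rw [e1, e2, eulerA, eulerB, aeval_quadratic_end, aeval_quadratic_end, aeval_quadratic_end,
    aeval_quadratic_end, h1, h0]
  simp only [fuchsOp, map_add, map_mul, map_sub, map_neg, map_one, map_zero, hP']
  ring

/-- The lowered parameters `α - 1`, `β - 1` are chosen so that `indicialInf(θ) G` satisfies Gauss'
equation for `α`, `β`, `γ`. Each factor `z` in front of a multiple of `indicialInf(θ) G` is absorbed
by `z indicialInf(θ) G = indicial(θ) G`; after all powers of `z` but a common one are gone,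
`recurrencePoly R` remains, applied to `G`. -/
theorem fuchsOp_eulerOp_eq_zero (hP : P.FuchsRelation) (hz : D z = 1) (hu : IsUnit z) {R : ℂ[X]}
    (hR : P.recurrencePoly R = 0) {G : S}
    (hG : aeval (eulerOp D z) P.indicial G = z * aeval (eulerOp D z) P.indicialInf G) :
    fuchsOp P D z (aeval (eulerOp D z) (R * P.indicialInf) G) = 0 := by
  have hm : ∀ p q : ℂ[X], aeval (eulerOp D z) (p * q) G =
      aeval (eulerOp D z) p (aeval (eulerOp D z) q G) := fun p q => aeval_mul_end _ _ _ _
  have hm' : ∀ (p q : ℂ[X]) (u : S), aeval (eulerOp D z) p (aeval (eulerOp D z) q u) =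
      aeval (eulerOp D z) (p * q) u := fun p q u => (aeval_mul_end _ _ _ _).symm
  have key : ∀ p : ℂ[X], z * aeval (eulerOp D z) (p * P.indicialInf) G =
      aeval (eulerOp D z) (p.comp (X - C 1) * P.indicial) G := fun p => by
    rw [hm, ← aeval_eulerOp_comp_mul hz, ← hG, ← hm]
  have t1 : z ^ 3 * aeval (eulerOp D z) (P.indicialInf.comp (X + C 1))
      (aeval (eulerOp D z) (R * P.indicialInf) G) = z * aeval (eulerOp D z)
        ((P.indicial * R.comp (X - C 1)).comp (X - C 1) * P.indicial) G := by
    have h1 : (P.indicialInf.comp (X + C 1) * R).comp (X - C 1) * P.indicial =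
        (P.indicial * R.comp (X - C 1)) * P.indicialInf := by
      rw [mul_comp, comp_assoc, show (X + C 1 : ℂ[X]).comp (X - C 1) = X by simp, comp_X]
      ring
    rw [hm', ← mul_assoc, show z ^ 3 = z * (z * z) by ring, mul_assoc, mul_assoc, key, h1, key]
  have t2 : z ^ 2 * aeval (eulerOp D z) P.eulerA (aeval (eulerOp D z) (R * P.indicialInf) G) =
      z * aeval (eulerOp D z) ((P.eulerA * R).comp (X - C 1) * P.indicial) G := by
    rw [hm', ← mul_assoc, pow_two, mul_assoc, key]
  have t4 : aeval (eulerOp D z) P.indicial (aeval (eulerOp D z) (R * P.indicialInf) G) =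
      z * aeval (eulerOp D z) ((P.indicialInf * R).comp (X + C 1) * P.indicialInf) G := by
    rw [hm', mul_comm P.indicial, hm, hG, aeval_eulerOp_mul hz, hm', mul_comm R]
  have h := mul_fuchsOp_eq hP hz (aeval (eulerOp D z) (R * P.indicialInf) G)
  rw [t1, t2, t4, hm'] at h
  have h0 : aeval (eulerOp D z) (P.recurrencePoly R) G = 0 := by rw [hR]; simp
  have e : P.recurrencePoly R = (P.indicial * R.comp (X - C 1)).comp (X - C 1) * P.indicial +
      (P.eulerA * R).comp (X - C 1) * P.indicial + P.eulerB * (R * P.indicialInf) -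
      C (P.a * P.a₁) * ((P.indicialInf * R).comp (X + C 1) * P.indicialInf) := by
    rw [recurrencePoly]
    ring
  rw [e, map_sub, map_add, map_add, LinearMap.sub_apply, LinearMap.add_apply, LinearMap.add_apply,
    aeval_mul_end _ (C _), aeval_C, Module.algebraMap_end_apply, Algebra.smul_def] at h0
  have h1 : z * fuchsOp P D z (aeval (eulerOp D z) (R * P.indicialInf) G) = 0 := by
    rw [h]
    linear_combination z * h0
  exact hu.mul_right_eq_zero.1 h1

/-- With `N` the degree of `R`, the coefficient of degree `N + 4` cancels identically. The next one
is `(a - 1)(a₁ - 1)(ε + ε₁ + N)` times the leading coefficient of `R`. -/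
theorem natDegree_of_recurrencePoly (hP : P.FuchsRelation) (hd : P.DistinctPoints) {R : ℂ[X]}
    (h0 : R ≠ 0) (hR : P.recurrencePoly R = 0) : P.ε + P.ε₁ = -(R.natDegree : ℂ) := by
  obtain ⟨-, ha1, -, ha₁1, -⟩ := hd
  set N := R.natDegree
  have hT : TopTwo N R R.leadingCoeff ((reflect N R).coeff 1) :=
    ⟨le_rfl, by simp [N, coeff_reflect, revAt_le], rfl⟩
  have hX : TopTwo 1 X 1 0 := by simpa using TopTwo.linear 0
  have hW : TopTwo 2 P.indicial _ _ := hX.mul (TopTwo.linear (P.γ - 1))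
  have hZ : TopTwo 2 P.indicialInf _ _ :=
    (TopTwo.linear (P.α - 1)).mul (TopTwo.linear (P.β - 1))
  have hA : TopTwo 2 P.eulerA _ _ := TopTwo.quadratic _ _ _
  have hB : TopTwo 2 P.eulerB _ _ := TopTwo.quadratic _ _ _
  have hs : (X - C 1 : ℂ[X]) = X + C (-1) := by simp [sub_eq_add_neg]
  have e : P.recurrencePoly R =
      (P.indicial * ((P.indicial * R.comp (X + C (-1))).comp (X + C (-1)) +
      (P.eulerA * R).comp (X + C (-1))) + P.indicialInf * (P.eulerB * R +
      C (-(P.a * P.a₁)) * (P.indicialInf * R).comp (X + C 1))) := by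
    rw [recurrencePoly, show C (-(P.a * P.a₁)) = -C (P.a * P.a₁) from C_neg]
    simp only [hs]
    ring
  have h := ((hW.mul (((hW.mul (hT.comp (-1))).comp (-1)).add ((hA.mul hT).comp (-1)))).add
    (hZ.mul ((hB.mul hT).add (((hZ.mul hT).comp 1).C_mul (-(P.a * P.a₁)))))).2.2
  rw [← e, hR] at h
  have hL : R.leadingCoeff ≠ 0 := leadingCoeff_ne_zero.2 h0
  have h2 : ((P.a - 1) * (P.a₁ - 1) * R.leadingCoeff) * (P.ε + P.ε₁ + N) = 0 := by
    simp only [reflect_zero, coeff_zero] at h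
    push_cast at h
    simp only [FuchsRelation] at hP
    have hδ : P.δ = 1 + P.α + P.β - P.γ - P.ε - P.ε₁ := by linear_combination -hP
    rw [hδ] at h
    linear_combination h
  have := (mul_eq_zero.1 h2).resolve_left
    (mul_ne_zero (mul_ne_zero (sub_ne_zero.2 ha1) (sub_ne_zero.2 ha₁1)) hL)
  linear_combination this

end FuchsianParams

end Euler

/-! ### Gauss' equation near `a` -/

section Formal

open PowerSeries

variable (P : FuchsianParams)

/-- The coefficients of the Taylor expansion at `a` of a solution of the hypergeometric equation
with parameters `α - 1`, `β - 1`, `γ`. -/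
noncomputable def gaussCoeff (c₀ c₁ : ℂ) : ℕ → ℂ
  | 0 => c₀
  | 1 => c₁
  | n + 2 => -((((1 - 2 * P.a) * n + (P.γ - (P.α + P.β - 1) * P.a)) * (n + 1)) *
      gaussCoeff c₀ c₁ (n + 1) - (n * (n - 1) + (P.α + P.β - 1) * n + (P.α - 1) * (P.β - 1)) *
      gaussCoeff c₀ c₁ n) / (P.a * (1 - P.a) * ((n + 2) * (n + 1)))

variable {P}

/-- As `a ≠ 0, 1`, the point `a` is ordinary for Gauss' equation, so value and derivative are free.
-/
theorem exists_gauss_solution (hd : P.DistinctPoints) (c₀ c₁ : ℂ) :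
    ∃ G : ℂ⟦X⟧, coeff 0 G = c₀ ∧ coeff 1 G = c₁ ∧
      Polynomial.aeval (eulerOp (d⁄dX ℂ) (C P.a + X)) P.indicial G =
        (C P.a + X) * Polynomial.aeval (eulerOp (d⁄dX ℂ) (C P.a + X)) P.indicialInf G := by
  obtain ⟨ha0, ha1, -⟩ := hd
  set G : ℂ⟦X⟧ := PowerSeries.mk (gaussCoeff P c₀ c₁) with hG
  refine ⟨G, by simp [hG, gaussCoeff], by simp [hG, gaussCoeff], ?_⟩
  have hz : (d⁄dX ℂ) (C P.a + X) = 1 := by simp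
  have h1 : (eulerOp (d⁄dX ℂ) (C P.a + X)) (eulerOp (d⁄dX ℂ) (C P.a + X) G) =
      (C P.a + X) * d⁄dX ℂ G + (C P.a + X) ^ 2 * d⁄dX ℂ (d⁄dX ℂ G) := by
    simp only [eulerOp_apply, Derivation.leibniz, hz, smul_eq_mul]
    ring
  have h0 : eulerOp (d⁄dX ℂ) (C P.a + X) G = (C P.a + X) * d⁄dX ℂ G := rfl
  have e1 : P.indicialInf = .C 1 * .X ^ 2 + .C (P.α + P.β - 2) * .X +
      .C ((P.α - 1) * (P.β - 1)) := by
    simp only [FuchsianParams.indicialInf, Polynomial.C_sub, Polynomial.C_add, Polynomial.C_mul,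
      Polynomial.C_1, Polynomial.C_ofNat]
    ring
  have e2 : P.indicial = .C 1 * .X ^ 2 + .C (P.γ - 1) * .X + .C 0 := by
    simp only [FuchsianParams.indicial, Polynomial.C_1, Polynomial.C_0]
    ring
  have key : C (P.a * (1 - P.a)) * (X ^ 2 * d⁄dX ℂ (d⁄dX ℂ G)) +
      X * (C (1 - 2 * P.a) * (X ^ 2 * d⁄dX ℂ (d⁄dX ℂ G)) +
        C (P.γ - (P.α + P.β - 1) * P.a) * (X * d⁄dX ℂ G)) +
      X ^ 2 * (C (-1) * (X ^ 2 * d⁄dX ℂ (d⁄dX ℂ G)) +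
        C (-(P.α + P.β - 1)) * (X * d⁄dX ℂ G) + C (-((P.α - 1) * (P.β - 1))) * G) = 0 := by
    have := coeff_fourTerm (fun n => P.a * (1 - P.a) * (n * (n - 1)))
      (fun n => (1 - 2 * P.a) * (n * (n - 1)) + (P.γ - (P.α + P.β - 1) * P.a) * n)
      (fun n => -1 * (n * (n - 1)) + -(P.α + P.β - 1) * n + -((P.α - 1) * (P.β - 1)))
      (fun n => 0) G (eulerQuad (P.a * (1 - P.a)) 0 0 G)
      (eulerQuad (1 - 2 * P.a) (P.γ - (P.α + P.β - 1) * P.a) 0 G)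
      (eulerQuad (-1) (-(P.α + P.β - 1)) (-((P.α - 1) * (P.β - 1))) G) 0
      (fun n => by rw [coeff_eulerQuad]; ring) (fun n => by rw [coeff_eulerQuad]; ring)
      (fun n => by rw [coeff_eulerQuad]) (fun n => by simp)
    have hzero : eulerQuad (P.a * (1 - P.a)) 0 0 G +
        X * eulerQuad (1 - 2 * P.a) (P.γ - (P.α + P.β - 1) * P.a) 0 G +
        X ^ 2 * eulerQuad (-1) (-(P.α + P.β - 1)) (-((P.α - 1) * (P.β - 1))) G + X ^ 3 * 0 = 0 := by
      ext n
      rw [this, map_zero]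
      have hc : ∀ n : ℕ, (P.a * (1 - P.a) * ((n + 2) * (n + 1)) : ℂ) ≠ 0 := fun n =>
        mul_ne_zero (mul_ne_zero ha0 (sub_ne_zero.2 ha1.symm))
          (mul_ne_zero (by exact_mod_cast (by omega : n + 2 ≠ 0))
            (by exact_mod_cast (by omega : n + 1 ≠ 0)))
      have hrec : ∀ n : ℕ, P.a * (1 - P.a) * ((n + 2) * (n + 1)) * coeff (n + 2) G =
          -((((1 - 2 * P.a) * n + (P.γ - (P.α + P.β - 1) * P.a)) * (n + 1)) * coeff (n + 1) G -
            (n * (n - 1) + (P.α + P.β - 1) * n + (P.α - 1) * (P.β - 1)) * coeff n G) := by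
        intro n
        rw [hG, coeff_mk, coeff_mk, coeff_mk, gaussCoeff, mul_div_cancel₀ _ (hc n)]
      match n with
      | 0 => simp [fourTerm]
      | 1 => simp [fourTerm]
      | 2 =>
        have h2 := hrec 0
        simp only [fourTerm]
        push_cast at h2 ⊢
        linear_combination h2
      | n + 3 =>
        have h2 := hrec (n + 1)
        simp only [fourTerm]
        push_cast at h2 ⊢
        linear_combination h2
    rw [← hzero]
    simp only [eulerQuad, map_zero]
    ring
  have key2 : (C P.a + X) * (1 - (C P.a + X)) * d⁄dX ℂ (d⁄dX ℂ G) +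
      (C P.γ - (C P.α + C P.β - 1) * (C P.a + X)) * d⁄dX ℂ G -
      (C P.α - 1) * (C P.β - 1) * G = 0 := by
    have : X ^ 2 * ((C P.a + X) * (1 - (C P.a + X)) * d⁄dX ℂ (d⁄dX ℂ G) +
        (C P.γ - (C P.α + C P.β - 1) * (C P.a + X)) * d⁄dX ℂ G -
        (C P.α - 1) * (C P.β - 1) * G) = 0 := by
      rw [← key]
      simp only [map_mul, map_sub, map_add, map_one, map_neg, show (C (2 : ℂ) : ℂ⟦X⟧) = 2 from rfl]
      ring
    exact (mul_eq_zero.1 this).resolve_left (pow_ne_zero _ X_ne_zero)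
  rw [e1, e2, aeval_quadratic_end, aeval_quadratic_end, h1, h0]
  simp only [PowerSeries.algebraMap_apply, Algebra.algebraMap_self, RingHom.id_apply, map_sub,
    map_add, map_mul, map_one, map_zero, map_ofNat]
  linear_combination (C P.a + X) * key2

end Formal

/-! ### Gauss' equation satisfies no Euler equation -/

section Injective

open Polynomial

variable {P : FuchsianParams}

/-- If the translates of `r` avoided the zeros of `W`, all of them would be roots of `S`, which has
finitely many. -/
theorem exists_shift_root {S W : ℂ[X]} (c : ℂ) (hc : ∀ n : ℕ, n ≠ 0 → (n : ℂ) * c ≠ 0)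
    (h0 : S ≠ 0) (h : S ∣ S.comp (X + C c) * W) {r : ℂ} (hr : S.IsRoot r) :
    ∃ m : ℕ, W.IsRoot (r + m * c) := by
  by_contra! hW
  have hroot : ∀ m : ℕ, S.IsRoot (r + m * c) := by
    intro m
    induction m with
    | zero => simpa using hr
    | succ m ih =>
      have := ih.dvd h
      rw [IsRoot, eval_mul, eval_comp] at this
      have := (mul_eq_zero.1 this).resolve_right (hW m)
      have e : (X + C c).eval (r + m * c) = r + ((m + 1 : ℕ) : ℂ) * c := by
        simp only [eval_add, eval_X, eval_C]
        push_cast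
        ring
      rwa [e] at this
  refine (Set.infinite_of_injective_forall_mem (f := fun m : ℕ => r + m * c) ?_ hroot)
    (finite_setOfPred_isRoot h0)
  intro m n hmn
  have hmn' : ((m : ℂ) - n) * c = 0 := by
    linear_combination hmn
  have hc0 : c ≠ 0 := by simpa using hc 1 one_ne_zero
  have := sub_eq_zero.1 ((mul_eq_zero.1 hmn').resolve_right hc0)
  exact_mod_cast this

/-- A nonzero solution of a hypergeometric equation with irreducible monodromy satisfies no
Euler equation. -/
theorem eq_zero_of_aeval_eulerOp {S : Type*} [CommRing S] [Algebra ℂ S] {D : Derivation ℂ S S}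
    {z : S} (hz : D z = 1) (hu : IsUnit z)
    (hint : ∀ m : ℤ, P.α ≠ m ∧ P.β ≠ m ∧ P.γ - P.α ≠ m ∧ P.γ - P.β ≠ m) {G : S}
    (hG : aeval (eulerOp D z) P.indicial G = z * aeval (eulerOp D z) P.indicialInf G)
    {Q : ℂ[X]} (hQ : Q ≠ 0) (h : aeval (eulerOp D z) Q G = 0) : G = 0 := by
  -- The annihilator of `G` is an ideal. By the commutation with `z` its generator `T` divides both
  -- `T(x - 1) indicial` and `T(x + 1) indicialInf`. A root of `T` therefore leads downwards to a
  -- zero of `indicial` and upwards to a zero of `indicialInf`; their integral distance is excluded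
  -- by `hint`.
  let I : Ideal ℂ[X] :=
    { carrier := {p | aeval (eulerOp D z) p G = 0}
      add_mem' := fun {p q} hp hq => by
        simp only [Set.mem_ofPred_eq] at hp hq ⊢
        simp [hp, hq]
      zero_mem' := by simp
      smul_mem' := fun p q hq => by
        simp only [Set.mem_ofPred_eq] at hq ⊢
        rw [smul_eq_mul, aeval_mul_end, hq, map_zero] }
  have hI : ∀ p, p ∈ I ↔ aeval (eulerOp D z) p G = 0 := fun p => Iff.rfl
  obtain ⟨T, hT⟩ := (IsPrincipalIdealRing.principal I).principal
  have hdvd : ∀ p, p ∈ I → T ∣ p := fun p hp => by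
    rw [hT] at hp
    exact Ideal.mem_span_singleton.1 hp
  have hTI : aeval (eulerOp D z) T G = 0 := by
    rw [← hI, hT]
    exact Ideal.mem_span_singleton_self T
  have hT0 : T ≠ 0 := by
    rintro rfl
    exact hQ (zero_dvd_iff.1 (hdvd Q h))
  by_cases hdeg : T.degree = 0
  · rw [eq_C_of_degree_eq_zero hdeg] at hTI hT0
    rw [aeval_C, Module.algebraMap_end_apply] at hTI
    have hc : T.coeff 0 ≠ 0 := fun h => hT0 (by rw [h, C_0])
    have : (T.coeff 0)⁻¹ • T.coeff 0 • G = 0 := by rw [hTI, smul_zero]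
    rwa [smul_smul, inv_mul_cancel₀ hc, one_smul] at this
  obtain ⟨r, hr⟩ := IsAlgClosed.exists_root T hdeg
  have h1 : T ∣ T.comp (X + C (-1)) * P.indicial := by
    apply hdvd
    rw [hI, aeval_mul_end, hG, show (X + C (-1) : ℂ[X]) = X - C 1 by simp [sub_eq_add_neg],
      aeval_eulerOp_comp_mul hz, ← aeval_mul_end, mul_comm T, aeval_mul_end, hTI, map_zero,
      mul_zero]
  have h2 : T ∣ T.comp (X + C 1) * P.indicialInf := by
    apply hdvd
    rw [hI, aeval_mul_end]
    have : z * aeval (eulerOp D z) (T.comp (X + C 1)) (aeval (eulerOp D z) P.indicialInf G) = 0 := by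
      rw [← aeval_eulerOp_mul hz, ← hG, ← aeval_mul_end, mul_comm T, aeval_mul_end, hTI, map_zero]
    exact hu.mul_right_eq_zero.1 this
  obtain ⟨m, hm⟩ := exists_shift_root (-1) (fun n hn => by simpa using hn) hT0 h1 hr
  obtain ⟨n, hn⟩ := exists_shift_root 1 (fun n hn => by simpa using hn) hT0 h2 hr
  simp only [FuchsianParams.indicial, FuchsianParams.indicialInf, IsRoot, eval_mul, eval_add,
    eval_X, eval_C] at hm hn
  exfalso
  rcases mul_eq_zero.1 hm with hm | hm <;> rcases mul_eq_zero.1 hn with hn | hn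
  · refine (hint (1 - m - n)).1 ?_
    push_cast
    linear_combination hn - hm
  · refine (hint (1 - m - n)).2.1 ?_
    push_cast
    linear_combination hn - hm
  · refine (hint (m + n)).2.2.1 ?_
    push_cast
    linear_combination hm - hn
  · refine (hint (m + n)).2.2.2 ?_
    push_cast
    linear_combination hm - hn

end Injective

/-! ### Necessity of the conditions -/

section Necessary

open PowerSeries

variable {P : FuchsianParams}

/-- There is a nonzero formal solution at `a` with a prescribed linear condition. -/
theorem exists_local_solution (hP : P.FuchsRelation) (hd : P.DistinctPoints)
    (hint : ∀ m : ℤ, P.α ≠ m ∧ P.β ≠ m ∧ P.γ - P.α ≠ m ∧ P.γ - P.β ≠ m) {R : Polynomial ℂ}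
    (h0 : R ≠ 0) (hR : P.recurrencePoly R = 0) (L : ℂ⟦X⟧ →ₗ[ℂ] ℂ) :
    ∃ u : ℂ⟦X⟧, u ≠ 0 ∧ fuchsOp P (d⁄dX ℂ) (C P.a + X) u = 0 ∧ L u = 0 := by
  have hz : (d⁄dX ℂ) (C P.a + X) = 1 := by simp
  have hu : IsUnit (C P.a + X : ℂ⟦X⟧) := by
    rw [PowerSeries.isUnit_iff_constantCoeff]
    simpa using hd.1
  set Φ : Module.End ℂ ℂ⟦X⟧ :=
    Polynomial.aeval (eulerOp (d⁄dX ℂ) (C P.a + X)) (R * P.indicialInf) with hΦ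
  have main : ∀ G : ℂ⟦X⟧, G ≠ 0 →
      Polynomial.aeval (eulerOp (d⁄dX ℂ) (C P.a + X)) P.indicial G =
        (C P.a + X) * Polynomial.aeval (eulerOp (d⁄dX ℂ) (C P.a + X)) P.indicialInf G →
      L (Φ G) = 0 →
      ∃ u : ℂ⟦X⟧, u ≠ 0 ∧ fuchsOp P (d⁄dX ℂ) (C P.a + X) u = 0 ∧ L u = 0 := by
    intro G hG0 hG hL
    refine ⟨Φ G, fun h => hG0 ?_, FuchsianParams.fuchsOp_eulerOp_eq_zero hP hz hu hR hG, hL⟩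
    refine eq_zero_of_aeval_eulerOp hz hu hint hG (mul_ne_zero h0 ?_) h
    exact mul_ne_zero (Polynomial.X_add_C_ne_zero _) (Polynomial.X_add_C_ne_zero _)
  -- Gauss' solutions at `a` include two independent ones, so one linear condition still leaves a
  -- nonzero combination.
  obtain ⟨G₁, h10, h11, hG1⟩ := exists_gauss_solution hd 1 0
  obtain ⟨G₂, h20, h21, hG2⟩ := exists_gauss_solution hd 0 1
  by_cases hc : L (Φ G₂) = 0
  · refine main G₂ ?_ hG2 hc
    rintro rfl
    simp at h21
  · refine main (L (Φ G₂) • G₁ - L (Φ G₁) • G₂) ?_ ?_ ?_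
    · intro h
      have := congrArg (coeff 0) h
      rw [map_sub, LinearMap.map_smul, LinearMap.map_smul, h10, h20] at this
      simp [hc] at this
    · rw [map_sub, map_sub, LinearMap.map_smul, LinearMap.map_smul, LinearMap.map_smul,
        LinearMap.map_smul, hG1, hG2, mul_sub, mul_smul_comm, mul_smul_comm]
    · rw [map_sub, map_sub, LinearMap.map_smul, LinearMap.map_smul, LinearMap.map_smul,
        LinearMap.map_smul, smul_eq_mul, smul_eq_mul]
      ring

/-- A nonzero power series solution that vanishes at `a` must start at a positive exponent, and `1 -
ε` is the only candidate. -/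
theorem exists_exponent_of_recurrencePoly (hP : P.FuchsRelation) (hd : P.DistinctPoints)
    (hint : ∀ m : ℤ, P.α ≠ m ∧ P.β ≠ m ∧ P.γ - P.α ≠ m ∧ P.γ - P.β ≠ m) {R : Polynomial ℂ}
    (h0 : R ≠ 0) (hR : P.recurrencePoly R = 0) : ∃ k : ℕ, P.ε = -(k : ℂ) := by
  by_contra! hk
  obtain ⟨u, hu, hsol, hL⟩ := exists_local_solution hP hd hint h0 hR (coeff 0)
  refine hu (eq_zero_of_fuchsOp_local P hP u hsol fun n => ?_)
  cases n with
  | zero => exact Or.inl hL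
  | succ n =>
    right
    rw [localK₀]
    refine mul_ne_zero (mul_ne_zero (mul_ne_zero hd.1 (sub_ne_zero.2 hd.2.1))
      (sub_ne_zero.2 hd.2.2.2.2)) (mul_ne_zero (Nat.cast_ne_zero.2 (by omega)) fun h => hk n ?_)
    push_cast at h
    linear_combination h

/-- Take a nonzero solution without term of degree `k + 1`. It cannot vanish at `a`, for it would
then have no exponent to start at, and a solution with nonzero value excludes logarithms. -/
theorem apparentRec_eq_zero_of_recurrencePoly {k l : ℕ} (hP : P.FuchsRelation)
    (hd : P.DistinctPoints)
    (hint : ∀ m : ℤ, P.α ≠ m ∧ P.β ≠ m ∧ P.γ - P.α ≠ m ∧ P.γ - P.β ≠ m) (hε : P.ε = -k)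
    (hε₁ : P.ε₁ = -l) {R : Polynomial ℂ} (h0 : R ≠ 0) (hR : P.recurrencePoly R = 0) :
    apparentRec k l P.vec 1 P.accessory P.swap.accessory (k + 1) = 0 := by
  by_contra hne
  obtain ⟨u, hu, hsol, hL⟩ := exists_local_solution hP hd hint h0 hR (coeff (k + 1))
  refine hu (eq_zero_of_fuchsOp_local P hP u hsol fun n => ?_)
  by_cases hn0 : n = 0
  · left
    by_contra hcon
    exact hne (apparentRec_eq_zero_of_fuchsOp_local hP hε hε₁ u hsol (hn0 ▸ hcon))
  · by_cases hn1 : n = k + 1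
    · exact Or.inl (hn1 ▸ hL)
    · exact Or.inr (localK₀_ne_zero hd hε hn0 hn1)

theorem isApparentPair_of_recurrencePoly {k l : ℕ} (hP : P.FuchsRelation)
    (hd : P.DistinctPoints)
    (hint : ∀ m : ℤ, P.α ≠ m ∧ P.β ≠ m ∧ P.γ - P.α ≠ m ∧ P.γ - P.β ≠ m) (hε : P.ε = -k)
    (hε₁ : P.ε₁ = -l) {R : Polynomial ℂ} (h0 : R ≠ 0) (hR : P.recurrencePoly R = 0) :
    IsApparentPair k l P.vec P.accessory P.swap.accessory := by
  refine ⟨apparentRec_eq_zero_of_recurrencePoly hP hd hint hε hε₁ h0 hR, ?_⟩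
  rw [← FuchsianParams.swap_vec]
  exact apparentRec_eq_zero_of_recurrencePoly hP.swap hd.swap hint hε₁ hε h0
    ((P.recurrencePoly_swap R).trans hR)

/-- The coefficients of Gauss' hypergeometric series. -/
noncomputable def gaussSeriesCoeff (P : FuchsianParams) (n : ℕ) : ℂ :=
  ((ascPochhammer ℂ n).eval P.α * (ascPochhammer ℂ n).eval P.β) /
    ((ascPochhammer ℂ n).eval P.γ * n.factorial)

theorem ascPochhammer_eval_ne_zero {x : ℂ} (hx : ∀ m : ℕ, x ≠ -m) (n : ℕ) :
    (ascPochhammer ℂ n).eval x ≠ 0 := by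
  induction n with
  | zero => simp
  | succ n ih =>
    rw [ascPochhammer_succ_eval]
    exact mul_ne_zero ih fun h => hx n (by linear_combination h)

theorem gaussSeriesCoeff_succ (hγ : ∀ m : ℕ, P.γ ≠ -m) (n : ℕ) :
    (n + P.γ) * (n + 1) * gaussSeriesCoeff P (n + 1) =
      (n + P.α) * (n + P.β) * gaussSeriesCoeff P n := by
  have h1 := ascPochhammer_eval_ne_zero hγ n
  have h2 : (P.γ + n : ℂ) ≠ 0 := fun h => hγ n (by linear_combination h)
  have h3 : (n.factorial : ℂ) ≠ 0 := by exact_mod_cast n.factorial_ne_zero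
  have h4 : (n + 1 : ℂ) ≠ 0 := by exact_mod_cast n.succ_ne_zero
  rw [gaussSeriesCoeff, gaussSeriesCoeff, ascPochhammer_succ_eval, ascPochhammer_succ_eval,
    ascPochhammer_succ_eval, Nat.factorial_succ]
  push_cast
  field_simp
  ring

theorem gaussSeriesCoeff_ne_zero (hα : ∀ m : ℕ, P.α ≠ -m) (hβ : ∀ m : ℕ, P.β ≠ -m)
    (hγ : ∀ m : ℕ, P.γ ≠ -m) (n : ℕ) : gaussSeriesCoeff P n ≠ 0 :=
  div_ne_zero (mul_ne_zero (ascPochhammer_eval_ne_zero hα n) (ascPochhammer_eval_ne_zero hβ n))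
    (mul_ne_zero (ascPochhammer_eval_ne_zero hγ n) (by exact_mod_cast n.factorial_ne_zero))

/-- The recurrence of index `n + 3`, with all Gauss coefficients expressed by the one of index `n +
2`, is the value of the polynomial at `n + 2`. Infinitely many zeros make it vanish. -/
theorem recurrencePoly_eq_zero (hP : P.FuchsRelation) (hα : ∀ m : ℕ, P.α ≠ -m)
    (hβ : ∀ m : ℕ, P.β ≠ -m) (hγ : ∀ m : ℕ, P.γ ≠ -m) {R : Polynomial ℂ} {u : ℂ⟦X⟧}
    (hu : ∀ n, coeff n u = gaussSeriesCoeff P n * R.eval (n : ℂ))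
    (hsol : fuchsOp P (d⁄dX ℂ) X u = 0) : P.recurrencePoly R = 0 := by
  have hroot : ∀ n : ℕ, (P.recurrencePoly R).IsRoot ((n + 2 : ℕ) : ℂ) := by
    intro n
    have h1 := coeff_X_mul_fuchsOp_origin P hP u (n + 3)
    rw [hsol, mul_zero, map_zero] at h1
    simp only [fourTerm, hu] at h1
    have g0 := gaussSeriesCoeff_succ hγ n
    have g1 := gaussSeriesCoeff_succ hγ (n + 1)
    have g2 := gaussSeriesCoeff_succ hγ (n + 2)
    have hne := gaussSeriesCoeff_ne_zero hα hβ hγ (n + 2)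
    simp only [show n + 1 + 1 = n + 2 from rfl, show n + 2 + 1 = n + 3 from rfl] at g1 g2
    generalize gaussSeriesCoeff P n = c₀ at *
    generalize gaussSeriesCoeff P (n + 1) = c₁ at *
    generalize gaussSeriesCoeff P (n + 2) = c₂ at *
    generalize gaussSeriesCoeff P (n + 3) = c₃ at *
    rw [Polynomial.IsRoot]
    refine (mul_eq_zero.1 (?_ : c₂ * _ = 0)).resolve_left hne
    simp only [FuchsianParams.recurrencePoly, FuchsianParams.indicial, FuchsianParams.indicialInf,
      FuchsianParams.eulerA, FuchsianParams.eulerB, Polynomial.eval_add, Polynomial.eval_sub,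
      Polynomial.eval_mul, Polynomial.eval_comp, Polynomial.eval_X, Polynomial.eval_C,
      Polynomial.eval_pow]
    simp only [originK₀, originK₁, originK₂, lastK] at h1
    push_cast at h1 g0 g1 g2 ⊢
    rw [show (n + 2 - 1 : ℂ) = n + 1 by ring, show (n + 1 - 1 : ℂ) = n by ring,
      show (n + 2 + 1 : ℂ) = n + 3 by ring]
    generalize R.eval (n : ℂ) = r₀ at *
    generalize R.eval (n + 1 : ℂ) = r₁ at *
    generalize R.eval (n + 2 : ℂ) = r₂ at *
    generalize R.eval (n + 3 : ℂ) = r₃ at *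
    clear hu hsol hα hβ hγ hP
    linear_combination (-((n + 1 + P.α) * (n + 1 + P.β))) * h1 +
      ((n + 1) * (n + P.γ) * r₀ + (-(1 + P.a + P.a₁) * (n + 1) ^ 2 +
        ((1 + P.a + P.a₁) - (P.γ * (1 + P.a + P.a₁) + P.δ * (P.a + P.a₁) + P.ε * (1 + P.a₁) +
          P.ε₁ * (1 + P.a))) * (n + 1) - P.θ₁) * r₁) * g1 +
      (n + 1 + P.α) * (n + 1 + P.β) * r₀ * g0 +
      (n + 1 + P.α) * (n + 1 + P.β) * (P.a * P.a₁) * r₃ * g2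
  by_contra hne
  refine (Set.infinite_of_injective_forall_mem (f := fun n : ℕ => ((n + 2 : ℕ) : ℂ)) ?_ hroot)
    (Polynomial.finite_setOfPred_isRoot hne)
  intro m n hmn
  simp only [Nat.cast_inj] at hmn
  omega

end Necessary

/-! ### The connection on the pairs `w₀ u + w₁ z u'` -/

section Connection

variable {S S' : Type*} [CommRing S] [Algebra ℂ S] [CommRing S'] [Algebra ℂ S']
  (P : FuchsianParams) (D : Derivation ℂ S S) (z : S)

/-- The first component of the derivative of `(z - a)^ε (z - a₁)^ε₁ (w₀ u + w₁ z u')`, multiplied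
by `(z - a) (z - a₁)`. -/
def connZero (w₀ w₁ : S) : S :=
  z * (z - 1) * ((z - algebraMap ℂ S P.a) * (z - algebraMap ℂ S P.a₁)) * D w₀ +
  z * (z - 1) * (algebraMap ℂ S P.ε * (z - algebraMap ℂ S P.a₁) +
    algebraMap ℂ S P.ε₁ * (z - algebraMap ℂ S P.a)) * w₀ -
  z * (algebraMap ℂ S P.α * algebraMap ℂ S P.β * z ^ 2 - algebraMap ℂ S P.θ₁ * z -
    algebraMap ℂ S P.θ₀) * w₁

/-- The second component of that derivative. -/
def connOne (w₀ w₁ : S) : S :=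
  z * (z - 1) * D w₁ + (z - 1) * w₀ +
  ((z - 1) * (1 - algebraMap ℂ S P.γ) - algebraMap ℂ S P.δ * z) * w₁

/-- Apply `z (z - 1) d/dz` to `(z - a)^ε (z - a₁)^ε₁ (w₀ u + w₁ z u')` and eliminate `u''`. Without
divisions, and with the equation as error term on the right, the identity also covers truncated
solutions. -/
theorem connection_identity (hz : D z = 1) (u w₀ w₁ w₀' : S)
    (h : (z - algebraMap ℂ S P.a) * (z - algebraMap ℂ S P.a₁) * w₀' = connZero P D z w₀ w₁) :
    (z - algebraMap ℂ S P.a) * (z - algebraMap ℂ S P.a₁) *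
        (z * (z - 1) * D (w₀ * u + w₁ * (z * D u)) -
          (w₀' * u + connOne P D z w₀ w₁ * (z * D u))) +
      z * (z - 1) * (algebraMap ℂ S P.ε * (z - algebraMap ℂ S P.a₁) +
        algebraMap ℂ S P.ε₁ * (z - algebraMap ℂ S P.a)) * (w₀ * u + w₁ * (z * D u)) =
      z * w₁ * fuchsOp P D z u := by
  simp only [connZero] at h
  simp only [map_add, Derivation.leibniz, smul_eq_mul, hz, connOne, fuchsOp]
  linear_combination -u * h

theorem map_connZero (f : S →ₐ[ℂ] S') (D' : Derivation ℂ S' S') (hD : ∀ x, f (D x) = D' (f x))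
    (w₀ w₁ : S) : f (connZero P D z w₀ w₁) = connZero P D' (f z) (f w₀) (f w₁) := by
  simp [connZero, hD]

theorem map_connOne (f : S →ₐ[ℂ] S') (D' : Derivation ℂ S' S') (hD : ∀ x, f (D x) = D' (f x))
    (w₀ w₁ : S) : f (connOne P D z w₀ w₁) = connOne P D' (f z) (f w₀) (f w₁) := by
  simp [connOne, hD]

theorem connZero_swap (w₀ w₁ : S) : connZero P.swap D z w₀ w₁ = connZero P D z w₀ w₁ := by
  simp only [connZero, FuchsianParams.swap]
  ring

/-- The Leibniz terms cancel in the cross product with the pair, so a common factor can be removed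
from an invariant line. -/
theorem connZero_mul (g w₀ w₁ : S) : connZero P D z (g * w₀) (g * w₁) =
    g * connZero P D z w₀ w₁ +
      z * (z - 1) * ((z - algebraMap ℂ S P.a) * (z - algebraMap ℂ S P.a₁)) * D g * w₀ := by
  simp only [connZero, Derivation.leibniz, smul_eq_mul]
  ring

theorem connOne_mul (g w₀ w₁ : S) : connOne P D z (g * w₀) (g * w₁) =
    g * connOne P D z w₀ w₁ + z * (z - 1) * D g * w₁ := by
  simp only [connOne, Derivation.leibniz, smul_eq_mul]
  ring

end Connection

/-! ### Action of the connection on leading coefficients -/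

section Top

open Polynomial

/-- The coefficient of `X ^ m` of a polynomial of degree at most `m`. -/
def TopCoeff (m : ℕ) (p : ℂ[X]) (a : ℂ) : Prop := p.natDegree ≤ m ∧ p.coeff m = a

theorem TopCoeff.add {m : ℕ} {p q : ℂ[X]} {a b : ℂ} (hp : TopCoeff m p a) (hq : TopCoeff m q b) :
    TopCoeff m (p + q) (a + b) :=
  ⟨natDegree_add_le_of_degree_le hp.1 hq.1, by rw [coeff_add, hp.2, hq.2]⟩

theorem TopCoeff.sub {m : ℕ} {p q : ℂ[X]} {a b : ℂ} (hp : TopCoeff m p a) (hq : TopCoeff m q b) :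
    TopCoeff m (p - q) (a - b) :=
  ⟨natDegree_sub_le_of_le hp.1 hq.1 |>.trans (by simp), by rw [coeff_sub, hp.2, hq.2]⟩

theorem TopCoeff.mul {m n : ℕ} {p q : ℂ[X]} {a b : ℂ} (hp : TopCoeff m p a)
    (hq : TopCoeff n q b) : TopCoeff (m + n) (p * q) (a * b) :=
  ⟨natDegree_mul_le_of_le hp.1 hq.1, by
    rw [coeff_mul_add_eq_of_natDegree_le hp.1 hq.1, hp.2, hq.2]⟩

theorem TopCoeff.C (a : ℂ) : TopCoeff 0 (C a) a := ⟨natDegree_C a |>.le, coeff_C_zero⟩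

theorem TopCoeff.X : TopCoeff 1 X 1 := ⟨natDegree_X_le, coeff_X_one⟩

theorem TopCoeff.X_sub_C (a : ℂ) : TopCoeff 1 (.X - .C a) 1 :=
  ⟨natDegree_X_sub_C_le a, by simp⟩

theorem TopCoeff.X_mul_derivative {m : ℕ} {p : ℂ[X]} {a : ℂ} (hp : TopCoeff m p a) :
    TopCoeff m (.X * polyD p) (m * a) := by
  have hd : polyD p = derivative p := rfl
  have key : ∀ n, (.X * polyD p : ℂ[X]).coeff n = n * p.coeff n := by
    intro n
    rw [hd]
    cases n with
    | zero => simp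
    | succ n =>
      rw [coeff_X_mul, coeff_derivative]
      push_cast
      ring
  refine ⟨natDegree_le_iff_coeff_eq_zero.2 fun n hn => ?_, by rw [key, hp.2]⟩
  rw [key, natDegree_le_iff_coeff_eq_zero.1 hp.1 n hn, mul_zero]

theorem TopCoeff.of_mul {m n : ℕ} {p q : ℂ[X]} {a : ℂ} (hq : q.Monic) (hn : q.natDegree = n)
    (h : TopCoeff (n + m) (q * p) a) : TopCoeff m p a := by
  have hd : p.natDegree ≤ m := by
    by_cases hp : p = 0
    · simp [hp]
    have := h.1
    rw [hq.natDegree_mul' hp, hn] at this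
    omega
  refine ⟨hd, ?_⟩
  rw [← h.2, coeff_mul_add_eq_of_natDegree_le hn.le hd, ← hn, hq.coeff_natDegree, one_mul]

theorem TopCoeff.quadratic (a b c : ℂ) : TopCoeff 2 (.C a * .X ^ 2 + .C b * .X + .C c) a :=
  ⟨natDegree_quadratic_le, by simp⟩

theorem TopCoeff.quadric (P : FuchsianParams) :
    TopCoeff 2 (algebraMap ℂ ℂ[X] P.α * algebraMap ℂ ℂ[X] P.β * .X ^ 2 - algebraMap ℂ ℂ[X] P.θ₁ * .X -
      algebraMap ℂ ℂ[X] P.θ₀) (P.α * P.β) := by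
  have h : algebraMap ℂ ℂ[X] P.α * algebraMap ℂ ℂ[X] P.β * .X ^ 2 - algebraMap ℂ ℂ[X] P.θ₁ * .X -
      algebraMap ℂ ℂ[X] P.θ₀ = .C (P.α * P.β) * .X ^ 2 + .C (-P.θ₁) * .X + .C (-P.θ₀) := by
    simp only [algebraMap_eq, C_mul, C_neg]
    ring
  rw [h]
  exact TopCoeff.quadratic _ _ _

theorem topCoeff_connZero (P : FuchsianParams) {m : ℕ} {w₀ w₁ : ℂ[X]} {x₀ x₁ : ℂ}
    (h₀ : TopCoeff m w₀ x₀) (h₁ : TopCoeff m w₁ x₁) :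
    TopCoeff (m + 3) (connZero P polyD .X w₀ w₁) ((m + P.ε + P.ε₁) * x₀ - P.α * P.β * x₁) := by
  have hX := TopCoeff.X
  have h1 : TopCoeff 1 (.X - 1 : ℂ[X]) 1 := by simpa using TopCoeff.X_sub_C 1
  have hA := TopCoeff.X_sub_C P.a
  have hA₁ := TopCoeff.X_sub_C P.a₁
  have a1 := ((h1.mul (hA.mul hA₁)).mul h₀.X_mul_derivative)
  have a2 := ((hX.mul h1).mul (((TopCoeff.C P.ε).mul hA₁).add
    (((TopCoeff.C P.ε₁).mul hA)))).mul h₀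
  have a3 := (hX.mul (TopCoeff.quadric P)).mul h₁
  have e : 1 + (1 + 1) + m = m + 3 := by omega
  have e2 : 1 + 1 + (0 + 1) + m = m + 3 := by omega
  have e3 : 1 + 2 + m = m + 3 := by omega
  rw [e] at a1
  rw [e2] at a2
  rw [e3] at a3
  have := (a1.add a2).sub a3
  convert this using 1
  · simp only [connZero, algebraMap_eq]
    ring
  · ring

theorem topCoeff_connOne (P : FuchsianParams) {m : ℕ} {w₀ w₁ : ℂ[X]} {x₀ x₁ : ℂ}
    (h₀ : TopCoeff m w₀ x₀) (h₁ : TopCoeff m w₁ x₁) :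
    TopCoeff (m + 1) (connOne P polyD .X w₀ w₁) (x₀ + (m + 1 - P.γ - P.δ) * x₁) := by
  have hX := TopCoeff.X
  have h1 : TopCoeff 1 (.X - 1 : ℂ[X]) 1 := by simpa using TopCoeff.X_sub_C 1
  have a1 := h1.mul h₁.X_mul_derivative
  have a2 := h1.mul h₀
  have a3 := ((h1.mul (TopCoeff.C (1 - P.γ))).sub ((TopCoeff.C P.δ).mul hX)).mul h₁
  rw [add_comm 1 m] at a1 a2
  have e : 1 + 0 + m = m + 1 := by omega
  rw [e] at a3
  have := (a1.add a2).add a3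
  convert this using 1
  · simp only [connOne, algebraMap_eq, C_sub, C_1]
    ring
  · ring

end Top

/-! ### Irreducibility of the connection -/

section Irreducible

open Polynomial

variable {P : FuchsianParams} {k l : ℕ}

theorem eval_connZero (w₀ w₁ : ℂ[X]) (x : ℂ) : (connZero P polyD X w₀ w₁).eval x =
    x * (x - 1) * ((x - P.a) * (x - P.a₁)) * (polyD w₀).eval x +
    x * (x - 1) * (P.ε * (x - P.a₁) + P.ε₁ * (x - P.a)) * w₀.eval x -
    x * (P.α * P.β * x ^ 2 - P.θ₁ * x - P.θ₀) * w₁.eval x := by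
  simp [connZero, algebraMap_eq]

theorem eval_connOne (w₀ w₁ : ℂ[X]) (x : ℂ) : (connOne P polyD X w₀ w₁).eval x =
    x * (x - 1) * (polyD w₁).eval x + (x - 1) * w₀.eval x +
    ((x - 1) * (1 - P.γ) - P.δ * x) * w₁.eval x := by
  simp [connOne, algebraMap_eq]

/-- The residue theorem for `m / (z (z - 1) (z - a) (z - a₁))`: the residues `r₀, …, r₃` add up to
the top coefficient. -/
theorem cubic_partial_fraction {m : ℂ[X]} (hm : m.natDegree ≤ 3) (hd : P.DistinctPoints)
    {r₀ r₁ r₂ r₃ : ℂ} (h₀ : m.eval 0 = -(P.a * P.a₁) * r₀)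
    (h₁ : m.eval 1 = (1 - P.a) * (1 - P.a₁) * r₁)
    (h₂ : m.eval P.a = P.a * (P.a - 1) * (P.a - P.a₁) * r₂)
    (h₃ : m.eval P.a₁ = P.a₁ * (P.a₁ - 1) * (P.a₁ - P.a) * r₃) :
    m.coeff 3 = r₀ + r₁ + r₂ + r₃ := by
  obtain ⟨ha0, ha1, hb0, hb1, hab⟩ := hd
  have e : ∀ x, m.eval x = m.coeff 0 + m.coeff 1 * x + m.coeff 2 * x ^ 2 + m.coeff 3 * x ^ 3 := by
    intro x
    rw [eval_eq_sum_range' (n := 4) (by omega)]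
    simp [Finset.sum_range_succ]
  rw [e] at h₀ h₁ h₂ h₃
  generalize m.coeff 0 = c₀ at *
  generalize m.coeff 1 = c₁ at *
  generalize m.coeff 2 = c₂ at *
  generalize m.coeff 3 = c₃ at *
  generalize P.a = a at *
  generalize P.a₁ = b at *
  have f1 := sub_ne_zero.2 ha1
  have f2 := sub_ne_zero.2 hb1
  have f3 := sub_ne_zero.2 hab
  have key : (a * b * (a - 1) * (b - 1) * (a - b)) * (c₃ - (r₀ + r₁ + r₂ + r₃)) = 0 := by
    linear_combination (-(a - 1) * (b - 1) * (a - b)) * h₀ + a * b * (a - b) * h₁ +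
      b * (b - 1) * h₂ - a * (a - 1) * h₃
  exact sub_eq_zero.1 ((mul_eq_zero.1 key).resolve_left
    (mul_ne_zero (mul_ne_zero (mul_ne_zero (mul_ne_zero ha0 hb0) f1) f2) f3))

/-- An invariant line of the connection spanned by a coprime pair contradicts the
nonintegrality of the exponents. -/
theorem no_coprime_eigenvector (hP : P.FuchsRelation) (hd : P.DistinctPoints)
    (hint : ∀ m : ℤ, P.α ≠ m ∧ P.β ≠ m ∧ P.γ - P.α ≠ m ∧ P.γ - P.β ≠ m) (hε : P.ε = -k)
    (hε₁ : P.ε₁ = -l) {s₀ s₁ m : ℂ[X]} (hs : IsCoprime s₀ s₁)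
    (h₀ : connZero P polyD X s₀ s₁ = m * s₀)
    (h₁ : (X - C P.a) * (X - C P.a₁) * connOne P polyD X s₀ s₁ = m * s₁) : False := by
  have hne : ∀ x, s₀.eval x = 0 → s₁.eval x ≠ 0 := by
    intro x hx0 hx1
    obtain ⟨u, v, huv⟩ := hs
    have := congrArg (eval x) huv
    simp [hx0, hx1] at this
  have ev₀ : ∀ x, _ := fun x => congrArg (eval x) h₀
  have ev₁ : ∀ x, _ := fun x => congrArg (eval x) h₁
  simp only [eval_mul, eval_sub, eval_X, eval_C, eval_connZero, eval_connOne] at ev₀ ev₁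
  have d1 := sub_ne_zero.2 hd.2.1
  have d2 := sub_ne_zero.2 hd.2.2.2.1
  have d3 := sub_ne_zero.2 hd.2.2.2.2
  have d4 := sub_ne_zero.2 hd.2.2.2.2.symm
  -- At each finite singularity the residue of `m` is one of two local eigenvalues. Coprimality
  -- leaves a nonzero component of the pair by which to divide.
  have r₀ : ∃ r, m.eval 0 = -(P.a * P.a₁) * r ∧ (r = 0 ∨ r = 1 - P.γ) := by
    have e0 := ev₀ 0
    have e1 := ev₁ 0
    by_cases hx : s₀.eval 0 = 0
    · refine ⟨1 - P.γ, mul_right_cancel₀ (hne 0 hx) ?_, Or.inr rfl⟩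
      rw [hx] at e1
      linear_combination -e1
    · exact ⟨0, mul_right_cancel₀ hx (by linear_combination -e0), Or.inl rfl⟩
  have r₁ : ∃ r, m.eval 1 = (1 - P.a) * (1 - P.a₁) * r ∧ (r = 0 ∨ r = -P.δ) := by
    have e0 := ev₀ 1
    have e1 := ev₁ 1
    by_cases hx : s₁.eval 1 = 0
    · have hx0 : s₀.eval 1 ≠ 0 := fun h => hne 1 h hx
      refine ⟨0, mul_right_cancel₀ hx0 ?_, Or.inl rfl⟩
      rw [hx] at e0
      linear_combination -e0
    · exact ⟨-P.δ, mul_right_cancel₀ hx (by linear_combination -e1), Or.inr rfl⟩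
  have r₂ : ∃ i : ℤ, m.eval P.a = P.a * (P.a - 1) * (P.a - P.a₁) * (i : ℂ) := by
    have e0 := ev₀ P.a
    have e1 := ev₁ P.a
    by_cases hx : s₁.eval P.a = 0
    · have hx0 : s₀.eval P.a ≠ 0 := fun h => hne _ h hx
      refine ⟨-k, mul_right_cancel₀ hx0 ?_⟩
      rw [hx, hε] at e0
      push_cast
      linear_combination -e0
    · exact ⟨0, mul_right_cancel₀ hx (by push_cast; linear_combination -e1)⟩
  have r₃ : ∃ i : ℤ, m.eval P.a₁ = P.a₁ * (P.a₁ - 1) * (P.a₁ - P.a) * (i : ℂ) := by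
    have e0 := ev₀ P.a₁
    have e1 := ev₁ P.a₁
    by_cases hx : s₁.eval P.a₁ = 0
    · have hx0 : s₀.eval P.a₁ ≠ 0 := fun h => hne _ h hx
      refine ⟨-l, mul_right_cancel₀ hx0 ?_⟩
      rw [hx, hε₁] at e0
      push_cast
      linear_combination -e0
    · exact ⟨0, mul_right_cancel₀ hx (by push_cast; linear_combination -e1)⟩
  obtain ⟨r₀, hr₀, hr₀'⟩ := r₀
  obtain ⟨r₁, hr₁, hr₁'⟩ := r₁
  obtain ⟨r₂, hr₂⟩ := r₂
  obtain ⟨r₃, hr₃⟩ := r₃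
  set σ := max s₀.natDegree s₁.natDegree with hσ
  have t₀ : TopCoeff σ s₀ (s₀.coeff σ) := ⟨le_max_left _ _, rfl⟩
  have t₁ : TopCoeff σ s₁ (s₁.coeff σ) := ⟨le_max_right _ _, rfl⟩
  have hs0 : s₀ ≠ 0 ∨ s₁ ≠ 0 := by
    by_contra! h
    exact hne 0 (by simp [h.1]) (by simp [h.2])
  have hx : s₀.coeff σ ≠ 0 ∨ s₁.coeff σ ≠ 0 := by
    by_contra! h
    rcases max_choice s₀.natDegree s₁.natDegree with hm | hm <;> rw [hσ, hm] at h
    · have hz := leadingCoeff_eq_zero.1 h.1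
      have : s₁.natDegree = 0 := by
        have := hm ▸ le_max_right s₀.natDegree s₁.natDegree
        simpa [hz] using this
      have h2 := h.2
      rw [hz, natDegree_zero, ← this] at h2
      exact hs0.elim (fun h => h hz) (fun h => h (leadingCoeff_eq_zero.1 h2))
    · have hz := leadingCoeff_eq_zero.1 h.2
      have : s₀.natDegree = 0 := by
        have := hm ▸ le_max_left s₀.natDegree s₁.natDegree
        simpa [hz] using this
      have h2 := h.1
      rw [hz, natDegree_zero, ← this] at h2
      exact hs0.elim (fun h => h (leadingCoeff_eq_zero.1 h2)) (fun h => h hz)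
  have T₀ := topCoeff_connZero P t₀ t₁
  have T₁ := ((TopCoeff.X_sub_C P.a).mul (TopCoeff.X_sub_C P.a₁)).mul (topCoeff_connOne P t₀ t₁)
  rw [h₀] at T₀
  rw [h₁, show 1 + 1 + (σ + 1) = σ + 3 by omega] at T₁
  have hm3 : m.natDegree ≤ 3 := by
    by_cases hm0 : m = 0
    · simp [hm0]
    rcases hx with hx | hx
    · have hs := le_natDegree_of_ne_zero hx
      have hs' : s₀ ≠ 0 := fun h => hx (by simp [h])
      have := T₀.1
      rw [natDegree_mul hm0 hs'] at this
      omega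
    · have hs := le_natDegree_of_ne_zero hx
      have hs' : s₁ ≠ 0 := fun h => hx (by simp [h])
      have := T₁.1
      rw [natDegree_mul hm0 hs'] at this
      omega
  have c₀ := T₀.2
  have c₁ := T₁.2
  rw [add_comm σ 3, coeff_mul_add_eq_of_natDegree_le hm3 t₀.1] at c₀
  rw [add_comm σ 3, coeff_mul_add_eq_of_natDegree_le hm3 t₁.1] at c₁
  have hc := cubic_partial_fraction hm3 hd hr₀ hr₁ hr₂ hr₃
  have hδ : P.δ = 1 + P.α + P.β - P.γ - P.ε - P.ε₁ := by rw [hP]; ring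
  have hx₁ : s₁.coeff σ ≠ 0 := by
    intro h1
    rw [h1] at c₁ hx
    refine hx.elim (fun h => h ?_) (fun h => h rfl)
    linear_combination -c₁
  -- The top coefficients form an eigenvector at infinity. Eliminating them leaves a quadratic
  -- relation whose roots carry `-α` and `-β`.
  have hτ : (m.coeff 3 - σ - P.ε - P.ε₁ + P.α) * (m.coeff 3 - σ - P.ε - P.ε₁ + P.β) = 0 := by
    refine mul_right_cancel₀ hx₁ ?_
    rw [hδ] at c₁
    linear_combination c₀ + (m.coeff 3 - σ - P.ε - P.ε₁) * c₁
  rw [hε, hε₁] at hτ hδ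
  rw [hc] at hτ
  -- Two choices each at 0, 1 and infinity. In all eight cases the residue theorem makes one of `α`,
  -- `β`, `γ - α`, `γ - β` an integer.
  rcases mul_eq_zero.1 hτ with hτ | hτ <;> rcases hr₀' with h0 | h0 <;>
    rcases hr₁' with h1 | h1 <;> rw [h0, h1] at hτ
  · refine (hint (σ - k - l - r₂ - r₃)).1 ?_
    push_cast
    linear_combination hτ
  · refine (hint (1 + k + l - (r₂ + r₃ - σ + k + l))).2.2.2 ?_
    push_cast
    linear_combination hτ + hδ
  · refine (hint (1 + (r₂ + r₃ - σ + k + l))).2.2.1 ?_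
    push_cast
    linear_combination -hτ
  · refine (hint (r₂ + r₃ - σ)).2.1 ?_
    push_cast
    linear_combination -hτ - hδ
  · refine (hint (σ - k - l - r₂ - r₃)).2.1 ?_
    push_cast
    linear_combination hτ
  · refine (hint (1 + k + l - (r₂ + r₃ - σ + k + l))).2.2.1 ?_
    push_cast
    linear_combination hτ + hδ
  · refine (hint (1 + (r₂ + r₃ - σ + k + l))).2.2.2 ?_
    push_cast
    linear_combination -hτ
  · refine (hint (r₂ + r₃ - σ)).1 ?_
    push_cast
    linear_combination -hτ - hδ

theorem eq_zero_of_invariant_line (hP : P.FuchsRelation) (hd : P.DistinctPoints)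
    (hint : ∀ m : ℤ, P.α ≠ m ∧ P.β ≠ m ∧ P.γ - P.α ≠ m ∧ P.γ - P.β ≠ m) (hε : P.ε = -k)
    (hε₁ : P.ε₁ = -l) {w₀ w₁ : ℂ[X]}
    (h : w₀ * ((X - C P.a) * (X - C P.a₁) * connOne P polyD X w₀ w₁) =
      w₁ * connZero P polyD X w₀ w₁) : w₀ = 0 ∧ w₁ = 0 := by
  by_contra hne
  obtain ⟨g, s₀, s₁, hg, hs, rfl, rfl⟩ : ∃ g s₀ s₁ : ℂ[X], g ≠ 0 ∧ IsCoprime s₀ s₁ ∧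
      w₀ = g * s₀ ∧ w₁ = g * s₁ := by
    have hg : EuclideanDomain.gcd w₀ w₁ ≠ 0 := fun h0 =>
      hne (EuclideanDomain.gcd_eq_zero_iff.1 h0)
    obtain ⟨s₀, h0⟩ := EuclideanDomain.gcd_dvd_left w₀ w₁
    obtain ⟨s₁, h1⟩ := EuclideanDomain.gcd_dvd_right w₀ w₁
    refine ⟨_, s₀, s₁, hg, ?_, h0, h1⟩
    have hb := EuclideanDomain.gcd_eq_gcd_ab w₀ w₁
    refine ⟨EuclideanDomain.gcdA w₀ w₁, EuclideanDomain.gcdB w₀ w₁, mul_left_cancel₀ hg ?_⟩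
    conv_rhs => rw [mul_one, hb]
    linear_combination -EuclideanDomain.gcdA w₀ w₁ * h0 - EuclideanDomain.gcdB w₀ w₁ * h1
  rw [connZero_mul, connOne_mul] at h
  have h' : s₀ * ((X - C P.a) * (X - C P.a₁) * connOne P polyD X s₀ s₁) =
      s₁ * connZero P polyD X s₀ s₁ := by
    refine mul_left_cancel₀ (mul_ne_zero hg hg) ?_
    simp only [algebraMap_eq] at h
    linear_combination h
  obtain ⟨m, hm⟩ : s₀ ∣ connZero P polyD X s₀ s₁ :=
    hs.dvd_of_dvd_mul_left ⟨_, h'.symm⟩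
  by_cases h0 : s₀ = 0
  · subst h0
    have hu : s₁ ≠ 0 := by
      rintro rfl
      exact not_isCoprime_zero_zero hs
    rw [zero_mul] at h' hm
    have hu1 : IsUnit s₁ := isCoprime_zero_left.1 hs
    obtain ⟨v, hv⟩ := hu1.exists_right_inv
    refine no_coprime_eigenvector hP hd hint hε hε₁ hs
      (m := v * ((X - C P.a) * (X - C P.a₁) * connOne P polyD X 0 s₁)) ?_ ?_
    · rw [hm, mul_zero]
    · linear_combination -((X - C P.a) * (X - C P.a₁) * connOne P polyD X 0 s₁) * hv
  · refine no_coprime_eigenvector hP hd hint hε hε₁ hs (m := m) (by rw [hm, mul_comm]) ?_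
    refine mul_left_cancel₀ h0 ?_
    rw [h', hm]
    ring

end Irreducible

/-! ### Adapted pairs -/

section Adapted

open Polynomial

variable {P : FuchsianParams} {k l : ℕ} {U U₁ w₀ w₁ w₀' : ℂ[X]}

/-- The connection preserves the pairs with `w₀ u + w₁ z u'` vanishing to order `k` at `a`. -/
theorem dvd_connection (hd : P.DistinctPoints) (hε : P.ε = -k)
    (hU : (X - C P.a) ^ (k + 1) ∣ fuchsOp P polyD X U)
    (h : (X - C P.a) * (X - C P.a₁) * w₀' = connZero P polyD X w₀ w₁)
    (hw : (X - C P.a) ^ k ∣ w₀ * U + w₁ * (X * polyD U)) :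
    (X - C P.a) ^ k ∣ w₀' * U + connOne P polyD X w₀ w₁ * (X * polyD U) := by
  have hz : polyD (X : ℂ[X]) = 1 := by simp
  have key := connection_identity P polyD X hz U w₀ w₁ w₀' h
  obtain ⟨Y, hY⟩ := hw
  obtain ⟨V, hV⟩ := hU
  rw [hY, hV] at key
  simp only [algebraMap_eq, hε, C_neg, Derivation.leibniz, smul_eq_mul] at key
  set A : ℂ[X] := X - C P.a with hA
  set A₁ : ℂ[X] := X - C P.a₁ with hA₁
  -- The derivative of `A ^ k` cancels the term with `ε = -k`.
  have hAD : A * polyD (A ^ k) = C (k : ℂ) * A ^ k := by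
    cases k with
    | zero => simp
    | succ k =>
      rw [Derivation.leibniz_pow, hA]
      simp
      ring
  have hcop : IsCoprime (A ^ k) A₁ :=
    (isCoprime_X_sub_C_of_isUnit_sub (sub_ne_zero.2 hd.2.2.2.2).isUnit).pow_left
  refine hcop.dvd_of_dvd_mul_left (?_ : _ ∣ A₁ * _)
  -- One factor `A` is cancelled here, which is why `U` has to solve the equation to order `k + 1`.
  have hA0 : A ≠ 0 := X_sub_C_ne_zero _
  refine (mul_dvd_mul_iff_left hA0).1 ?_
  refine ⟨A₁ * (X * (X - 1)) * polyD Y + X * (X - 1) * (C P.ε₁) * Y - X * w₁ * V, ?_⟩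
  linear_combination -key + A₁ * (X * (X - 1)) * Y * hAD

/-- Evaluate at `a`. The equation of `U` expresses the numerator of `q` by `U'(a)`. For `k > 0`
adaptedness gives `w₀(a) + a w₁(a) U'(a) = 0`; for `k = 0` the term with `ε` is absent. -/
theorem dvd_connZero (hε : P.ε = -k)
    (hU1 : U.eval P.a = 1) (hU : (X - C P.a) ^ (k + 1) ∣ fuchsOp P polyD X U)
    (hw : (X - C P.a) ^ k ∣ w₀ * U + w₁ * (X * polyD U)) :
    X - C P.a ∣ connZero P polyD X w₀ w₁ := by
  rw [dvd_iff_isRoot, IsRoot, eval_connZero]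
  have h1 := congrArg (eval P.a) (Classical.choose_spec hU)
  rw [eval_mul] at h1
  simp [fuchsOp, algebraMap_eq, hU1] at h1
  cases k with
  | zero =>
    simp only [Nat.cast_zero, neg_zero] at hε
    rw [hε] at h1 ⊢
    linear_combination -P.a * w₁.eval P.a * h1
  | succ k =>
    obtain ⟨Y, hY⟩ := hw
    have h2 := congrArg (eval P.a) hY
    simp [hU1] at h2
    simp only [polyD] at *
    linear_combination -P.a * w₁.eval P.a * h1 +
      P.a * (P.a - 1) * (P.a - P.a₁) * P.ε * h2

/-- The local data of an equation with apparent singularities at `a` and `a₁`. -/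
structure ApparentData (P : FuchsianParams) (k l : ℕ) (U U₁ : ℂ[X]) : Prop where
  rel : P.FuchsRelation
  dist : P.DistinctPoints
  eps : P.ε = -k
  eps₁ : P.ε₁ = -l
  eval : U.eval P.a = 1
  dvd : (X - C P.a) ^ (k + 1) ∣ fuchsOp P polyD X U
  eval₁ : U₁.eval P.a₁ = 1
  dvd₁ : (X - C P.a₁) ^ (l + 1) ∣ fuchsOp P polyD X U₁

/-- The pairs with `w₀ u + w₁ z u'` divisible by `(z - a) ^ k (z - a₁) ^ l` for all local
solutions. -/
def Adapted (P : FuchsianParams) (k l : ℕ) (U U₁ w₀ w₁ : ℂ[X]) : Prop :=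
  (X - C P.a) ^ k ∣ w₀ * U + w₁ * (X * polyD U) ∧
  (X - C P.a₁) ^ l ∣ w₀ * U₁ + w₁ * (X * polyD U₁)

theorem ApparentData.exists_connection (h : ApparentData P k l U U₁)
    (hw : Adapted P k l U U₁ w₀ w₁) : ∃ w₀' : ℂ[X],
      (X - C P.a) * (X - C P.a₁) * w₀' = connZero P polyD X w₀ w₁ ∧
      Adapted P k l U U₁ w₀' (connOne P polyD X w₀ w₁) := by
  have d1 := dvd_connZero h.eps h.eval h.dvd hw.1
  have d2 := dvd_connZero (P := P.swap) h.eps₁ h.eval₁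
    (by rw [fuchsOp_swap]; exact h.dvd₁) hw.2
  rw [connZero_swap] at d2
  have hcop : IsCoprime (X - C P.a) (X - C P.a₁) :=
    isCoprime_X_sub_C_of_isUnit_sub (sub_ne_zero.2 h.dist.2.2.2.2).isUnit
  obtain ⟨w₀', hw'⟩ := hcop.mul_dvd d1 d2
  refine ⟨w₀', hw'.symm, dvd_connection h.dist h.eps h.dvd hw'.symm hw.1, ?_⟩
  have := dvd_connection (P := P.swap) h.dist.swap h.eps₁ (U := U₁) (w₀ := w₀) (w₁ := w₁) (w₀' := w₀')
    (by rw [fuchsOp_swap]; exact h.dvd₁)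
    (by rw [connZero_swap, hw', mul_comm (X - C P.swap.a)]; rfl) hw.2
  exact this

theorem Adapted.add {v₀ v₁ : ℂ[X]} (hw : Adapted P k l U U₁ w₀ w₁)
    (hv : Adapted P k l U U₁ v₀ v₁) : Adapted P k l U U₁ (w₀ + v₀) (w₁ + v₁) := by
  refine ⟨?_, ?_⟩
  · convert dvd_add hw.1 hv.1 using 1
    ring
  · convert dvd_add hw.2 hv.2 using 1
    ring

theorem Adapted.mul (p : ℂ[X]) (hw : Adapted P k l U U₁ w₀ w₁) :
    Adapted P k l U U₁ (p * w₀) (p * w₁) := by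
  refine ⟨?_, ?_⟩
  · convert hw.1.mul_left p using 1
    ring
  · convert hw.2.mul_left p using 1
    ring

theorem Adapted.of_mul {p : ℂ[X]} (h0 : IsCoprime (X - C P.a) p) (h1 : IsCoprime (X - C P.a₁) p)
    (hw : Adapted P k l U U₁ (p * w₀) (p * w₁)) : Adapted P k l U U₁ w₀ w₁ := by
  refine ⟨h0.pow_left.dvd_of_dvd_mul_left (?_ : _ ∣ p * _),
    h1.pow_left.dvd_of_dvd_mul_left (?_ : _ ∣ p * _)⟩
  · convert hw.1 using 1
    ring
  · convert hw.2 using 1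
    ring

/-- Eliminating `V'` from the two divisible combinations leaves `V` times the determinant, and `V`
is coprime to `X - c`. -/
theorem dvd_wronskian_aux {c : ℂ} {V v₀ v₁ : ℂ[X]} (hV : V.eval c ≠ 0) {n : ℕ}
    (hw : (X - C c) ^ n ∣ w₀ * V + w₁ * (X * polyD V))
    (hv : (X - C c) ^ n ∣ v₀ * V + v₁ * (X * polyD V)) : (X - C c) ^ n ∣ w₀ * v₁ - w₁ * v₀ := by
  have hcop : IsCoprime (X - C c) V := by
    refine (irreducible_X_sub_C c).coprime_iff_not_dvd.2 ?_
    rwa [dvd_iff_isRoot]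
  refine hcop.pow_left.dvd_of_dvd_mul_left (?_ : _ ∣ V * _)
  convert dvd_sub (hw.mul_left v₁) (hv.mul_left w₁) using 1
  ring

theorem ApparentData.dvd_wronskian (h : ApparentData P k l U U₁) {v₀ v₁ : ℂ[X]}
    (hw : Adapted P k l U U₁ w₀ w₁) (hv : Adapted P k l U U₁ v₀ v₁) :
    (X - C P.a) ^ k * (X - C P.a₁) ^ l ∣ w₀ * v₁ - w₁ * v₀ := by
  refine IsCoprime.mul_dvd ?_ (dvd_wronskian_aux (by simp [h.eval]) hw.1 hv.1)
    (dvd_wronskian_aux (by simp [h.eval₁]) hw.2 hv.2)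
  exact (isCoprime_X_sub_C_of_isUnit_sub (sub_ne_zero.2 h.dist.2.2.2.2).isUnit).pow

theorem ApparentData.topCoeff_derivative (h : ApparentData P k l U U₁) {d : ℕ} {x₀ x₁ : ℂ}
    (hw : (X - C P.a) * (X - C P.a₁) * w₀' = connZero P polyD X w₀ w₁)
    (h₀ : TopCoeff d w₀ x₀) (h₁ : TopCoeff d w₁ x₁) :
    TopCoeff (d + 1) w₀' ((d - (k + l : ℕ)) * x₀ - P.α * P.β * x₁) ∧
    TopCoeff (d + 1) (connOne P polyD X w₀ w₁)
      (x₀ + (d - (k + l : ℕ) - P.α - P.β) * x₁) := by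
  have hP := h.rel
  simp only [FuchsianParams.FuchsRelation] at hP
  constructor
  · refine TopCoeff.of_mul (n := 2) ((monic_X_sub_C P.a).mul (monic_X_sub_C P.a₁)) ?_ ?_
    · rw [natDegree_mul (X_sub_C_ne_zero _) (X_sub_C_ne_zero _), natDegree_X_sub_C,
        natDegree_X_sub_C]
    · rw [hw]
      have := topCoeff_connZero P h₀ h₁
      rw [h.eps, h.eps₁] at this
      convert this using 1
      · omega
      · push_cast
        ring
  · have := topCoeff_connOne P h₀ h₁
    convert this using 1
    rw [h.eps, h.eps₁] at hP
    push_cast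
    linear_combination -x₁ * hP

/-- There is a nonzero adapted pair of small degree. -/
theorem exists_adapted (P : FuchsianParams) (k l d i : ℕ) (U U₁ : ℂ[X]) (hN : k + l = 2 * d + i)
    (hi : i ≤ 1) : ∃ Q₀ Q₁ : ℂ[X], ¬ (Q₀ = 0 ∧ Q₁ = 0) ∧ Adapted P k l U U₁ Q₀ Q₁ ∧
      Q₀.natDegree ≤ d ∧ Q₁.natDegree ≤ d ∧ (i = 0 → Q₁.eval 1 = 0) := by
  let toPoly : (Fin (d + 1) → ℂ) →ₗ[ℂ] ℂ[X] :=
    (degreeLT ℂ (d + 1)).subtype ∘ₗ (degreeLTEquiv ℂ (d + 1)).symm.toLinearMap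
  have hdeg : ∀ x, (toPoly x).natDegree ≤ d := by
    intro x
    have := ((degreeLTEquiv ℂ (d + 1)).symm x).2
    rw [mem_degreeLT, degree_lt_iff_coeff_zero] at this
    exact natDegree_le_iff_coeff_eq_zero.2 fun n hn => this n hn
  have hinj : ∀ x, toPoly x = 0 → x = 0 := by
    intro x hx
    simpa [toPoly] using hx
  let tay : ℂ → ℕ → ℂ[X] →ₗ[ℂ] ℂ := fun c m =>
    (PowerSeries.coeff m).comp (taylorSeries c).toLinearMap
  let cond : ℂ → ℂ[X] → ℕ → (ℂ[X] × ℂ[X]) →ₗ[ℂ] ℂ := fun c V m =>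
    tay c m ∘ₗ (LinearMap.mulRight ℂ V ∘ₗ LinearMap.fst ℂ _ _ +
      LinearMap.mulRight ℂ (X * polyD V) ∘ₗ LinearMap.snd ℂ _ _)
  let Φ : ((Fin (d + 1) → ℂ) × (Fin (d + 1) → ℂ)) →ₗ[ℂ]
      (Fin k → ℂ) × (Fin l → ℂ) × (Fin (1 - i) → ℂ) :=
    (LinearMap.pi fun m : Fin k => cond P.a U m).prod
      ((LinearMap.pi fun m : Fin l => cond P.a₁ U₁ m).prod
        (LinearMap.pi fun _ => leval 1 ∘ₗ LinearMap.snd ℂ _ _)) ∘ₗ toPoly.prodMap toPoly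
  -- There are `2d + 2` unknown coefficients and `k + l + (1 - i) = 2d + 1` conditions.
  have hker : LinearMap.ker Φ ≠ ⊥ := by
    refine LinearMap.ker_ne_bot_of_finrank_lt ?_
    simp only [Module.finrank_prod, Module.finrank_fintype_fun_eq_card, Fintype.card_fin]
    omega
  obtain ⟨⟨x, y⟩, hxy, hne⟩ := Submodule.exists_mem_ne_zero_of_ne_bot hker
  rw [LinearMap.mem_ker] at hxy
  have h1 := congrArg Prod.fst hxy
  have h2 := congrArg (fun v => v.2.1) hxy
  have h3 := congrArg (fun v => v.2.2) hxy
  refine ⟨toPoly x, toPoly y, fun h => hne ?_, ⟨?_, ?_⟩, hdeg x, hdeg y, ?_⟩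
  · rw [hinj x h.1, hinj y h.2]
    rfl
  · rw [sub_pow_dvd_iff_taylorSeries]
    intro m hm
    exact congrFun h1 ⟨m, hm⟩
  · rw [sub_pow_dvd_iff_taylorSeries]
    intro m hm
    exact congrFun h2 ⟨m, hm⟩
  · rintro rfl
    exact congrFun h3 ⟨0, by omega⟩

end Adapted

/-! ### Reduction to Gauss' equation with shifted parameters -/

section Reduction

open Polynomial

variable {P : FuchsianParams} {k l d i : ℕ} {U U₁ : ℂ[X]}

theorem TopCoeff.natDegree_le_of_eq_zero {p : ℂ[X]} (h : TopCoeff (d + 1) p 0) :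
    p.natDegree ≤ d := by
  refine natDegree_le_iff_coeff_eq_zero.2 fun n hn => ?_
  rcases Nat.eq_or_lt_of_le (Nat.succ_le_of_lt hn) with h1 | h1
  · rw [← h1]
    exact h.2
  · exact natDegree_le_iff_coeff_eq_zero.1 h.1 n h1

theorem TopCoeff.eq_zero {p : ℂ[X]} (h : TopCoeff 0 p 0) : p = 0 := by
  rw [eq_C_of_natDegree_le_zero h.1, h.2, C_0]

/-- Adapted pairs of small degree vanish. -/
theorem ApparentData.adapted_eq_zero (h : ApparentData P k l U U₁)
    (hint : ∀ m : ℤ, P.α ≠ m ∧ P.β ≠ m ∧ P.γ - P.α ≠ m ∧ P.γ - P.β ≠ m)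
    (hN : 2 * d + 2 ≤ k + l) {w₀ w₁ : ℂ[X]} (hw : Adapted P k l U U₁ w₀ w₁)
    (h₀ : w₀.natDegree ≤ d) (h₁ : w₁.natDegree ≤ d) : w₀ = 0 ∧ w₁ = 0 := by
  obtain ⟨w₀', hw', had⟩ := h.exists_connection hw
  have ht := h.topCoeff_derivative hw' ⟨h₀, rfl⟩ ⟨h₁, rfl⟩
  have hdvd := h.dvd_wronskian hw had
  have hmon : ((X - C P.a) ^ k * (X - C P.a₁) ^ l).Monic :=
    ((monic_X_sub_C _).pow k).mul ((monic_X_sub_C _).pow l)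
  have hnat : ((X - C P.a) ^ k * (X - C P.a₁) ^ l).natDegree = k + l := by
    rw [((monic_X_sub_C _).pow k).natDegree_mul ((monic_X_sub_C _).pow l)]
    simp
  -- The Wronskian has degree at most `2d + 1`, yet is divisible by a polynomial of degree `k + l ≥
  -- 2d + 2`.
  have hz : w₀ * connOne P polyD X w₀ w₁ - w₁ * w₀' = 0 := by
    by_contra hne
    have h1 := natDegree_le_of_dvd hdvd hne
    have h2 : (w₀ * connOne P polyD X w₀ w₁ - w₁ * w₀').natDegree ≤ d + (d + 1) := by
      refine (natDegree_sub_le _ _).trans (max_le ?_ ?_)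
      · exact natDegree_mul_le_of_le h₀ ht.2.1
      · exact natDegree_mul_le_of_le h₁ ht.1.1
    omega
  refine eq_zero_of_invariant_line h.rel h.dist hint h.eps h.eps₁ ?_
  rw [← hw']
  linear_combination (X - C P.a) * (X - C P.a₁) * hz

/-- The hypergeometric operator applied to a pair, in terms of its derivatives. -/
noncomputable def gaussComb (P : FuchsianParams) (n : ℕ) (w w' w'' : ℂ[X]) : ℂ[X] :=
  w'' + (C (P.α + P.β + 2 * n - 1) * X + C (1 - P.γ)) * w' +
    C ((P.α + n) * (P.β + n)) * (X * (X - C 1)) * w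

theorem topCoeff_gaussComb {n : ℕ} {w w' w'' : ℂ[X]} {x x' x'' : ℂ} (h : TopCoeff d w x)
    (h' : TopCoeff (d + 1) w' x') (h'' : TopCoeff (d + 2) w'' x'') :
    TopCoeff (d + 2) (gaussComb P n w w' w'')
      (x'' + (P.α + P.β + 2 * n - 1) * x' + (P.α + n) * (P.β + n) * x) := by
  have h1 : TopCoeff 1 (C (P.α + P.β + 2 * n - 1) * X + C (1 - P.γ))
      (P.α + P.β + 2 * n - 1) := by
    refine ⟨natDegree_linear_le, by simp [coeff_C, coeff_one]⟩
  have a1 := h1.mul h'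
  have a2 := ((TopCoeff.C ((P.α + n) * (P.β + n))).mul (TopCoeff.X.mul (TopCoeff.X_sub_C 1))).mul h
  rw [show 1 + (d + 1) = d + 2 by omega] at a1
  rw [show 0 + (1 + 1) + d = d + 2 by omega] at a2
  have := (h''.add a1).add a2
  rwa [mul_one, mul_one] at this

theorem exists_eq_X_mul_of_eval {p : ℂ[X]} (h0 : p.eval 0 = 0) (h1 : p.eval 1 = 0) :
    ∃ q, p = X * (X - C 1) * q := by
  refine IsCoprime.mul_dvd ?_ (X_dvd_iff.2 (by rw [coeff_zero_eq_eval_zero, h0]))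
    (dvd_iff_isRoot.2 h1)
  simpa using isCoprime_X_sub_C_of_isUnit_sub (a := (0 : ℂ)) (b := 1) (by simp)

/-- The combination is adapted, vanishes at 0 and 1, and has no top coefficient for `n = d + i`.
Divided by `z (z - 1)` it is an adapted pair of degree below `d`, hence zero. At 1 the target
equation has the exponents 0 and `1 - δ - i`. For `i = 0` the exponent `-δ` of `u'` has to be
suppressed, which is the purpose of `Q₁(1) = 0`. -/
theorem ApparentData.gaussComb_eq_zero (h : ApparentData P k l U U₁)
    (hint : ∀ m : ℤ, P.α ≠ m ∧ P.β ≠ m ∧ P.γ - P.α ≠ m ∧ P.γ - P.β ≠ m)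
    (hN : k + l = 2 * d + i) (hi : i ≤ 1) {Q₀ Q₁ Q₀' Q₀'' : ℂ[X]}
    (hQ : Adapted P k l U U₁ Q₀ Q₁) (h₀ : Q₀.natDegree ≤ d) (h₁ : Q₁.natDegree ≤ d)
    (h10 : i = 0 → Q₁.eval 1 = 0)
    (hQ' : (X - C P.a) * (X - C P.a₁) * Q₀' = connZero P polyD X Q₀ Q₁)
    (had' : Adapted P k l U U₁ Q₀' (connOne P polyD X Q₀ Q₁))
    (hQ'' : (X - C P.a) * (X - C P.a₁) * Q₀'' =
      connZero P polyD X Q₀' (connOne P polyD X Q₀ Q₁))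
    (had'' : Adapted P k l U U₁ Q₀'' (connOne P polyD X Q₀' (connOne P polyD X Q₀ Q₁))) :
    gaussComb P (d + i) Q₀ Q₀' Q₀'' = 0 ∧
    gaussComb P (d + i) Q₁ (connOne P polyD X Q₀ Q₁)
      (connOne P polyD X Q₀' (connOne P polyD X Q₀ Q₁)) = 0 := by
  have hP := h.rel
  simp only [FuchsianParams.FuchsRelation, h.eps, h.eps₁] at hP
  obtain ⟨ha0, ha1, hb0, hb1, -⟩ := h.dist
  set Q₁' := connOne P polyD X Q₀ Q₁ with hQ₁'
  set Q₁'' := connOne P polyD X Q₀' Q₁' with hQ₁''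
  have hNc : (k : ℂ) + l = 2 * d + i := by exact_mod_cast hN
  have hab : P.a * P.a₁ ≠ 0 := mul_ne_zero ha0 hb0
  have hab1 : (1 - P.a) * (1 - P.a₁) ≠ 0 :=
    mul_ne_zero (sub_ne_zero.2 ha1.symm) (sub_ne_zero.2 hb1.symm)
  have e0 : ∀ x, _ := fun x => congrArg (Polynomial.eval x) hQ'
  have e0' : ∀ x, _ := fun x => congrArg (Polynomial.eval x) hQ''
  have e1 : ∀ x, _ := fun x => congrArg (Polynomial.eval x) hQ₁'
  have e1' : ∀ x, _ := fun x => congrArg (Polynomial.eval x) hQ₁''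
  simp only [eval_mul, eval_sub, eval_X, eval_C, eval_connZero, eval_connOne] at e0 e0' e1 e1'
  have z0 : Q₀'.eval 0 = 0 := mul_left_cancel₀ hab (by linear_combination e0 0)
  have z0' : Q₀''.eval 0 = 0 := mul_left_cancel₀ hab (by linear_combination e0' 0)
  have z1' : Q₁''.eval 0 = -(1 - P.γ) * Q₁'.eval 0 := by
    linear_combination e1' 0 - z0
  have o1 : Q₁'.eval 1 = -P.δ * Q₁.eval 1 := by linear_combination e1 1
  have o1' : Q₁''.eval 1 = -P.δ * Q₁'.eval 1 := by linear_combination e1' 1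
  have hi' : (1 - i : ℂ) * Q₁.eval 1 = 0 := by
    rcases Nat.le_one_iff_eq_zero_or_eq_one.1 hi with hi | hi
    · rw [h10 hi, mul_zero]
    · rw [hi]
      simp
  have t := h.topCoeff_derivative hQ' ⟨h₀, rfl⟩ ⟨h₁, rfl⟩
  have t' := h.topCoeff_derivative hQ'' t.1 t.2
  have T₀ := topCoeff_gaussComb (P := P) (n := d + i) ⟨h₀, rfl⟩ t.1 t'.1
  have T₁ := topCoeff_gaussComb (P := P) (n := d + i) ⟨h₁, rfl⟩ t.2 t'.2
  obtain ⟨ω₀, hω₀⟩ : ∃ q, gaussComb P (d + i) Q₀ Q₀' Q₀'' = X * (X - C 1) * q := by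
    refine exists_eq_X_mul_of_eval ?_ ?_
    · simp [gaussComb, z0, z0']
    · refine mul_left_cancel₀ hab1 ?_
      simp only [gaussComb, eval_add, eval_mul, eval_C, eval_X, eval_sub]
      push_cast
      linear_combination e0' 1 + (P.α + P.β + 2 * (d + i) - P.γ) * e0 1 -
        (P.α * P.β - P.θ₁ - P.θ₀) * (o1 + Q₁.eval 1 * (hP - hNc) - hi')
  obtain ⟨ω₁, hω₁⟩ : ∃ q, gaussComb P (d + i) Q₁ Q₁' Q₁'' = X * (X - C 1) * q := by
    refine exists_eq_X_mul_of_eval ?_ ?_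
    · simp only [gaussComb, eval_add, eval_mul, eval_C, eval_X, eval_sub]
      linear_combination z1'
    · simp only [gaussComb, eval_add, eval_mul, eval_C, eval_X, eval_sub]
      push_cast
      linear_combination o1' + (-P.δ + P.α + P.β + 2 * (d + i) - P.γ) * o1 -
        P.δ * (Q₁.eval 1 * (hP - hNc) - hi')
  have hX2 : (X * (X - C 1) : ℂ[X]).Monic := monic_X.mul (monic_X_sub_C 1)
  have hX2' : (X * (X - C 1) : ℂ[X]).natDegree = 2 := by
    rw [monic_X.natDegree_mul (monic_X_sub_C 1), natDegree_X, natDegree_X_sub_C]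
  have s₀ : TopCoeff d ω₀ 0 := by
    refine TopCoeff.of_mul (n := 2) hX2 hX2' ?_
    rw [← hω₀, add_comm]
    convert T₀ using 1
    push_cast
    rw [hNc]
    ring
  have s₁ : TopCoeff d ω₁ 0 := by
    refine TopCoeff.of_mul (n := 2) hX2 hX2' ?_
    rw [← hω₁, add_comm]
    convert T₁ using 1
    push_cast
    rw [hNc]
    ring
  have hcop : ∀ c : ℂ, c ≠ 0 → c ≠ 1 → IsCoprime (X - C c) (X * (X - C 1)) := by
    intro c hc0 hc1
    refine IsCoprime.mul_right ?_ ?_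
    · simpa using isCoprime_X_sub_C_of_isUnit_sub (a := c) (b := 0) (by simpa using hc0)
    · exact isCoprime_X_sub_C_of_isUnit_sub (sub_ne_zero.2 hc1).isUnit
  have hω : Adapted P k l U U₁ ω₀ ω₁ := by
    refine Adapted.of_mul (p := X * (X - C 1)) (hcop _ ha0 ha1) (hcop _ hb0 hb1) ?_
    rw [← hω₀, ← hω₁]
    exact (had''.add (had'.mul _)).add (hQ.mul _)
  -- For `d = 0` the missing top coefficient is the whole polynomial; otherwise the degree is at
  -- most `d - 1`.
  have hz : ω₀ = 0 ∧ ω₁ = 0 := by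
    cases d with
    | zero => exact ⟨s₀.eq_zero, s₁.eq_zero⟩
    | succ d =>
      exact h.adapted_eq_zero hint (by omega) hω s₀.natDegree_le_of_eq_zero
        s₁.natDegree_le_of_eq_zero
  rw [hω₀, hω₁, hz.1, hz.2, mul_zero]
  exact ⟨rfl, rfl⟩

/-- By irreducibility the Wronskian is nonzero. It has degree at most `2d + 1` and is divisible by
`(z - a)^k (z - a₁)^l s`, of degree exactly `2d + 1`, with `s = z - 1` for even `k + l` and `s = 1`
for odd. So it is a constant multiple, and Cramer's rule needs no further denominators. -/
theorem ApparentData.exists_reduction (h : ApparentData P k l U U₁)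
    (hint : ∀ m : ℤ, P.α ≠ m ∧ P.β ≠ m ∧ P.γ - P.α ≠ m ∧ P.γ - P.β ≠ m) :
    ∃ (n : ℕ) (Q₀ Q₁ Q₀' Q₀'' Q₁' Q₁'' Q₂ Q₂' s : ℂ[X]) (c : ℂ),
      (X - C P.a) * (X - C P.a₁) * Q₀' = connZero P polyD X Q₀ Q₁ ∧
      Q₁' = connOne P polyD X Q₀ Q₁ ∧
      (X - C P.a) * (X - C P.a₁) * Q₀'' = connZero P polyD X Q₀' Q₁' ∧
      Q₁'' = connOne P polyD X Q₀' Q₁' ∧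
      gaussComb P n Q₀ Q₀' Q₀'' = 0 ∧ gaussComb P n Q₁ Q₁' Q₁'' = 0 ∧
      Q₁ = s * Q₂ ∧ Q₁' = s * Q₂' ∧ c ≠ 0 ∧
      Q₀ * Q₂' - Q₂ * Q₀' = C c * ((X - C P.a) ^ k * (X - C P.a₁) ^ l) ∧
      Q₂'.natDegree ≤ n ∧ ((X - C 1) * Q₂).natDegree ≤ n := by
  obtain ⟨d, i, hN, hi⟩ : ∃ d i, k + l = 2 * d + i ∧ i ≤ 1 :=
    ⟨(k + l) / 2, (k + l) % 2, by omega, by omega⟩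
  obtain ⟨Q₀, Q₁, hne, hQ, h₀, h₁, h10⟩ := exists_adapted P k l d i U U₁ hN hi
  obtain ⟨Q₀', hQ', had'⟩ := h.exists_connection hQ
  obtain ⟨Q₀'', hQ'', had''⟩ := h.exists_connection had'
  have hη := h.gaussComb_eq_zero hint hN hi hQ h₀ h₁ h10 hQ' had' hQ'' had''
  have ht := h.topCoeff_derivative hQ' ⟨h₀, rfl⟩ ⟨h₁, rfl⟩
  have hw : Q₀ * connOne P polyD X Q₀ Q₁ - Q₁ * Q₀' ≠ 0 := by
    intro h0
    refine hne (eq_zero_of_invariant_line h.rel h.dist hint h.eps h.eps₁ ?_)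
    rw [← hQ']
    linear_combination (X - C P.a) * (X - C P.a₁) * h0
  have hmon : ((X - C P.a) ^ k * (X - C P.a₁) ^ l).Monic :=
    ((monic_X_sub_C _).pow k).mul ((monic_X_sub_C _).pow l)
  have hnat : ((X - C P.a) ^ k * (X - C P.a₁) ^ l).natDegree = k + l := by
    rw [((monic_X_sub_C _).pow k).natDegree_mul ((monic_X_sub_C _).pow l)]
    simp
  have hdeg : (Q₀ * connOne P polyD X Q₀ Q₁ - Q₁ * Q₀').natDegree ≤ d + (d + 1) := by
    refine (natDegree_sub_le _ _).trans (max_le ?_ ?_)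
    · exact natDegree_mul_le_of_le h₀ ht.2.1
    · exact natDegree_mul_le_of_le h₁ ht.1.1
  have hdvd := h.dvd_wronskian hQ had'
  obtain ⟨s, Q₂, Q₂', hs, hsd, hsc, e₁, e₁'⟩ : ∃ s Q₂ Q₂' : ℂ[X], s.Monic ∧ s.natDegree = 1 - i ∧
      IsCoprime ((X - C P.a) ^ k * (X - C P.a₁) ^ l) s ∧ Q₁ = s * Q₂ ∧
      connOne P polyD X Q₀ Q₁ = s * Q₂' := by
    rcases Nat.le_one_iff_eq_zero_or_eq_one.1 hi with hi0 | hi0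
    · have r1 := h10 hi0
      have r2 : (connOne P polyD X Q₀ Q₁).eval 1 = 0 := by
        rw [eval_connOne, r1]
        ring
      obtain ⟨q, hq⟩ := dvd_iff_isRoot.2 r1
      obtain ⟨q', hq'⟩ := dvd_iff_isRoot.2 r2
      refine ⟨X - C 1, q, q', monic_X_sub_C 1, ?_, ?_, hq, hq'⟩
      · rw [natDegree_X_sub_C, hi0]
      · exact IsCoprime.mul_left
          (isCoprime_X_sub_C_of_isUnit_sub (sub_ne_zero.2 h.dist.2.1).isUnit).pow_left
          (isCoprime_X_sub_C_of_isUnit_sub (sub_ne_zero.2 h.dist.2.2.2.1).isUnit).pow_left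
    · exact ⟨1, Q₁, connOne P polyD X Q₀ Q₁, monic_one, by rw [natDegree_one, hi0],
        isCoprime_one_right, (one_mul _).symm, (one_mul _).symm⟩
  have efac : Q₀ * connOne P polyD X Q₀ Q₁ - Q₁ * Q₀' = s * (Q₀ * Q₂' - Q₂ * Q₀') := by
    rw [e₁']
    conv_lhs => rw [e₁]
    ring
  rw [efac] at hw hdeg hdvd
  have hw' := right_ne_zero_of_mul hw
  obtain ⟨q, hq⟩ := hsc.dvd_of_dvd_mul_left hdvd
  have hq0 : q ≠ 0 := by
    rintro rfl
    exact hw' (by rw [hq, mul_zero])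
  have hqd : q.natDegree = 0 := by
    rw [hq, hs.natDegree_mul' (mul_ne_zero hmon.ne_zero hq0), hmon.natDegree_mul' hq0, hnat,
      hsd] at hdeg
    omega
  have hdeg₂ : ∀ p : ℂ[X], p.natDegree + (1 - i) ≤ max (s * p).natDegree (1 - i) := by
    intro p
    by_cases hp : p = 0
    · simp [hp]
    · rw [hs.natDegree_mul' hp, hsd]
      omega
  have hd₂ := hdeg₂ Q₂
  have hd₂' := hdeg₂ Q₂'
  rw [← e₁] at hd₂
  rw [← e₁'] at hd₂'
  have ht2 := ht.2.1
  refine ⟨d + i, Q₀, Q₁, Q₀', Q₀'', _, _, Q₂, Q₂', s, q.coeff 0, hQ', rfl, hQ'', rfl, hη.1, hη.2,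
    e₁, e₁', ?_, ?_, ?_, ?_⟩
  · intro h0
    apply hq0
    rw [eq_C_of_natDegree_eq_zero hqd, h0, C_0]
  · rw [hq, mul_comm, ← eq_C_of_natDegree_eq_zero hqd]
  · omega
  · have := (natDegree_mul_le (p := X - C (1 : ℂ)) (q := Q₂))
    rw [natDegree_X_sub_C] at this
    by_cases hq2 : Q₂ = 0
    · simp [hq2]
    have h3 : Q₂.natDegree + (1 - i) ≤ d := by
      rw [e₁, hs.natDegree_mul' hq2, hsd] at h₁
      omega
    omega

end Reduction

/-! ### Series with Gauss coefficients times a polynomial -/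

section GaussClass

open PowerSeries

variable {P : FuchsianParams}

theorem ascPochhammer_succ_eval_left (n : ℕ) (x : ℂ) :
    (ascPochhammer ℂ (n + 1)).eval x = x * (ascPochhammer ℂ n).eval (x + 1) := by
  rw [ascPochhammer_succ_left]
  simp

/-- The series whose coefficients are those of Gauss' series times `(α + m)_j (β + m)_j` and a
polynomial in `m`. -/
def GaussClass (P : FuchsianParams) (j : ℕ) (g : ℂ⟦X⟧) : Prop :=
  ∃ R : Polynomial ℂ, ∀ m : ℕ, coeff m g = gaussSeriesCoeff P m *
    ((ascPochhammer ℂ j).eval (P.α + m) * (ascPochhammer ℂ j).eval (P.β + m) * R.eval (m : ℂ))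

theorem GaussClass.add {j : ℕ} {g h : ℂ⟦X⟧} (hg : GaussClass P j g) (hh : GaussClass P j h) :
    GaussClass P j (g + h) := by
  obtain ⟨R, hR⟩ := hg
  obtain ⟨T, hT⟩ := hh
  refine ⟨R + T, fun m => ?_⟩
  rw [map_add, hR, hT, Polynomial.eval_add]
  ring

theorem GaussClass.C_mul {j : ℕ} {g : ℂ⟦X⟧} (c : ℂ) (hg : GaussClass P j g) :
    GaussClass P j (C c * g) := by
  obtain ⟨R, hR⟩ := hg
  refine ⟨.C c * R, fun m => ?_⟩
  rw [coeff_C_mul, hR, Polynomial.eval_mul, Polynomial.eval_C]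
  ring

theorem GaussClass.X_mul_derivative {j : ℕ} {g : ℂ⟦X⟧} (hg : GaussClass P j g) :
    GaussClass P j (X * d⁄dX ℂ g) := by
  obtain ⟨R, hR⟩ := hg
  refine ⟨.X * R, fun m => ?_⟩
  have := coeff_eulerQuad 0 1 0 g m
  rw [eulerQuad, map_zero, map_one, zero_mul, zero_mul, zero_add, add_zero, one_mul] at this
  rw [this, hR, Polynomial.eval_mul, Polynomial.eval_X]
  ring

theorem GaussClass.of_succ {j : ℕ} {g : ℂ⟦X⟧} (hg : GaussClass P (j + 1) g) :
    GaussClass P j g := by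
  obtain ⟨R, hR⟩ := hg
  refine ⟨(.X + .C (P.α + j)) * (.X + .C (P.β + j)) * R, fun m => ?_⟩
  rw [hR, ascPochhammer_succ_eval, ascPochhammer_succ_eval]
  simp only [Polynomial.eval_mul, Polynomial.eval_add, Polynomial.eval_X, Polynomial.eval_C]
  ring

/-- The index shift trades `(α + m)(β + m) h_m` for `(m + 1)(m + γ) h_{m+1}`, which uses up one of
the `j + 1` available factors. -/
theorem GaussClass.X_mul (hγ : ∀ m : ℕ, P.γ ≠ -m) {j : ℕ} {g : ℂ⟦X⟧}
    (hg : GaussClass P (j + 1) g) : GaussClass P j (X * g) := by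
  obtain ⟨R, hR⟩ := hg
  refine ⟨.X * (.X + .C (P.γ - 1)) * R.comp (.X - .C 1), fun m => ?_⟩
  cases m with
  | zero => simp
  | succ m =>
    rw [coeff_succ_X_mul, hR, ascPochhammer_succ_eval_left, ascPochhammer_succ_eval_left]
    simp only [Polynomial.eval_mul, Polynomial.eval_add, Polynomial.eval_X, Polynomial.eval_C,
      Polynomial.eval_comp, Polynomial.eval_sub]
    push_cast
    rw [show (m + 1 - 1 : ℂ) = m by ring, ← add_assoc, ← add_assoc]
    linear_combination -((ascPochhammer ℂ j).eval (P.α + m + 1) *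
      (ascPochhammer ℂ j).eval (P.β + m + 1) * R.eval (m : ℂ)) * gaussSeriesCoeff_succ hγ m

theorem GaussClass.mono {i j : ℕ} (h : i ≤ j) {g : ℂ⟦X⟧} (hg : GaussClass P j g) :
    GaussClass P i g := by
  induction h using Nat.decreasingInduction with
  | self => exact hg
  | of_succ k hk ih => exact ih.of_succ

theorem GaussClass.X_pow_mul (hγ : ∀ m : ℕ, P.γ ≠ -m) {j : ℕ} (i : ℕ) {g : ℂ⟦X⟧}
    (hg : GaussClass P (j + i) g) : GaussClass P j (X ^ i * g) := by
  induction i generalizing j with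
  | zero => simpa using hg
  | succ i ih =>
    rw [pow_succ', mul_assoc]
    exact (ih (j := j + 1) (by rwa [add_assoc, add_comm 1 i])).X_mul hγ

theorem GaussClass.taylorSeries_mul (hγ : ∀ m : ℕ, P.γ ≠ -m) {n : ℕ} {g : ℂ⟦X⟧}
    (hg : GaussClass P n g) {p : Polynomial ℂ} (hp : p.natDegree ≤ n) :
    GaussClass P 0 (taylorSeries 0 p * g) := by
  have h : ∀ i ∈ Finset.range (n + 1), GaussClass P 0 (C (p.coeff i) * (X ^ i * g)) := by
    intro i hi
    refine GaussClass.C_mul _ (GaussClass.X_pow_mul hγ i (hg.mono ?_))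
    have := Finset.mem_range.1 hi
    omega
  have h0 : GaussClass P 0 (0 : ℂ⟦X⟧) := ⟨0, by simp⟩
  have e : taylorSeries 0 p * g = ∑ i ∈ Finset.range (n + 1), C (p.coeff i) * (X ^ i * g) := by
    conv_lhs => rw [p.as_sum_range' (n + 1) (by omega)]
    rw [map_sum, Finset.sum_mul]
    refine Finset.sum_congr rfl fun i _ => ?_
    rw [taylorSeries, Polynomial.aeval_monomial, map_zero, zero_add, mul_assoc]
    rfl
  rw [e]
  exact Finset.sum_induction _ _ (fun _ _ => GaussClass.add) h0 h

/-- These are multiples of the coefficients of `₂F₁(α + n, β + n; γ; z)`, and `(α)_n (α + n)_m =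
(α)_m (α + m)_n`. So the polynomial `R` may be taken constant. -/
theorem gaussClass_of_recurrence (hα : ∀ m : ℕ, P.α ≠ -m) (hβ : ∀ m : ℕ, P.β ≠ -m)
    (hγ : ∀ m : ℕ, P.γ ≠ -m) (n : ℕ) {f : ℂ⟦X⟧}
    (h : ∀ m : ℕ, (m + P.γ) * (m + 1) * coeff (m + 1) f =
      (m + P.α + n) * (m + P.β + n) * coeff m f) : GaussClass P n f := by
  have h1 := ascPochhammer_eval_ne_zero hα n
  have h2 := ascPochhammer_eval_ne_zero hβ n
  refine ⟨.C (coeff 0 f / ((ascPochhammer ℂ n).eval P.α * (ascPochhammer ℂ n).eval P.β)),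
    fun m => ?_⟩
  rw [Polynomial.eval_C]
  set c := coeff 0 f / ((ascPochhammer ℂ n).eval P.α * (ascPochhammer ℂ n).eval P.β) with hc
  induction m with
  | zero =>
    rw [hc]
    simp only [gaussSeriesCoeff, ascPochhammer_zero, Polynomial.eval_one, Nat.factorial_zero,
      Nat.cast_zero, add_zero, Nat.cast_one, mul_one, div_one]
    field_simp
  | succ m ih =>
    have hne : (m + P.γ : ℂ) * (m + 1) ≠ 0 := by
      refine mul_ne_zero (fun h => hγ m (by linear_combination h)) ?_
      exact_mod_cast m.succ_ne_zero
    refine mul_left_cancel₀ hne ?_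
    rw [h, ih]
    have e1 := ascPochhammer_succ_eval_left n (P.α + m)
    have e2 := ascPochhammer_succ_eval_left n (P.β + m)
    rw [ascPochhammer_succ_eval] at e1 e2
    have e3 := gaussSeriesCoeff_succ hγ m
    push_cast
    rw [← add_assoc, ← add_assoc]
    generalize (ascPochhammer ℂ n).eval (P.α + m) = x at *
    generalize (ascPochhammer ℂ n).eval (P.β + m) = y at *
    generalize (ascPochhammer ℂ n).eval (P.α + m + 1) = x' at *
    generalize (ascPochhammer ℂ n).eval (P.β + m + 1) = y' at *
    linear_combination c * gaussSeriesCoeff P m * (y * (P.β + m + n) * e1 +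
      (P.α + m) * x' * e2) - c * x' * y' * e3

end GaussClass

/-! ### From apparent singularities to hypergeometric coefficients -/

section Existence

open PowerSeries

variable {P : FuchsianParams} {k l : ℕ}

theorem series_connection (hε : P.ε = -k) (hε₁ : P.ε₁ = -l) {u f : ℂ⟦X⟧}
    (hu : fuchsOp P (d⁄dX ℂ) X u = 0) {w₀ w₁ w₀' : Polynomial ℂ}
    (h : (.X - .C P.a) * (.X - .C P.a₁) * w₀' = connZero P polyD .X w₀ w₁)
    (hf : taylorSeries 0 ((.X - .C P.a) ^ k * (.X - .C P.a₁) ^ l) * f =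
      taylorSeries 0 w₀ * u + taylorSeries 0 w₁ * (X * d⁄dX ℂ u)) :
    taylorSeries 0 ((.X - .C P.a) ^ k * (.X - .C P.a₁) ^ l) * (X * (X - 1) * d⁄dX ℂ f) =
      taylorSeries 0 w₀' * u +
        taylorSeries 0 (connOne P polyD .X w₀ w₁) * (X * d⁄dX ℂ u) := by
  have hX : taylorSeries 0 .X = (X : ℂ⟦X⟧) := by simp [taylorSeries]
  have hC : ∀ c, taylorSeries 0 (.C c) = (C c : ℂ⟦X⟧) := fun c => by
    simp [taylorSeries]
  have hz : d⁄dX ℂ (X : ℂ⟦X⟧) = 1 := by simp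
  have h' := congrArg (taylorSeries 0) h
  rw [map_connZero P polyD .X (taylorSeries 0) (d⁄dX ℂ) (taylorSeries_derivative 0), map_mul,
    map_mul, map_sub, map_sub, hX, hC, hC] at h'
  have key := connection_identity P (d⁄dX ℂ) X hz u (taylorSeries 0 w₀) (taylorSeries 0 w₁)
    (taylorSeries 0 w₀') h'
  rw [map_connOne P polyD .X (taylorSeries 0) (d⁄dX ℂ) (taylorSeries_derivative 0), hX]
  rw [hu, ← hf, mul_zero] at key
  simp only [map_mul, map_pow, map_sub, hX, hC] at key ⊢
  simp only [PowerSeries.algebraMap_apply, Algebra.algebraMap_self, RingHom.id_apply] at key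
  rw [hε, hε₁, map_neg, map_neg] at key
  have ne : ∀ c : ℂ, (X - C c : ℂ⟦X⟧) ≠ 0 := fun c h0 => by
    have := congrArg (coeff 1) h0
    simp [coeff_X] at this
  have hpow : ∀ (c : ℂ) (k : ℕ), (X - C c : ℂ⟦X⟧) * d⁄dX ℂ ((X - C c) ^ k) =
      C (k : ℂ) * (X - C c) ^ k := by
    intro c k
    cases k with
    | zero => simp
    | succ k =>
      rw [Derivation.leibniz_pow]
      simp
      ring
  refine mul_left_cancel₀ (mul_ne_zero (ne P.a) (ne P.a₁)) ?_
  simp only [Derivation.leibniz, smul_eq_mul] at key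
  linear_combination key - X * (X - 1) * f * ((X - C P.a₁) * (X - C P.a₁) ^ l * hpow P.a k +
    (X - C P.a) * (X - C P.a) ^ k * hpow P.a₁ l)

/-- `f` lies in the class of index `n` because it solves Gauss' equation with `α + n`, `β + n`.
Recovering `u` multiplies `f` and `z f'` by polynomials of degree at most `n`, for which the `n`
spare factors suffice. -/
theorem ApparentData.exists_gaussClass {U U₁ : Polynomial ℂ} (h : ApparentData P k l U U₁)
    (hint : ∀ m : ℤ, P.α ≠ m ∧ P.β ≠ m ∧ P.γ - P.α ≠ m ∧ P.γ - P.β ≠ m)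
    (hγ : ∀ m : ℕ, P.γ ≠ -m) {u : ℂ⟦X⟧} (hu : fuchsOp P (d⁄dX ℂ) X u = 0) : GaussClass P 0 u := by
  obtain ⟨n, Q₀, Q₁, Q₀', Q₀'', Q₁', Q₁'', Q₂, Q₂', s, c, h0, h1, h0', h1', hη, hη₁, e, e', hc, hw,
    d, d'⟩ := h.exists_reduction hint
  set Δ := taylorSeries 0 ((.X - .C P.a) ^ k * (.X - .C P.a₁) ^ l) with hΔ
  have hX : taylorSeries 0 .X = (X : ℂ⟦X⟧) := by simp [taylorSeries]
  have hC : ∀ c, taylorSeries 0 (.C c) = (C c : ℂ⟦X⟧) := fun c => by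
    simp [taylorSeries]
  have hΔu : IsUnit Δ := by
    rw [PowerSeries.isUnit_iff_constantCoeff, ← coeff_zero_eq_constantCoeff_apply, hΔ,
      coeff_zero_taylorSeries, isUnit_iff_ne_zero]
    simp [h.dist.1, h.dist.2.2.1]
  obtain ⟨Δi, hΔi⟩ := hΔu.exists_right_inv
  set f : ℂ⟦X⟧ := Δi * (taylorSeries 0 Q₀ * u + taylorSeries 0 Q₁ * (X * d⁄dX ℂ u)) with hf
  have f0 : Δ * f = taylorSeries 0 Q₀ * u + taylorSeries 0 Q₁ * (X * d⁄dX ℂ u) := by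
    rw [hf, ← mul_assoc, hΔi, one_mul]
  have f1 := series_connection h.eps h.eps₁ hu h0 f0
  rw [← h1] at f1
  have f2 := series_connection h.eps h.eps₁ hu h0' f1
  rw [← h1'] at f2
  rw [← hΔ] at f1 f2
  have hη' := congrArg (taylorSeries 0) hη
  have hη₁' := congrArg (taylorSeries 0) hη₁
  simp only [gaussComb, map_add, map_mul, map_zero, hX, hC, map_sub] at hη' hη₁'
  have g1 : X * (X - 1) * d⁄dX ℂ (X * (X - 1) * d⁄dX ℂ f) +
      (C (P.α + P.β + 2 * n - 1) * X + C (1 - P.γ)) * (X * (X - 1) * d⁄dX ℂ f) +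
      C ((P.α + n) * (P.β + n)) * (X * (X - 1)) * f = 0 := by
    refine hΔu.mul_right_eq_zero.1 ?_
    simp only [map_add, map_mul, map_sub, map_one] at hη' hη₁' ⊢
    linear_combination f2 + ((C P.α + C P.β + C 2 * C (n : ℂ) - 1) * X + 1 - C P.γ) * f1 +
      (C P.α + C (n : ℂ)) * (C P.β + C (n : ℂ)) * (X * (X - 1)) * f0 + u * hη' +
      (X * d⁄dX ℂ u) * hη₁'
  -- Dividing by `z (z - 1)` restores Gauss' equation in its usual form.
  have g2 : X * (X - 1) * d⁄dX ℂ (d⁄dX ℂ f) +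
      (C (P.α + P.β + 2 * n + 1) * X - C P.γ) * d⁄dX ℂ f +
      C ((P.α + n) * (P.β + n)) * f = 0 := by
    have hne : (X * (X - 1) : ℂ⟦X⟧) ≠ 0 := by
      refine mul_ne_zero X_ne_zero fun h0 => ?_
      have := congrArg (coeff 1) h0
      simp [coeff_X, coeff_one] at this
    refine mul_left_cancel₀ hne ?_
    rw [mul_zero, ← g1]
    simp only [Derivation.leibniz, smul_eq_mul, map_sub, map_add, map_one, derivative_X,
      Derivation.map_one_eq_zero, map_mul]
    ring
  have hrec : ∀ m : ℕ, (m + P.γ) * (m + 1) * coeff (m + 1) f =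
      (m + P.α + n) * (m + P.β + n) * coeff m f := by
    intro m
    have g3 : eulerQuad (-1) (-P.γ) 0 f +
        X * eulerQuad 1 (P.α + P.β + 2 * n + 1) ((P.α + n) * (P.β + n)) f = 0 := by
      rw [← mul_zero X, ← g2]
      simp only [eulerQuad, map_zero, map_one, map_neg]
      ring
    have := congrArg (coeff (m + 1)) g3
    rw [map_add, coeff_succ_X_mul, coeff_eulerQuad, coeff_eulerQuad, map_zero] at this
    push_cast at this
    linear_combination -this
  have hα : ∀ m : ℕ, P.α ≠ -m := fun m => by simpa using (hint (-m)).1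
  have hβ : ∀ m : ℕ, P.β ≠ -m := fun m => by simpa using (hint (-m)).2.1
  have hG := gaussClass_of_recurrence hα hβ hγ n hrec
  -- Cramer's rule with the determinant `c Δ`; the common factor `s` drops out.
  have hcu : u = C c⁻¹ * (taylorSeries 0 Q₂' * f +
      C (-1) * (taylorSeries 0 ((.X - .C 1) * Q₂) * (X * d⁄dX ℂ f))) := by
    have : C c * u = taylorSeries 0 Q₂' * f +
      C (-1) * (taylorSeries 0 ((.X - .C 1) * Q₂) * (X * d⁄dX ℂ f)) := by
      refine hΔu.mul_left_cancel ?_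
      have hw' := congrArg (taylorSeries 0) hw
      rw [map_mul, ← hΔ, map_sub, map_mul, map_mul, hC] at hw'
      rw [e, map_mul (taylorSeries 0) s Q₂] at f0
      rw [e', map_mul (taylorSeries 0) s Q₂'] at f1
      simp only [map_mul, map_sub, map_neg, map_one, hX]
      linear_combination -u * hw' - taylorSeries 0 Q₂' * f0 + taylorSeries 0 Q₂ * f1
    rw [← this, ← mul_assoc, ← map_mul, inv_mul_cancel₀ hc, map_one, one_mul]
  rw [hcu]
  exact ((hG.taylorSeries_mul hγ d).add
    ((hG.X_mul_derivative.taylorSeries_mul hγ d').C_mul _)).C_mul _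

/-- The reduction gives no control of the degree of `R`. The degree is read off afterwards from the
necessary condition `ε + ε₁ = -deg R`. -/
theorem exists_hypergeometric_coeff (hP : P.FuchsRelation) (hd : P.DistinctPoints)
    (hint : ∀ m : ℤ, P.α ≠ m ∧ P.β ≠ m ∧ P.γ - P.α ≠ m ∧ P.γ - P.β ≠ m)
    (hγ : ∀ m : ℕ, P.γ ≠ -m) (hε : P.ε = -k) (hε₁ : P.ε₁ = -l)
    (h : IsApparentPair k l P.vec P.accessory P.swap.accessory) :
    ∃ (u : ℂ⟦X⟧) (R : Polynomial ℂ), coeff 0 u = 1 ∧ fuchsOp P (d⁄dX ℂ) X u = 0 ∧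
      R.natDegree = k + l ∧ ∀ m : ℕ, coeff m u = gaussSeriesCoeff P m * R.eval (m : ℂ) := by
  obtain ⟨U, hU, hUd⟩ := exists_truncated_solution hP hd hε hε₁ h.1
  obtain ⟨U₁, hU₁, hUd₁⟩ := exists_truncated_solution hP.swap hd.swap (k := l) (l := k) hε₁ hε
    (by rw [FuchsianParams.swap_vec]; exact h.2)
  rw [fuchsOp_swap] at hUd₁
  obtain ⟨u, hu0, hu⟩ := exists_origin_solution hP hd hε hε₁ hγ
  have hdata : ApparentData P k l U U₁ := ⟨hP, hd, hε, hε₁, hU, hUd, hU₁, hUd₁⟩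
  obtain ⟨R, hR⟩ := hdata.exists_gaussClass hint hγ hu
  have hR' : ∀ m : ℕ, coeff m u = gaussSeriesCoeff P m * R.eval (m : ℂ) := by
    intro m
    rw [hR]
    simp
  have hα : ∀ m : ℕ, P.α ≠ -m := fun m => by simpa using (hint (-m)).1
  have hβ : ∀ m : ℕ, P.β ≠ -m := fun m => by simpa using (hint (-m)).2.1
  have hR0 : R ≠ 0 := by
    rintro rfl
    have := hR' 0
    rw [hu0] at this
    simp at this
  refine ⟨u, R, hu0, hu, ?_, hR'⟩
  have := P.natDegree_of_recurrencePoly hP hd hR0 (recurrencePoly_eq_zero hP hα hβ hγ hR' hu)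
  rw [hε, hε₁] at this
  have h2 : (R.natDegree : ℂ) = ((k + l : ℕ) : ℂ) := by
    push_cast
    linear_combination this
  exact_mod_cast h2

end Existence

/-! ### Positive coefficients at the base point -/

section Positivity

open PowerSeries

/-- All coefficients are nonnegative real numbers. -/
def NonnegSeries (u : ℂ⟦X⟧) : Prop := ∀ n, ∃ r : ℝ, 0 ≤ r ∧ coeff n u = r

theorem NonnegSeries.mul {u v : ℂ⟦X⟧} (hu : NonnegSeries u) (hv : NonnegSeries v) :
    NonnegSeries (u * v) := by
  choose r hr hr' using hu
  choose s hs hs' using hv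
  refine fun n => ⟨∑ p ∈ Finset.HasAntidiagonal.antidiagonal n, r p.1 * s p.2,
    Finset.sum_nonneg fun p _ => mul_nonneg (hr _) (hs _), ?_⟩
  rw [coeff_mul]
  push_cast
  exact Finset.sum_congr rfl fun p _ => by rw [hr', hs']

theorem NonnegSeries.pow {u : ℂ⟦X⟧} (hu : NonnegSeries u) (n : ℕ) : NonnegSeries (u ^ n) := by
  induction n with
  | zero =>
    intro m
    refine ⟨if m = 0 then 1 else 0, by split_ifs <;> norm_num, ?_⟩
    rw [pow_zero, coeff_one]
    split_ifs <;> simp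
  | succ n ih => exact pow_succ u n ▸ ih.mul hu

theorem nonnegSeries_one_add {c : ℝ} (hc : 0 ≤ c) : NonnegSeries (1 + C (c : ℂ) * X) := by
  intro n
  match n with
  | 0 => exact ⟨1, zero_le_one, by simp⟩
  | 1 => exact ⟨c, hc, by simp [coeff_one]⟩
  | n + 2 => exact ⟨0, le_rfl, by simp [coeff_one]⟩

/-- The geometric series. -/
noncomputable def geomSeries : ℂ⟦X⟧ := PowerSeries.mk 1

theorem nonnegSeries_geomSeries : NonnegSeries geomSeries :=
  fun n => ⟨1, zero_le_one, by simp [geomSeries]⟩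

/-- Multiplication by the geometric series forms partial sums, which are at least the constant term
1. -/
theorem NonnegSeries.coeff_geomSeries_mul_ne_zero {u : ℂ⟦X⟧} (hu : NonnegSeries u)
    (h0 : coeff 0 u = 1) (n : ℕ) : coeff n (geomSeries * u) ≠ 0 := by
  choose r hr hr' using hu
  have h1 : r 0 = 1 := by
    have := hr' 0
    rw [h0] at this
    exact_mod_cast this.symm
  have h2 : coeff n (geomSeries * u) = ((∑ p ∈ Finset.HasAntidiagonal.antidiagonal n, r p.2 : ℝ) : ℂ) := by
    rw [coeff_mul]
    push_cast
    exact Finset.sum_congr rfl fun p _ => by rw [hr']; simp [geomSeries]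
  rw [h2]
  have h3 : r 0 ≤ ∑ p ∈ Finset.HasAntidiagonal.antidiagonal n, r p.2 :=
    Finset.single_le_sum (f := fun p : ℕ × ℕ => r p.2) (fun p _ => hr _)
      (Finset.HasAntidiagonal.mem_antidiagonal.2 (by simp) : (n, 0) ∈ Finset.HasAntidiagonal.antidiagonal n)
  exact_mod_cast (by linarith : (0 : ℝ) < _).ne'

/-- The solution of the limiting equation at the base point. -/
noncomputable def baseSeries (i j : ℕ) (c : ℝ) : ℂ⟦X⟧ :=
  geomSeries * (geomSeries ^ (i + j) * ((1 + C ((1 : ℝ) : ℂ) * X) ^ i * (1 + C (c : ℂ) * X) ^ j))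

theorem coeff_zero_baseSeries (i j : ℕ) (c : ℝ) : coeff 0 (baseSeries i j c) = 1 := by
  simp [baseSeries, geomSeries]

theorem coeff_baseSeries_ne_zero (i j : ℕ) {c : ℝ} (hc : 0 ≤ c) (n : ℕ) :
    coeff n (baseSeries i j c) ≠ 0 := by
  refine NonnegSeries.coeff_geomSeries_mul_ne_zero ?_ (by simp [geomSeries]) n
  exact (nonnegSeries_geomSeries.pow _).mul
    (((nonnegSeries_one_add zero_le_one).pow _).mul ((nonnegSeries_one_add hc).pow _))

theorem mul_derivative_one_add_pow (c : ℂ) (i : ℕ) :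
    (1 + C c * X) * d⁄dX ℂ ((1 + C c * X) ^ i) = C (i * c) * (1 + C c * X) ^ i := by
  cases i with
  | zero => simp
  | succ i =>
    rw [Derivation.leibniz_pow]
    simp
    ring

theorem one_sub_mul_geomSeries : (1 - X) * geomSeries = 1 := by
  rw [mul_comm]
  exact mk_one_mul_one_sub_eq_one ℂ

theorem mul_derivative_geomSeries_pow (n : ℕ) :
    (1 - X) * d⁄dX ℂ (geomSeries ^ n) = C (n : ℂ) * geomSeries ^ n := by
  have h1 : (1 - X) * d⁄dX ℂ geomSeries = geomSeries := by
    have := congrArg (d⁄dX ℂ) one_sub_mul_geomSeries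
    simp only [Derivation.leibniz, smul_eq_mul, map_sub, Derivation.map_one_eq_zero,
      derivative_X] at this
    linear_combination this
  cases n with
  | zero => simp
  | succ n =>
    rw [Derivation.leibniz_pow, smul_eq_mul, nsmul_eq_mul, Nat.add_sub_cancel]
    push_cast
    rw [map_add, map_one, map_natCast]
    linear_combination (n + 1) * geomSeries ^ n * h1

theorem baseSeries_ode (i j : ℕ) (c : ℝ) :
    (1 - X) * (1 + C ((1 : ℝ) : ℂ) * X) * (1 + C (c : ℂ) * X) * d⁄dX ℂ (baseSeries i j c) =
      (C ((1 + i + j : ℕ) : ℂ) * (1 + C ((1 : ℝ) : ℂ) * X) * (1 + C (c : ℂ) * X) +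
        C (i * ((1 : ℝ) : ℂ)) * (1 - X) * (1 + C (c : ℂ) * X) +
        C (j * (c : ℂ)) * (1 - X) * (1 + C ((1 : ℝ) : ℂ) * X)) * baseSeries i j c := by
  have e : baseSeries i j c = geomSeries ^ (1 + i + j) *
      ((1 + C ((1 : ℝ) : ℂ) * X) ^ i * (1 + C (c : ℂ) * X) ^ j) := by
    rw [baseSeries, add_assoc, pow_add _ 1, pow_one, mul_assoc]
  have h1 := mul_derivative_geomSeries_pow (1 + i + j)
  have h2 := mul_derivative_one_add_pow ((1 : ℝ) : ℂ) i
  have h3 := mul_derivative_one_add_pow (c : ℂ) j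
  rw [e]
  simp only [Derivation.leibniz, smul_eq_mul]
  generalize d⁄dX ℂ (geomSeries ^ (1 + i + j)) = dE at *
  generalize geomSeries ^ (1 + i + j) = E at *
  generalize d⁄dX ℂ ((1 + C ((1 : ℝ) : ℂ) * X) ^ i) = dT at *
  generalize (1 + C ((1 : ℝ) : ℂ) * X) ^ i = T at *
  generalize d⁄dX ℂ ((1 + C (c : ℂ) * X) ^ j) = dM at *
  generalize (1 + C (c : ℂ) * X) ^ j = M at *
  linear_combination (1 + C ((1 : ℝ) : ℂ) * X) * (1 + C (c : ℂ) * X) * T * M * h1 +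
    (1 - X) * (1 + C (c : ℂ) * X) * E * M * h2 +
    (1 - X) * (1 + C ((1 : ℝ) : ℂ) * X) * E * T * h3

/-- At `h = 0` the equation has order one, with solution `(1 - z)^(-(1+i+j)) (1 + z)^i (1 +
z/(2k+3))^j`. Since `a = -1` and `a₁ = -(2k+3)` are negative, its coefficients are positive, and
`originRec` differs from them by nonzero factors. -/
theorem originRec_basePoint_ne_zero (k l i j n : ℕ) :
    originRec k l (basePoint k) (4 * (k + 1) * i) (-(4 * (k + 1) * (k + 2) * j)) n ≠ 0 := by
  set c : ℝ := (2 * k + 3)⁻¹ with hc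
  set u := baseSeries i j c with hu
  have hk : (2 * k + 3 : ℂ) ≠ 0 := by exact_mod_cast (by positivity : 2 * k + 3 ≠ 0)
  have hk' : (2 * k + 2 : ℂ) ≠ 0 := by exact_mod_cast (by positivity : 2 * k + 2 ≠ 0)
  have hcc : (c : ℂ) = (2 * k + 3 : ℂ)⁻¹ := by rw [hc]; push_cast; rfl
  have hCc : C (2 * k + 3 : ℂ) * C (c : ℂ) = (1 : ℂ⟦X⟧) := by
    rw [← map_mul, hcc, mul_inv_cancel₀ hk, map_one]
  have hode := baseSeries_ode i j c
  rw [← hu] at hode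
  set w : ℕ → ℂ := fun n => (2 * k + 2) * (2 * k + 3) * n with hw
  have hz : eulerQuad 0 (-((2 * k + 2) * (2 * k + 3))) 0 u +
      X * eulerQuad 0 (-(2 * k + 2)) ((2 * k + 2) * ((2 * k + 3) + 2 * (2 * k + 3) * i +
        (2 * k + 4) * j)) u +
      X ^ 2 * eulerQuad 0 ((2 * k + 2) * (2 * k + 3)) ((2 * k + 2) * ((2 * k + 4) + 2 * i +
        (2 * k + 4) * j)) u +
      X ^ 3 * eulerQuad 0 (2 * k + 2) (2 * k + 2) u = 0 := by
    simp only [eulerQuad, map_zero, map_mul, map_add, map_neg, map_one, map_natCast,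
      show (C (2 : ℂ) : ℂ⟦X⟧) = 2 from rfl, show (C (3 : ℂ) : ℂ⟦X⟧) = 3 from rfl,
      show (C (4 : ℂ) : ℂ⟦X⟧) = 4 from rfl, Complex.ofReal_one, Nat.cast_add, Nat.cast_one] at hode hCc ⊢
    generalize d⁄dX ℂ u = du at *
    generalize (C (c : ℂ) : ℂ⟦X⟧) = c' at *
    linear_combination (-(2 * k + 2) * X * (2 * k + 3)) * hode + (2 * k + 2) * X *
      ((1 - X ^ 2) * X * du - ((1 + i + j) * (1 + X) * X + i * (1 - X) * X +
        j * (1 - X) * (1 + X)) * u) * hCc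
  have hrec : coeff n u * ∏ j ∈ Finset.range n, w (j + 1) = coeff 0 u *
      originRec k l (basePoint k) (4 * (k + 1) * i) (-(4 * (k + 1) * (k + 2) * j)) n := by
    rw [originRec]
    refine mul_prod_eq_rec3 _ _ _ w
      (fun n => -(2 * k + 2) * n + (2 * k + 2) * ((2 * k + 3) + 2 * (2 * k + 3) * i +
        (2 * k + 4) * j))
      (fun n => (2 * k + 2) * (2 * k + 3) * n + (2 * k + 2) * ((2 * k + 4) + 2 * i +
        (2 * k + 4) * j))
      (fun n => (2 * k + 2) * n + (2 * k + 2)) (fun n => coeff n u) ?_ ?_ ?_ n ?_ n le_rfl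
    · funext n
      simp [basePoint, scaledDelta]
      ring
    · intro n
      simp [basePoint, scaledDelta, hw]
      ring
    · intro n
      simp [basePoint, hw]
      ring
    · intro m _
      rw [← coeff_fourTerm _ _ _ _ u
        (eulerQuad 0 (-((2 * k + 2) * (2 * k + 3))) 0 u)
        (eulerQuad 0 (-(2 * k + 2)) ((2 * k + 2) * ((2 * k + 3) + 2 * (2 * k + 3) * i +
          (2 * k + 4) * j)) u)
        (eulerQuad 0 ((2 * k + 2) * (2 * k + 3)) ((2 * k + 2) * ((2 * k + 4) + 2 * i +
          (2 * k + 4) * j)) u)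
        (eulerQuad 0 (2 * k + 2) (2 * k + 2) u), hz, map_zero]
      · intro n
        rw [coeff_eulerQuad, hw]
        ring
      · intro n
        rw [coeff_eulerQuad]
        ring
      · intro n
        rw [coeff_eulerQuad]
        ring
      · intro n
        rw [coeff_eulerQuad]
        ring
  rw [hu, coeff_zero_baseSeries, one_mul] at hrec
  rw [← hrec]
  refine mul_ne_zero (coeff_baseSeries_ne_zero i j (by positivity) n)
    (Finset.prod_ne_zero_iff.2 fun m _ => ?_)
  exact mul_ne_zero (mul_ne_zero hk' hk) (Nat.cast_ne_zero.2 (by omega))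

end Positivity

theorem eval₂_originRec {P R : Type} [CommRing P] [CommRing R] (φ : P →+* R) (k l : ℕ)
    (v : Fin 6 → P) (y y₁ : R) (n : ℕ) :
    MvPolynomial.eval₂ φ ![y, y₁] (originRec k l (MvPolynomial.C ∘ v) (MvPolynomial.X 0)
      (MvPolynomial.X 1) n) = originRec k l (φ ∘ v) y y₁ n := by
  rw [← MvPolynomial.coe_eval₂Hom, map_originRec]
  congr 1 <;> simp [Function.comp_def]

/-- Nonvanishing at all common points over the base point spreads to generic parameters, with an
exceptional polynomial that depends on `n`. -/
theorem exists_generic_originRec_ne_zero (k l n : ℕ) : ∃ G : MvPolynomial (Fin 6) ℂ,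
    MvPolynomial.eval (basePoint k) G ≠ 0 ∧ ∀ x : Fin 6 → ℂ, MvPolynomial.eval x G ≠ 0 →
      ∀ y y₁ : ℂ, IsApparentPair k l x y y₁ → originRec k l x y y₁ n ≠ 0 := by
  have hX : ∀ x : Fin 6 → ℂ, (MvPolynomial.eval x : MvPolynomial (Fin 6) ℂ → ℂ) ∘
      MvPolynomial.X = x := by
    intro x
    funext i
    simp
  obtain ⟨G, hG1, hG⟩ := exists_generic_ne_zero k l (MvPolynomial.X : Fin 6 → MvPolynomial (Fin 6) ℂ)
    (originRec k l (MvPolynomial.C ∘ MvPolynomial.X) (MvPolynomial.X 0) (MvPolynomial.X 1) n)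
    (MvPolynomial.aeval (basePoint k)) (fun y y₁ hy => by
      rw [eval₂_originRec]
      have e : (MvPolynomial.aeval (basePoint k) : MvPolynomial (Fin 6) ℂ → ℂ) ∘
          MvPolynomial.X = basePoint k := by
        funext i
        simp
      rw [e] at hy
      obtain ⟨i, -, j, -, rfl, rfl⟩ := (isApparentPair_basePoint_iff k l _ _).1 hy
      have := originRec_basePoint_ne_zero k l i j n
      rwa [← e] at this)
  refine ⟨G, ?_, fun x hx y y₁ hy => ?_⟩
  · rw [← MvPolynomial.coe_aeval_eq_eval]
    exact ne_of_eq_of_ne hG1 one_ne_zero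
  · have := hG (MvPolynomial.eval x) hx y y₁ (by rw [hX]; exact hy)
    rwa [eval₂_originRec, hX] at this

/-! ### Formal and convergent solutions -/

section Analytic

open PowerSeries

/-- The series converges in the unit disc. -/
def ConvSeries (F : ℂ⟦X⟧) : Prop :=
  ∀ z ∈ Metric.ball (0 : ℂ) 1, Summable fun n => coeff n F * z ^ n

/-- The sum of a series. -/
noncomputable def seriesSum (F : ℂ⟦X⟧) (z : ℂ) : ℂ := ∑' n, coeff n F * z ^ n

variable {F G : ℂ⟦X⟧} {z : ℂ}

theorem ConvSeries.add (hF : ConvSeries F) (hG : ConvSeries G) : ConvSeries (F + G) := by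
  intro z hz
  simpa [add_mul] using (hF z hz).add (hG z hz)

theorem seriesSum_add (hF : ConvSeries F) (hG : ConvSeries G) (hz : z ∈ Metric.ball (0 : ℂ) 1) :
    seriesSum (F + G) z = seriesSum F z + seriesSum G z := by
  rw [seriesSum, seriesSum, seriesSum, ← (hF z hz).tsum_add (hG z hz)]
  simp [add_mul]

theorem coeff_mul_mul_pow (F G : ℂ⟦X⟧) (z : ℂ) (n : ℕ) : coeff n (F * G) * z ^ n =
    ∑ p ∈ Finset.HasAntidiagonal.antidiagonal n,
      (coeff p.1 F * z ^ p.1) * (coeff p.2 G * z ^ p.2) := by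
  rw [coeff_mul, Finset.sum_mul]
  refine Finset.sum_congr rfl fun p hp => ?_
  rw [← Finset.HasAntidiagonal.mem_antidiagonal.1 hp, pow_add]
  ring

theorem ConvSeries.mul (hF : ConvSeries F) (hG : ConvSeries G) : ConvSeries (F * G) := by
  intro z hz
  simp_rw [coeff_mul_mul_pow]
  exact (summable_norm_sum_mul_antidiagonal_of_summable_norm (hF z hz).norm (hG z hz).norm).of_norm

theorem seriesSum_mul (hF : ConvSeries F) (hG : ConvSeries G) (hz : z ∈ Metric.ball (0 : ℂ) 1) :
    seriesSum (F * G) z = seriesSum F z * seriesSum G z := by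
  rw [seriesSum, seriesSum, seriesSum,
    tsum_mul_tsum_eq_tsum_sum_antidiagonal_of_summable_norm (hF z hz).norm (hG z hz).norm]
  simp_rw [coeff_mul_mul_pow]

theorem hasSum_polynomial (p : Polynomial ℂ) (z : ℂ) :
    HasSum (fun n => coeff n (p : ℂ⟦X⟧) * z ^ n) (p.eval z) := by
  rw [Polynomial.eval_eq_sum_range]
  simp only [Polynomial.coeff_coe]
  refine hasSum_sum_of_ne_finset_zero fun n hn => ?_
  rw [Polynomial.coeff_eq_zero_of_natDegree_lt, zero_mul]
  simpa [Nat.lt_succ_iff] using hn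

theorem convSeries_polynomial (p : Polynomial ℂ) : ConvSeries (p : ℂ⟦X⟧) :=
  fun z _ => (hasSum_polynomial p z).summable

theorem seriesSum_polynomial (p : Polynomial ℂ) (z : ℂ) : seriesSum (p : ℂ⟦X⟧) z = p.eval z :=
  (hasSum_polynomial p z).tsum_eq

/-- Convergence at a real point `r` between `‖z‖` and 1 dominates the series on the disc of radius
`r`, so it may be differentiated term by term. -/
theorem ConvSeries.hasSum_deriv (hF : ConvSeries F) (hz : z ∈ Metric.ball (0 : ℂ) 1) :
    HasSum (fun n => coeff n (d⁄dX ℂ F) * z ^ n) (deriv (seriesSum F) z) ∧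
      DifferentiableAt ℂ (seriesSum F) z := by
  rw [mem_ball_zero_iff] at hz
  obtain ⟨r, hr0, hr1⟩ := exists_between hz
  have hr : 0 ≤ r := (norm_nonneg z).trans hr0.le
  have hs : Summable fun n => ‖coeff n F * (r : ℂ) ^ n‖ :=
    (hF r (by rw [mem_ball_zero_iff]; simpa [abs_of_nonneg hr] using hr1)).norm
  have hle : ∀ (n : ℕ) (w : ℂ), w ∈ Metric.ball (0 : ℂ) r →
      ‖coeff n F * w ^ n‖ ≤ ‖coeff n F * (r : ℂ) ^ n‖ := by
    intro n w hw
    rw [mem_ball_zero_iff] at hw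
    rw [norm_mul, norm_mul, norm_pow, norm_pow, Complex.norm_real, Real.norm_eq_abs,
      abs_of_nonneg hr]
    gcongr
  have hdiff : ∀ n : ℕ, DifferentiableOn ℂ (fun w : ℂ => coeff n F * w ^ n)
      (Metric.ball (0 : ℂ) r) := fun n => by fun_prop
  have hzr : z ∈ Metric.ball (0 : ℂ) r := mem_ball_zero_iff.2 hr0
  constructor
  · have h := Complex.hasSum_deriv_of_summable_norm hs hdiff Metric.isOpen_ball hle hzr
    have e : ∀ n : ℕ, deriv (fun w : ℂ => coeff n F * w ^ n) z = coeff n F * (n * z ^ (n - 1)) := by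
      intro n
      simp
    simp only [e] at h
    have h' := (hasSum_nat_add_iff' 1).2 h
    simp only [Finset.sum_range_one, Nat.cast_zero, zero_mul, mul_zero, sub_zero,
      Nat.add_sub_cancel] at h'
    have e2 : (fun n => coeff n (d⁄dX ℂ F) * z ^ n) =
        fun n => coeff (n + 1) F * (((n + 1 : ℕ) : ℂ) * z ^ n) := by
      funext n
      rw [coeff_derivative]
      push_cast
      ring
    rw [e2]
    exact h'
  · exact ((Complex.differentiableOn_tsum_of_summable_norm hs hdiff Metric.isOpen_ball hle) z
      hzr).differentiableAt (Metric.isOpen_ball.mem_nhds hzr)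

theorem ConvSeries.derivative (hF : ConvSeries F) : ConvSeries (d⁄dX ℂ F) :=
  fun _ hz => (hF.hasSum_deriv hz).1.summable

theorem seriesSum_derivative (hF : ConvSeries F) (hz : z ∈ Metric.ball (0 : ℂ) 1) :
    seriesSum (d⁄dX ℂ F) z = deriv (seriesSum F) z := (hF.hasSum_deriv hz).1.tsum_eq

theorem seriesSum_derivative_derivative (hF : ConvSeries F) (hz : z ∈ Metric.ball (0 : ℂ) 1) :
    seriesSum (d⁄dX ℂ (d⁄dX ℂ F)) z = deriv (deriv (seriesSum F)) z := by
  rw [seriesSum_derivative hF.derivative hz]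
  refine EventuallyEq.deriv_eq ?_
  filter_upwards [Metric.isOpen_ball.mem_nhds hz] with w hw using seriesSum_derivative hF hw

/-- The constant term is the value at 0; the derivative vanishes as well, which gives the remaining
coefficients by induction. -/
theorem eq_zero_of_seriesSum (hF : ConvSeries F)
    (h : ∀ z ∈ Metric.ball (0 : ℂ) 1, seriesSum F z = 0) : F = 0 := by
  have key : ∀ (n : ℕ) (F : ℂ⟦X⟧), ConvSeries F →
      (∀ z ∈ Metric.ball (0 : ℂ) 1, seriesSum F z = 0) → coeff n F = 0 := by
    intro n
    induction n with
    | zero =>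
      intro F hF h
      have := h 0 (by simp)
      rw [seriesSum, tsum_eq_single 0 (fun n hn => by simp [hn])] at this
      simpa using this
    | succ n ih =>
      intro F hF h
      have h1 := ih (d⁄dX ℂ F) hF.derivative fun z hz => by
        rw [seriesSum_derivative hF hz]
        have : seriesSum F =ᶠ[𝓝 z] fun _ => 0 := by
          filter_upwards [Metric.isOpen_ball.mem_nhds hz] with w hw using h w hw
        rw [this.deriv_eq, deriv_const]
      rw [coeff_derivative] at h1
      exact (mul_eq_zero.1 h1).resolve_right (by exact_mod_cast n.succ_ne_zero)
  ext n
  rw [key n F hF h, map_zero]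

theorem fuchsOp_eq_polynomial (P : FuchsianParams) (F : ℂ⟦X⟧) :
    ∃ p₂ p₁ p₀ : Polynomial ℂ, fuchsOp P (d⁄dX ℂ) X F =
        p₂ * d⁄dX ℂ (d⁄dX ℂ F) + p₁ * d⁄dX ℂ F + p₀ * F ∧
      ∀ z : ℂ, z ≠ 0 → z ≠ 1 → z ≠ P.a → z ≠ P.a₁ → ∀ x₂ x₁ x₀ : ℂ,
        p₂.eval z * x₂ + p₁.eval z * x₁ + p₀.eval z * x₀ =
          z * (z - 1) * (z - P.a) * (z - P.a₁) * (x₂ + P.p z * x₁ + P.q z * x₀) := by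
  refine ⟨.X * (.X - 1) * (.X - .C P.a) * (.X - .C P.a₁),
    .C P.γ * ((.X - 1) * (.X - .C P.a) * (.X - .C P.a₁)) +
    .C P.δ * (.X * (.X - .C P.a) * (.X - .C P.a₁)) +
    .C P.ε * (.X * (.X - 1) * (.X - .C P.a₁)) + .C P.ε₁ * (.X * (.X - 1) * (.X - .C P.a)),
    .C P.α * .C P.β * .X ^ 2 - .C P.θ₁ * .X - .C P.θ₀, ?_, ?_⟩
  · simp [fuchsOp]
  · intro z h0 h1 ha hb x₂ x₁ x₀
    have h1' := sub_ne_zero.2 h1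
    have ha' := sub_ne_zero.2 ha
    have hb' := sub_ne_zero.2 hb
    simp only [Polynomial.eval_add, Polynomial.eval_mul, Polynomial.eval_sub, Polynomial.eval_X,
      Polynomial.eval_C, Polynomial.eval_one, Polynomial.eval_pow, FuchsianParams.p,
      FuchsianParams.q]
    field_simp

/-- A convergent series solves the equation in the disc if and only if it solves it formally. -/
theorem solvedOnUnitDisc_iff (P : FuchsianParams) (hF : ConvSeries F) :
    P.SolvedOnUnitDisc (seriesSum F) ↔ fuchsOp P (d⁄dX ℂ) X F = 0 := by
  obtain ⟨p₂, p₁, p₀, hp, hev⟩ := fuchsOp_eq_polynomial P F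
  have c0 := convSeries_polynomial p₀
  have c1 := convSeries_polynomial p₁
  have c2 := convSeries_polynomial p₂
  have hconv : ConvSeries (fuchsOp P (d⁄dX ℂ) X F) := by
    rw [hp]
    exact ((c2.mul hF.derivative.derivative).add (c1.mul hF.derivative)).add (c0.mul hF)
  have hsum : ∀ z ∈ Metric.ball (0 : ℂ) 1, seriesSum (fuchsOp P (d⁄dX ℂ) X F) z =
      p₂.eval z * deriv (deriv (seriesSum F)) z + p₁.eval z * deriv (seriesSum F) z +
        p₀.eval z * seriesSum F z := by
    intro z hz
    rw [hp, seriesSum_add ((c2.mul hF.derivative.derivative).add (c1.mul hF.derivative))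
      (c0.mul hF) hz, seriesSum_add (c2.mul hF.derivative.derivative) (c1.mul hF.derivative) hz,
      seriesSum_mul c2 hF.derivative.derivative hz, seriesSum_mul c1 hF.derivative hz,
      seriesSum_mul c0 hF hz, seriesSum_polynomial, seriesSum_polynomial, seriesSum_polynomial,
      seriesSum_derivative_derivative hF hz, seriesSum_derivative hF hz]
  have hne1 : ∀ z ∈ Metric.ball (0 : ℂ) 1, z ≠ 1 := by
    rintro z hz rfl
    simp at hz
  constructor
  · rintro ⟨-, h⟩
    -- The factor `z (z - a)(z - a₁)` makes the identity hold at the exceptional points too. It is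
    -- cancelled in the domain of power series.
    set p : Polynomial ℂ := .X * (.X - .C P.a) * (.X - .C P.a₁) with hpdef
    have h1 : (p : ℂ⟦X⟧) * fuchsOp P (d⁄dX ℂ) X F = 0 := by
      refine eq_zero_of_seriesSum ((convSeries_polynomial p).mul hconv) fun z hz => ?_
      rw [seriesSum_mul (convSeries_polynomial p) hconv hz, seriesSum_polynomial, hsum z hz]
      by_cases hz0 : z = 0
      · simp [hpdef, hz0]
      by_cases hza : z = P.a
      · simp [hpdef, hza]
      by_cases hzb : z = P.a₁
      · simp [hpdef, hzb]
      rw [hev z hz0 (hne1 z hz) hza hzb, h z hz hz0 hza hzb, mul_zero, mul_zero]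
    refine (mul_eq_zero.1 h1).resolve_left ?_
    rw [Polynomial.coe_eq_zero_iff]
    exact mul_ne_zero (mul_ne_zero Polynomial.X_ne_zero (Polynomial.X_sub_C_ne_zero _))
      (Polynomial.X_sub_C_ne_zero _)
  · intro h
    refine ⟨fun z hz => (hF.hasSum_deriv hz).2.differentiableWithinAt, ?_⟩
    intro z hz hz0 hza hzb
    have h1 := hsum z hz
    rw [h, hev z hz0 (hne1 z hz) hza hzb] at h1
    have h2 : seriesSum (0 : ℂ⟦X⟧) z = 0 := by simp [seriesSum]
    rw [h2] at h1
    exact (mul_eq_zero.1 h1.symm).resolve_left (mul_ne_zero (mul_ne_zero (mul_ne_zero hz0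
      (sub_ne_zero.2 (hne1 z hz))) (sub_ne_zero.2 hza)) (sub_ne_zero.2 hzb))

end Analytic

/-! ### The parameters `e` and the polynomial `R` -/

section Hypergeometric

open PowerSeries

variable {P : FuchsianParams} {N : ℕ}

/-- The polynomial `∏ (1 + x / eᵢ)`. -/
noncomputable def shiftPoly (e : Fin N → ℂ) : Polynomial ℂ :=
  ∏ i, (1 + .C (e i)⁻¹ * .X)

/-- `(1 + e)_n / (e)_n = (e + n) / e = 1 + n / e`. -/
theorem genHypCoeff_eq (e : Fin N → ℂ) (he : ∀ i (m : ℕ), e i ≠ -m) (n : ℕ) :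
    genHypCoeff (P.upper e) (P.lower e) n = gaussSeriesCoeff P n * (shiftPoly e).eval (n : ℂ) := by
  have h : ∀ i, (ascPochhammer ℂ n).eval (1 + e i) =
      (ascPochhammer ℂ n).eval (e i) * (1 + (e i)⁻¹ * n) := by
    intro i
    have h0 : e i ≠ 0 := by simpa using he i 0
    have h1 := ascPochhammer_succ_eval_left n (e i)
    rw [ascPochhammer_succ_eval] at h1
    refine mul_left_cancel₀ h0 ?_
    rw [add_comm 1, ← h1]
    field_simp
  have h2 : ∏ i, (ascPochhammer ℂ n).eval (e i) ≠ 0 :=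
    Finset.prod_ne_zero_iff.2 fun i _ => ascPochhammer_eval_ne_zero (he i) n
  rw [genHypCoeff, gaussSeriesCoeff, shiftPoly, Polynomial.eval_prod]
  simp only [FuchsianParams.upper, FuchsianParams.lower, Fin.prod_univ_succ, Matrix.cons_val_zero,
    Matrix.cons_val_succ, h, Finset.prod_mul_distrib, Polynomial.eval_add, Polynomial.eval_one,
    Polynomial.eval_mul, Polynomial.eval_C, Polynomial.eval_X]
  field_simp

theorem shiftPoly_natDegree (e : Fin N → ℂ) (he : ∀ i, e i ≠ 0) :
    (shiftPoly e).natDegree = N := by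
  have h : ∀ i, (1 + .C (e i)⁻¹ * .X : Polynomial ℂ).natDegree = 1 := by
    intro i
    rw [add_comm, ← Polynomial.C_1]
    exact Polynomial.natDegree_linear (inv_ne_zero (he i))
  rw [shiftPoly, Polynomial.natDegree_prod]
  · simp [h]
  · intro i _ h0
    have := h i
    rw [h0] at this
    simp at this

theorem shiftPoly_roots (e : Fin N → ℂ) (he : ∀ i, e i ≠ 0) :
    (shiftPoly e).roots = Finset.univ.val.map fun i => -e i := by
  have h : shiftPoly e = .C (∏ i, (e i)⁻¹) *
      ((Finset.univ.val.map fun i => -e i).map fun x => Polynomial.X - .C x).prod := by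
    rw [shiftPoly, map_prod, Multiset.map_map]
    change _ = _ * ∏ i, (Polynomial.X - Polynomial.C (-e i))
    rw [← Finset.prod_mul_distrib]
    refine Finset.prod_congr rfl fun i _ => ?_
    rw [Polynomial.C_neg, sub_neg_eq_add, mul_add, ← Polynomial.C_mul, inv_mul_cancel₀ (he i),
      Polynomial.C_1, add_comm]
  rw [h, Polynomial.roots_C_mul _ (Finset.prod_ne_zero_iff.2 fun i _ => inv_ne_zero (he i)),
    Polynomial.roots_multiset_prod_X_sub_C]

/-- The `e_i` are the negatives of the roots; the normalization `R(0) = 1` fixes the leading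
coefficient. -/
theorem exists_shiftPoly_eq (R : Polynomial ℂ) (hN : R.natDegree = N) (h0 : R.eval 0 = 1) :
    ∃ e : Fin N → ℂ, (∀ i, e i ≠ 0 ∧ R.eval (-e i) = 0) ∧ shiftPoly e = R := by
  have hR : R ≠ 0 := by
    rintro rfl
    simp at h0
  have hsplit := IsAlgClosed.splits R
  obtain ⟨r, hr⟩ : ∃ r : Fin N → ℂ, R.roots = Finset.univ.val.map r := by
    obtain ⟨L, hL⟩ := Quot.exists_rep R.roots
    have hlen : L.length = N := by
      rw [← hN, hsplit.natDegree_eq_card_roots, ← hL]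
      rfl
    subst hlen
    refine ⟨L.get, ?_⟩
    rw [Fin.univ_val_map, List.ofFn_get]
    exact hL.symm
  have hroot : ∀ i, R.eval (r i) = 0 := by
    intro i
    have : r i ∈ R.roots := by
      rw [hr]
      exact Multiset.mem_map_of_mem r (Finset.mem_univ_val i)
    exact Polynomial.isRoot_of_mem_roots this
  have hr0 : ∀ i, r i ≠ 0 := by
    intro i h
    have := hroot i
    rw [h, h0] at this
    exact one_ne_zero this
  refine ⟨fun i => -r i, fun i => ⟨neg_ne_zero.2 (hr0 i), by simpa using hroot i⟩, ?_⟩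
  have h1 : R = .C R.leadingCoeff * ∏ i, (Polynomial.X - .C (r i)) := by
    conv_lhs => rw [hsplit.eq_prod_roots, hr, Multiset.map_map]
    rfl
  have h2 : shiftPoly (fun i => -r i) = .C (∏ i, (-r i)⁻¹) * ∏ i, (Polynomial.X - .C (r i)) := by
    rw [shiftPoly, map_prod, ← Finset.prod_mul_distrib]
    refine Finset.prod_congr rfl fun i _ => ?_
    rw [mul_sub, ← Polynomial.C_mul, inv_neg, neg_mul, inv_mul_cancel₀ (hr0 i)]
    simp [add_comm]
  have h3 := congrArg (Polynomial.eval 0) h1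
  rw [h0, Polynomial.eval_mul, Polynomial.eval_C, Polynomial.eval_prod] at h3
  simp only [Polynomial.eval_sub, Polynomial.eval_X, Polynomial.eval_C, zero_sub] at h3
  have h4 : ∏ i, (-r i)⁻¹ = R.leadingCoeff := by
    rw [Finset.prod_inv_distrib]
    exact (eq_inv_of_mul_eq_one_left h3.symm).symm
  rw [h2, h4, ← h1]

theorem exists_perm_of_map_eq {ι κ : Type*} [Fintype ι] (f g : ι → κ)
    (h : Finset.univ.val.map f = Finset.univ.val.map g) : ∃ π : Equiv.Perm ι, g = f ∘ π := by
  classical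
  have hc : ∀ c, Nonempty ({i // g i = c} ≃ {i // f i = c}) := by
    intro c
    rw [← Fintype.card_eq, Fintype.card_subtype, Fintype.card_subtype]
    have := congrArg (Multiset.count c) h
    rw [Multiset.count_map, Multiset.count_map] at this
    simp only [Finset.card, Finset.filter_val, eq_comm (b := c)]
    simpa [eq_comm] using this.symm
  refine ⟨Equiv.ofFiberEquiv fun c => (hc c).some, ?_⟩
  funext i
  exact (Equiv.ofFiberEquiv_map (fun c => (hc c).some) i).symm

theorem exists_perm_of_shiftPoly_eq {e e' : Fin N → ℂ} (he : ∀ i, e i ≠ 0) (he' : ∀ i, e' i ≠ 0)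
    (h : shiftPoly e = shiftPoly e') : ∃ π : Equiv.Perm (Fin N), e' = e ∘ π := by
  obtain ⟨π, hπ⟩ := exists_perm_of_map_eq _ _
    ((shiftPoly_roots e he).symm.trans ((congrArg _ h).trans (shiftPoly_roots e' he')))
  exact ⟨π, funext fun i => neg_injective (congrFun hπ i)⟩

theorem convSeries_gauss (hα : ∀ m : ℕ, P.α ≠ -m) (hβ : ∀ m : ℕ, P.β ≠ -m)
    (hγ : ∀ m : ℕ, P.γ ≠ -m) : ConvSeries (PowerSeries.mk (gaussSeriesCoeff P)) := by
  intro z hz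
  have hr := ordinaryHypergeometricSeries_radius_eq_one ℂ P.α P.β P.γ fun m =>
    ⟨fun h => hα m (by rw [h, neg_neg]), fun h => hβ m (by rw [h, neg_neg]),
      fun h => hγ m (by rw [h, neg_neg])⟩
  have hs := (ordinaryHypergeometricSeries ℂ P.α P.β P.γ).summable (x := z) (by
    rw [hr]
    simpa [← ENNReal.coe_one, Metric.eball_coe] using hz)
  rw [ordinaryHypergeometricSeries_apply_eq'] at hs
  refine hs.congr fun n => ?_
  rw [PowerSeries.coeff_mk, gaussSeriesCoeff, smul_eq_mul]
  simp only [div_eq_mul_inv, mul_inv]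
  ring

/-- A factor `n` on the coefficients is the operator `z d/dz`, which preserves convergence in the
disc. -/
theorem convSeries_mul_eval {c : ℕ → ℂ} (hc : ConvSeries (PowerSeries.mk c)) (R : Polynomial ℂ) :
    ConvSeries (PowerSeries.mk fun n => c n * R.eval (n : ℂ)) := by
  induction R using Polynomial.induction_on with
  | C a =>
    intro z hz
    simpa [mul_right_comm] using (hc z hz).mul_right a
  | add p q hp hq =>
    intro z hz
    simpa [mul_add, add_mul] using (hp z hz).add (hq z hz)
  | monomial m a h =>
    intro z hz
    have hX : ConvSeries (X : ℂ⟦X⟧) := by simpa using convSeries_polynomial Polynomial.X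
    refine ((hX.mul h.derivative) z hz).congr fun n => ?_
    cases n with
    | zero => simp
    | succ n =>
      rw [coeff_succ_X_mul, coeff_derivative]
      simp only [coeff_mk, Polynomial.eval_mul, Polynomial.eval_C, Polynomial.eval_pow,
        Polynomial.eval_X, Nat.cast_succ, pow_succ]
      ring

theorem genHyp_eq_seriesSum (e : Fin N → ℂ) : genHyp (P.upper e) (P.lower e) =
    seriesSum (PowerSeries.mk (genHypCoeff (P.upper e) (P.lower e))) := by
  funext z
  simp [genHyp, seriesSum]

theorem lower_ne_iff (e : Fin N → ℂ) : (∀ (j : Fin (N + 1)) (m : ℕ), P.lower e j ≠ -(m : ℂ)) ↔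
    (∀ m : ℕ, P.γ ≠ -m) ∧ ∀ i (m : ℕ), e i ≠ -m := by
  rw [Fin.forall_fin_succ]
  rfl

/-- The coefficients of the series with the parameters `e`. -/
noncomputable def shiftSeries (P : FuchsianParams) (e : Fin N → ℂ) : ℂ⟦X⟧ :=
  PowerSeries.mk fun n => gaussSeriesCoeff P n * (shiftPoly e).eval (n : ℂ)

theorem FuchsianParams.IsHypergeometricSolution.formal {e : Fin N → ℂ}
    (h : P.IsHypergeometricSolution e) : (∀ m : ℕ, P.γ ≠ -m) ∧ (∀ i (m : ℕ), e i ≠ -m) ∧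
      fuchsOp P (d⁄dX ℂ) X (shiftSeries P e) = 0 := by
  obtain ⟨h1, h2, h3⟩ := h
  obtain ⟨hγ, he⟩ := (lower_ne_iff e).1 h1
  have hs : PowerSeries.mk (genHypCoeff (P.upper e) (P.lower e)) = shiftSeries P e := by
    ext n
    simp [shiftSeries, genHypCoeff_eq e he n]
  rw [genHyp_eq_seriesSum, hs] at h3
  refine ⟨hγ, he, (solvedOnUnitDisc_iff P ?_).1 h3⟩
  intro z hz
  rw [← hs]
  simpa using h2 z hz

theorem isHypergeometricSolution_of_formal (hα : ∀ m : ℕ, P.α ≠ -m) (hβ : ∀ m : ℕ, P.β ≠ -m)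
    (hγ : ∀ m : ℕ, P.γ ≠ -m) {e : Fin N → ℂ} (he : ∀ i (m : ℕ), e i ≠ -m)
    (h : fuchsOp P (d⁄dX ℂ) X (shiftSeries P e) = 0) : P.IsHypergeometricSolution e := by
  have hs : PowerSeries.mk (genHypCoeff (P.upper e) (P.lower e)) = shiftSeries P e := by
    ext n
    simp [shiftSeries, genHypCoeff_eq e he n]
  have hc : ConvSeries (shiftSeries P e) := convSeries_mul_eval (convSeries_gauss hα hβ hγ) _
  refine ⟨(lower_ne_iff e).2 ⟨hγ, he⟩, fun z hz => ?_, ?_⟩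
  · have := hc z hz
    rw [← hs] at this
    simpa using this
  · rw [genHyp_eq_seriesSum, hs]
    exact (solvedOnUnitDisc_iff P hc).2 h

end Hypergeometric

/-! ### Regular singular points -/

section SingularPoints

/-- If the point were ordinary, `(z - z₀) p` would tend to 0 there, but it tends to the residue. -/
theorem isRegularSingularPoint_of_residue_ne_zero {p q A B : ℂ → ℂ} {z₀ : ℂ} (hA : AnalyticAt ℂ A z₀)
    (hB : AnalyticAt ℂ B z₀) (hp : ∀ᶠ z in 𝓝[≠] z₀, (z - z₀) * p z = A z)
    (hq : ∀ᶠ z in 𝓝[≠] z₀, (z - z₀) ^ 2 * q z = B z) (h0 : A z₀ ≠ 0) :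
    IsRegularSingularPoint p q z₀ := by
  refine ⟨?_, A, B, hA, hB, hp, hq⟩
  rintro ⟨U, V, hU, -, hpU, -⟩
  have h1 : Tendsto A (𝓝[≠] z₀) (𝓝 (A z₀)) := hA.continuousAt.tendsto.mono_left nhdsWithin_le_nhds
  have h2 : Tendsto (fun z => (z - z₀) * U z) (𝓝[≠] z₀) (𝓝 ((z₀ - z₀) * U z₀)) :=
    (((continuousAt_id.sub continuousAt_const).mul hU.continuousAt).tendsto).mono_left
      nhdsWithin_le_nhds
  rw [sub_self, zero_mul] at h2
  refine h0 (tendsto_nhds_unique h1 (h2.congr' ?_))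
  filter_upwards [hp, hpU] with z h3 h4
  rw [← h3, h4]

theorem analyticAt_div_sub {z₀ b : ℂ} (c : ℂ) (h : z₀ ≠ b) :
    AnalyticAt ℂ (fun z => c / (z - b)) z₀ :=
  analyticAt_const.div (analyticAt_id.sub analyticAt_const) (sub_ne_zero.2 h)

theorem analyticAt_quadratic_div {z₀ b c d : ℂ} (u v w : ℂ) (hb : z₀ ≠ b) (hc : z₀ ≠ c)
    (hd : z₀ ≠ d) :
    AnalyticAt ℂ (fun z => (u * z ^ 2 - v * z - w) / ((z - b) * (z - c) * (z - d))) z₀ := by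
  refine AnalyticAt.div (by fun_prop) (by fun_prop) ?_
  exact mul_ne_zero (mul_ne_zero (sub_ne_zero.2 hb) (sub_ne_zero.2 hc)) (sub_ne_zero.2 hd)

theorem isRegularSingularPoint_of_partial_fractions {p q : ℂ → ℂ} {z₀ b c d : ℂ}
    (r r₁ r₂ r₃ u v w : ℂ)
    (hp : ∀ z, p z = r / (z - z₀) + r₁ / (z - b) + r₂ / (z - c) + r₃ / (z - d))
    (hq : ∀ z, q z = (u * z ^ 2 - v * z - w) / ((z - z₀) * (z - b) * (z - c) * (z - d)))
    (hb : z₀ ≠ b) (hc : z₀ ≠ c) (hd : z₀ ≠ d) (hr : r ≠ 0) : IsRegularSingularPoint p q z₀ := by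
  refine isRegularSingularPoint_of_residue_ne_zero
    (A := fun z => r + (z - z₀) * (r₁ / (z - b) + r₂ / (z - c) + r₃ / (z - d)))
    (B := fun z => (z - z₀) * ((u * z ^ 2 - v * z - w) / ((z - b) * (z - c) * (z - d))))
    (analyticAt_const.add ((analyticAt_id.sub analyticAt_const).mul
      (((analyticAt_div_sub r₁ hb).add (analyticAt_div_sub r₂ hc)).add (analyticAt_div_sub r₃ hd))))
    ((analyticAt_id.sub analyticAt_const).mul (analyticAt_quadratic_div u v w hb hc hd)) ?_ ?_
    (by simpa using hr)
  · filter_upwards [self_mem_nhdsWithin] with z hz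
    have hz' : z - z₀ ≠ 0 := sub_ne_zero.2 hz
    rw [hp, add_assoc, add_assoc, mul_add, mul_div_cancel₀ _ hz', add_assoc]
  · filter_upwards [self_mem_nhdsWithin] with z hz
    have hz' : z - z₀ ≠ 0 := sub_ne_zero.2 hz
    rw [hq, mul_assoc (z - z₀), mul_assoc (z - z₀), ← div_div, ← div_div]
    field_simp

variable {P : FuchsianParams}

/-- By the Fuchs relation the residue at `w = 0` is `2 - (γ + δ + ε + ε₁) = 1 - α - β`. -/
theorem isRegularSingularAtInfinity (hP : P.FuchsRelation) (hαβ : P.α + P.β ≠ 1) :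
    IsRegularSingularAtInfinity P.p P.q := by
  have h1 : ∀ c : ℂ, AnalyticAt ℂ (fun w : ℂ => 1 - c * w) 0 := fun c => by fun_prop
  have h2 : ∀ c r : ℂ, AnalyticAt ℂ (fun w : ℂ => r / (1 - c * w)) 0 := fun c r =>
    analyticAt_const.div (h1 c) (by simp)
  have hne : ∀ c : ℂ, ∀ᶠ w in 𝓝[≠] (0 : ℂ), 1 - c * w ≠ 0 := fun c =>
    ((h1 c).continuousAt.eventually_ne (by simp)).filter_mono nhdsWithin_le_nhds
  refine isRegularSingularPoint_of_residue_ne_zero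
    (A := fun w => 2 - (P.γ + P.δ / (1 - 1 * w) + P.ε / (1 - P.a * w) + P.ε₁ / (1 - P.a₁ * w)))
    (B := fun w => (P.α * P.β - P.θ₁ * w - P.θ₀ * w ^ 2) /
      ((1 - 1 * w) * (1 - P.a * w) * (1 - P.a₁ * w)))
    (analyticAt_const.sub (((analyticAt_const.add (h2 1 _)).add (h2 _ _)).add (h2 _ _)))
    (AnalyticAt.div (by fun_prop) (((h1 1).mul (h1 _)).mul (h1 _)) (by simp)) ?_ ?_ ?_
  · filter_upwards [self_mem_nhdsWithin, hne 1, hne P.a, hne P.a₁] with w hw e1 e2 e3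
    have hw : w ≠ 0 := hw
    have f1 : 1 / w - 1 = (1 - 1 * w) / w := by field_simp
    have f2 : 1 / w - P.a = (1 - P.a * w) / w := by field_simp
    have f3 : 1 / w - P.a₁ = (1 - P.a₁ * w) / w := by field_simp
    rw [FuchsianParams.p, f1, f2, f3]
    field_simp
    ring
  · filter_upwards [self_mem_nhdsWithin, hne 1, hne P.a, hne P.a₁] with w hw e1 e2 e3
    have hw : w ≠ 0 := hw
    have f1 : 1 / w - 1 = (1 - 1 * w) / w := by field_simp
    have f2 : 1 / w - P.a = (1 - P.a * w) / w := by field_simp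
    have f3 : 1 / w - P.a₁ = (1 - P.a₁ * w) / w := by field_simp
    rw [FuchsianParams.q, f1, f2, f3]
    field_simp
    ring
  · intro h
    simp only [mul_zero, sub_zero, div_one] at h
    refine hαβ ?_
    unfold FuchsianParams.FuchsRelation at hP
    linear_combination hP - h

theorem hasFiveRegularSingularPoints (hP : P.FuchsRelation) (hd : P.DistinctPoints)
    (hγ : P.γ ≠ 0) (hδ : P.δ ≠ 0) (hε : P.ε ≠ 0) (hε₁ : P.ε₁ ≠ 0) (hαβ : P.α + P.β ≠ 1) :
    P.HasFiveRegularSingularPoints := by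
  obtain ⟨ha0, ha1, hb0, hb1, hab⟩ := id hd
  refine ⟨hd, ?_, ?_, ?_, ?_, isRegularSingularAtInfinity hP hαβ, ?_⟩
  · refine isRegularSingularPoint_of_partial_fractions P.γ P.δ P.ε P.ε₁ (P.α * P.β) P.θ₁ P.θ₀
      (fun z => ?_) (fun z => ?_) zero_ne_one ha0.symm hb0.symm hγ
    · rw [FuchsianParams.p, sub_zero]
    · rw [FuchsianParams.q, sub_zero]
  · refine isRegularSingularPoint_of_partial_fractions (b := 0) P.δ P.γ P.ε P.ε₁ (P.α * P.β) P.θ₁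
      P.θ₀ (fun z => ?_) (fun z => ?_) one_ne_zero ha1.symm hb1.symm hδ
    · rw [FuchsianParams.p, sub_zero]
      ring
    · rw [FuchsianParams.q, sub_zero, mul_comm (z - 1) z]
  · refine isRegularSingularPoint_of_partial_fractions (b := 0) (c := 1) P.ε P.γ P.δ P.ε₁
      (P.α * P.β) P.θ₁ P.θ₀ (fun z => ?_) (fun z => ?_) ha0 ha1 hab hε
    · rw [FuchsianParams.p, sub_zero]
      ring
    · rw [FuchsianParams.q, sub_zero]
      ring
  · refine isRegularSingularPoint_of_partial_fractions (b := 0) (c := 1) P.ε₁ P.γ P.δ P.ε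
      (P.α * P.β) P.θ₁ P.θ₀ (fun z => ?_) (fun z => ?_) hb0 hb1 hab.symm hε₁
    · rw [FuchsianParams.p, sub_zero]
      ring
    · rw [FuchsianParams.q, sub_zero]
      ring
  · intro z h0 h1 h2 h3
    refine ⟨P.p, P.q, ?_, ?_, .of_forall fun _ => rfl, .of_forall fun _ => rfl⟩
    · exact (((analyticAt_const.div analyticAt_id h0).add (analyticAt_div_sub _ h1)).add
        (analyticAt_div_sub _ h2)).add (analyticAt_div_sub _ h3)
    · refine AnalyticAt.div (by fun_prop) (by fun_prop) ?_
      exact mul_ne_zero (mul_ne_zero (mul_ne_zero h0 (sub_ne_zero.2 h1)) (sub_ne_zero.2 h2))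
        (sub_ne_zero.2 h3)

end SingularPoints

/-! ### Generic parameters -/

section Generic

open MvPolynomial

/-- Induction on the number of variables. Once the leading coefficients in the first variable are
nonzero at `y`, each polynomial excludes finitely many values `t`, and `ℂ` is uncountable. -/
theorem exists_forall_eval_ne_zero (n : ℕ) (G : ℕ → MvPolynomial (Fin n) ℂ) (hG : ∀ i, G i ≠ 0) :
    ∃ x : Fin n → ℂ, ∀ i, eval x (G i) ≠ 0 := by
  induction n with
  | zero =>
    refine ⟨0, fun i h => hG i ?_⟩
    rw [eq_C_of_isEmpty (G i), eval_C] at h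
    rw [eq_C_of_isEmpty (G i), h, C_0]
  | succ n ih =>
    obtain ⟨y, hy⟩ := ih (fun i => (finSuccEquiv ℂ n (G i)).leadingCoeff) fun i =>
      Polynomial.leadingCoeff_ne_zero.2 (by simpa using hG i)
    have hne : ∀ i, (finSuccEquiv ℂ n (G i)).map (eval y) ≠ 0 := by
      intro i h
      refine hy i ?_
      rw [Polynomial.leadingCoeff, ← Polynomial.coeff_map, h, Polynomial.coeff_zero]
    have hc : (⋃ i, {t | ((finSuccEquiv ℂ n (G i)).map (eval y)).IsRoot t}).Countable :=
      Set.countable_iUnion fun i => (Polynomial.finite_setOfPred_isRoot (hne i)).countable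
    obtain ⟨t, ht⟩ : ∃ t, t ∉ ⋃ i, {t | ((finSuccEquiv ℂ n (G i)).map (eval y)).IsRoot t} := by
      by_contra! h
      exact not_countable_complex (hc.mono fun t _ => h t)
    refine ⟨Fin.cons t y, fun i h => ht (Set.mem_iUnion.2 ⟨i, ?_⟩)⟩
    rw [eval_eq_eval_mv_eval'] at h
    exact h

/-- The property holds off a countable union of zero sets of nonzero polynomials. -/
def HoldsGenerically {n : ℕ} (Q : (Fin n → ℂ) → Prop) : Prop :=
  ∃ G : ℕ → MvPolynomial (Fin n) ℂ, (∀ i, G i ≠ 0) ∧ ∀ x, (∀ i, eval x (G i) ≠ 0) → Q x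

namespace HoldsGenerically

variable {n : ℕ} {Q Q' : (Fin n → ℂ) → Prop}

theorem exists_point (h : HoldsGenerically Q) : ∃ x, Q x := by
  obtain ⟨G, hG, h⟩ := h
  obtain ⟨x, hx⟩ := exists_forall_eval_ne_zero n G hG
  exact ⟨x, h x hx⟩

theorem mono (h : HoldsGenerically Q) (hQ : ∀ x, Q x → Q' x) : HoldsGenerically Q' := by
  obtain ⟨G, hG, h⟩ := h
  exact ⟨G, hG, fun x hx => hQ x (h x hx)⟩

theorem of_eval_ne_zero (g : MvPolynomial (Fin n) ℂ) (x₀ : Fin n → ℂ) (h0 : eval x₀ g ≠ 0) :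
    HoldsGenerically fun x => eval x g ≠ 0 :=
  ⟨fun _ => g, fun _ h => h0 ((congrArg _ h).trans (map_zero _)), fun _ hx => hx 0⟩

theorem all {ι : Type*} [Countable ι] [Nonempty ι] {Q : ι → (Fin n → ℂ) → Prop}
    (h : ∀ i, HoldsGenerically (Q i)) : HoldsGenerically fun x => ∀ i, Q i x := by
  choose G hG h using h
  obtain ⟨f, hf⟩ := exists_surjective_nat (ι × ℕ)
  refine ⟨fun j => G (f j).1 (f j).2, fun j => hG _ _, fun x hx i => h i x fun m => ?_⟩
  obtain ⟨j, hj⟩ := hf (i, m)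
  simpa [hj] using hx j

theorem and (h : HoldsGenerically Q) (h' : HoldsGenerically Q') :
    HoldsGenerically fun x => Q x ∧ Q' x :=
  (all (Q := fun b : Bool => cond b Q Q') (Bool.rec h' h)).mono fun _ hx => ⟨hx true, hx false⟩

end HoldsGenerically

end Generic

/-! ### Hypergeometric solutions and apparent pairs -/

section Solutions

open PowerSeries

variable {P : FuchsianParams} {N k l : ℕ}

/-- None of `α`, `β`, `γ - α`, `γ - β` is an integer. -/
def FuchsianParams.NonIntegral (P : FuchsianParams) : Prop :=
  ∀ m : ℤ, P.α ≠ m ∧ P.β ≠ m ∧ P.γ - P.α ≠ m ∧ P.γ - P.β ≠ m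

theorem FuchsianParams.NonIntegral.α_ne (h : P.NonIntegral) (m : ℕ) : P.α ≠ -m := by
  exact_mod_cast (h (-m)).1

theorem FuchsianParams.NonIntegral.β_ne (h : P.NonIntegral) (m : ℕ) : P.β ≠ -m := by
  exact_mod_cast (h (-m)).2.1

theorem gaussSeriesCoeff_zero : gaussSeriesCoeff P 0 = 1 := by
  simp [gaussSeriesCoeff]

theorem shiftPoly_eval_zero (e : Fin N → ℂ) : (shiftPoly e).eval 0 = 1 := by
  simp [shiftPoly, Polynomial.eval_prod]

theorem coeff_zero_shiftSeries (e : Fin N → ℂ) : coeff 0 (shiftSeries P e) = 1 := by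
  simp [shiftSeries, gaussSeriesCoeff_zero, shiftPoly_eval_zero]

theorem shiftPoly_ne_zero (e : Fin N → ℂ) : shiftPoly e ≠ 0 := fun h => by
  simpa [h] using shiftPoly_eval_zero e

theorem ne_zero_of_forall_ne_neg {e : Fin N → ℂ} (he : ∀ i (m : ℕ), e i ≠ -m) (i : Fin N) :
    e i ≠ 0 := by
  simpa using he i 0

/-- The first relation at 0 reads `-a a₁ γ c₁ = θ₀`, and `γ c₁ = αβ R(1)`. -/
theorem theta0Formula_of_formal (hP : P.FuchsRelation) (hγ : ∀ m : ℕ, P.γ ≠ -m) {e : Fin N → ℂ}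
    (he : ∀ i (m : ℕ), e i ≠ -m) (h : fuchsOp P (d⁄dX ℂ) X (shiftSeries P e) = 0) :
    P.Theta0Formula e := by
  have h1 := coeff_X_mul_fuchsOp_origin P hP (shiftSeries P e) 1
  rw [h, mul_zero, map_zero] at h1
  simp only [fourTerm, coeff_zero_shiftSeries, originK₀, originK₁, Nat.cast_one, Nat.cast_zero] at h1
  have h2 : coeff 1 (shiftSeries P e) = gaussSeriesCoeff P 1 * (shiftPoly e).eval 1 := by
    simp [shiftSeries]
  have h3 : (shiftPoly e).eval 1 = (∏ i, (1 + e i)) / ∏ i, e i := by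
    rw [shiftPoly, Polynomial.eval_prod, ← Finset.prod_div_distrib]
    refine Finset.prod_congr rfl fun i _ => ?_
    have := ne_zero_of_forall_ne_neg he i
    simp only [Polynomial.eval_add, Polynomial.eval_one, Polynomial.eval_mul, Polynomial.eval_C,
      Polynomial.eval_X]
    field_simp
    ring
  have h4 := gaussSeriesCoeff_succ hγ 0
  rw [gaussSeriesCoeff_zero] at h4
  simp only [Nat.cast_zero, zero_add] at h4
  rw [FuchsianParams.Theta0Formula, ← h3]
  rw [h2] at h1
  linear_combination h1 - P.a * P.a₁ * (shiftPoly e).eval 1 * h4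

namespace FuchsianParams.IsHypergeometricSolution

variable {e : Fin N → ℂ}

theorem theta0Formula (h : P.IsHypergeometricSolution e) (hP : P.FuchsRelation) :
    P.Theta0Formula e :=
  theta0Formula_of_formal hP h.formal.1 h.formal.2.1 h.formal.2.2

theorem recurrencePoly_eq_zero (h : P.IsHypergeometricSolution e) (hP : P.FuchsRelation)
    (hint : P.NonIntegral) : P.recurrencePoly (shiftPoly e) = 0 :=
  _root_.recurrencePoly_eq_zero hP hint.α_ne hint.β_ne h.formal.1
    (fun _ => coeff_mk _ _) h.formal.2.2

theorem exists_exponents (h : P.IsHypergeometricSolution e) (hP : P.FuchsRelation)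
    (hd : P.DistinctPoints) (hint : P.NonIntegral) :
    ∃ k l : ℕ, P.ε = -(k : ℂ) ∧ P.ε₁ = -(l : ℂ) ∧ k + l = N := by
  have hR := h.recurrencePoly_eq_zero hP hint
  have h0 := shiftPoly_ne_zero e
  obtain ⟨k, hk⟩ := exists_exponent_of_recurrencePoly hP hd hint h0 hR
  obtain ⟨l, hl⟩ := exists_exponent_of_recurrencePoly hP.swap hd.swap hint h0
    ((P.recurrencePoly_swap (shiftPoly e)).trans hR)
  refine ⟨k, l, hk, hl, ?_⟩
  have h1 := P.natDegree_of_recurrencePoly hP hd h0 hR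
  rw [hk, show P.ε₁ = -(l : ℂ) from hl,
    shiftPoly_natDegree e (ne_zero_of_forall_ne_neg h.formal.2.1)] at h1
  have : ((k + l : ℕ) : ℂ) = N := by
    push_cast
    linear_combination -h1
  exact_mod_cast this

theorem isApparentPair (h : P.IsHypergeometricSolution e) (hP : P.FuchsRelation)
    (hd : P.DistinctPoints) (hint : P.NonIntegral) (hε : P.ε = -k) (hε₁ : P.ε₁ = -l) :
    IsApparentPair k l P.vec P.accessory P.swap.accessory :=
  isApparentPair_of_recurrencePoly hP hd hint hε hε₁ (shiftPoly_ne_zero e)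
    (h.recurrencePoly_eq_zero hP hint)

/-- The formal solution at 0 with constant term 1 is unique, so the two polynomials agree at all
natural numbers; their roots determine the parameters. -/
theorem exists_perm {e' : Fin N → ℂ} (h : P.IsHypergeometricSolution e)
    (h' : P.IsHypergeometricSolution e') (hP : P.FuchsRelation)
    (hd : P.DistinctPoints) (hint : P.NonIntegral) (hε : P.ε = -k) (hε₁ : P.ε₁ = -l) :
    ∃ π : Equiv.Perm (Fin N), e' = e ∘ π := by
  obtain ⟨hγ, he, hf⟩ := h.formal
  obtain ⟨-, he', hf'⟩ := h'.formal
  refine exists_perm_of_shiftPoly_eq (ne_zero_of_forall_ne_neg he) (ne_zero_of_forall_ne_neg he') ?_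
  have hev : ∀ n : ℕ, (shiftPoly e).eval (n : ℂ) = (shiftPoly e').eval (n : ℂ) := by
    intro n
    have h1 := coeff_mul_originProd hP hε hε₁ _ hf n
    have h2 := coeff_mul_originProd hP hε hε₁ _ hf' n
    rw [coeff_zero_shiftSeries] at h1 h2
    have h3 := mul_right_cancel₀ (originProd_ne_zero hd hγ n) (h1.trans h2.symm)
    simp only [shiftSeries, coeff_mk] at h3
    exact mul_left_cancel₀ (gaussSeriesCoeff_ne_zero hint.α_ne hint.β_ne hγ n) h3
  refine Polynomial.eq_of_infinite_eval_eq _ _ ((Set.infinite_range_of_injective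
    (Nat.cast_injective (R := ℂ))).mono ?_)
  rintro _ ⟨n, rfl⟩
  exact hev n

end FuchsianParams.IsHypergeometricSolution

/-- If some `e_i` were a non-positive integer `-m`, then `R(m) = 0`, and the coefficient of `z^m`
would vanish against `hne`. -/
theorem exists_isHypergeometricSolution (hP : P.FuchsRelation) (hd : P.DistinctPoints)
    (hint : P.NonIntegral) (hγ : ∀ m : ℕ, P.γ ≠ -m) (hε : P.ε = -k) (hε₁ : P.ε₁ = -l)
    (h : IsApparentPair k l P.vec P.accessory P.swap.accessory)
    (hne : ∀ n, originRec k l P.vec P.accessory P.swap.accessory n ≠ 0) :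
    ∃ e : Fin (k + l) → ℂ, P.IsHypergeometricSolution e := by
  obtain ⟨u, R, hu0, hu, hR, hc⟩ := exists_hypergeometric_coeff hP hd hint hγ hε hε₁ h
  have hR0 : R.eval 0 = 1 := by
    have := hc 0
    rwa [hu0, gaussSeriesCoeff_zero, one_mul, Nat.cast_zero, eq_comm] at this
  obtain ⟨e, he, rfl⟩ := exists_shiftPoly_eq R hR hR0
  have hev : ∀ m : ℕ, (shiftPoly e).eval (m : ℂ) ≠ 0 := by
    intro m h0
    have h1 := coeff_mul_originProd hP hε hε₁ u hu m
    rw [hc, h0, mul_zero, zero_mul, hu0, one_mul] at h1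
    exact hne m h1.symm
  refine ⟨e, isHypergeometricSolution_of_formal hint.α_ne hint.β_ne hγ (fun i m hm => ?_) ?_⟩
  · have := (he i).2
    rw [hm, neg_neg] at this
    exact hev m this
  · rwa [show shiftSeries P e = u by ext n; rw [shiftSeries, coeff_mk, hc]]

end Solutions

/-! ### Genericity of the apparent pairs -/

section Genericity

variable {k l : ℕ}

theorem isApparentPair_scaledParams {h : ℂ} (hh : h ≠ 0) (α β γ a a₁ y y₁ : ℂ) :
    IsApparentPair k l (scaledParams h α β γ a a₁) (h * y) (h * y₁) ↔
      IsApparentPair k l (scaledParams 1 α β γ a a₁) y y₁ := by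
  simp only [IsApparentPair, swapPoints_scaledParams, apparentRec_scaledParams, mul_eq_zero,
    pow_eq_zero_iff (Nat.succ_ne_zero _), hh, false_or]

/-- The `(k+1)(l+1)` lines given by the roots each carry a common point. This exhausts the Bézout
bound, so no line carries two. -/
theorem eq_of_isApparentPair {v : Fin 6 → ℂ} {E : Polynomial ℂ}
    (hE : ∀ x, E.IsRoot x ↔ ∃ y, IsApparentPair k l v y (y - x))
    (hdeg : E.natDegree = (k + 1) * (l + 1)) (hsep : E.Separable) {x y y' : ℂ}
    (h : IsApparentPair k l v y (y - x)) (h' : IsApparentPair k l v y' (y' - x)) : y = y' := by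
  classical
  choose! s hs using fun x => (hE x).1
  set Z : Finset (Fin 2 → ℂ) := E.roots.toFinset.image fun x => ![s x, s x - x] with hZ
  have hinj : Function.Injective fun x : ℂ => ![s x, s x - x] := by
    intro x x' hx
    have h0 := congrFun hx 0
    have h1 := congrFun hx 1
    simp only [Matrix.cons_val_zero, Matrix.cons_val_one] at h0 h1
    linear_combination h0 - h1
  have hcard : Z.card = (k + 1) * (l + 1) := by
    rw [hZ, Finset.card_image_of_injective _ hinj, Multiset.toFinset_card_of_nodup
      (Polynomial.nodup_roots hsep), ← (IsAlgClosed.splits E).natDegree_eq_card_roots, hdeg]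
  have hZp : ∀ p ∈ Z, IsApparentPair k l v (p 0) (p 1) := by
    intro p hp
    obtain ⟨x, hx, rfl⟩ := Finset.mem_image.1 hp
    exact hs x (Polynomial.isRoot_of_mem_roots (Multiset.mem_toFinset.1 hx))
  have key : ∀ y, IsApparentPair k l v y (y - x) → y = s x := by
    intro y hy
    have hmem : ![y, y - x] ∈ Z := by
      by_contra hn
      have := card_apparentPairs_le k l v (insert ![y, y - x] Z) (by
        intro p hp
        rcases Finset.mem_insert.1 hp with rfl | hp
        · exact hy
        · exact hZp p hp)
      rw [Finset.card_insert_of_notMem hn, hcard] at this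
      omega
    obtain ⟨x', -, hx'⟩ := Finset.mem_image.1 hmem
    have h0 := congrFun hx' 0
    have h1 := congrFun hx' 1
    simp only [Matrix.cons_val_zero, Matrix.cons_val_one] at h0 h1
    have : x' = x := by linear_combination h0 - h1
    rw [← this, h0]
  rw [key y h, key y' h']

/-- The parameter values at which the apparent pairs are counted by the eliminant and the series at
the origin have no vanishing coefficients. -/
def IsGoodPoint (k l : ℕ) (x : Fin 6 → ℂ) : Prop :=
  (((eliminant k l (MvPolynomial.X : Fin 6 → MvPolynomial (Fin 6) ℂ)).map
      (MvPolynomial.eval x)).natDegree = (k + 1) * (l + 1) ∧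
    ((eliminant k l (MvPolynomial.X : Fin 6 → MvPolynomial (Fin 6) ℂ)).map
      (MvPolynomial.eval x)).Separable) ∧
  ∀ (n : ℕ) (y y₁ : ℂ), IsApparentPair k l x y y₁ → originRec k l x y y₁ n ≠ 0

theorem holdsGenerically_isGoodPoint (k l : ℕ) : HoldsGenerically (IsGoodPoint k l) := by
  obtain ⟨G, hG0, hG⟩ := eliminant_generic k l (MvPolynomial.X : Fin 6 → MvPolynomial (Fin 6) ℂ)
    (MvPolynomial.eval (basePoint k)) (by funext i; simp)
  refine ((HoldsGenerically.of_eval_ne_zero G _ hG0).mono fun x hx => hG _ hx).and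
    (HoldsGenerically.all fun n => ?_)
  obtain ⟨G', hG0', hG'⟩ := exists_generic_originRec_ne_zero k l n
  exact (HoldsGenerically.of_eval_ne_zero G' _ hG0').mono hG'

theorem eval_aeval_scaledParams (h : ℂ) (x : Fin 5 → ℂ) (g : MvPolynomial (Fin 6) ℂ) :
    MvPolynomial.eval x (MvPolynomial.aeval (scaledParams (MvPolynomial.C h) (MvPolynomial.X 0)
      (MvPolynomial.X 1) (MvPolynomial.X 2) (MvPolynomial.X 3) (MvPolynomial.X 4)) g) =
      MvPolynomial.eval (scaledParams h (x 0) (x 1) (x 2) (x 3) (x 4)) g := by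
  induction g using MvPolynomial.induction_on with
  | C a => simp
  | add p q hp hq => simp only [map_add, hp, hq]
  | mul_X p i hp =>
    rw [map_mul, map_mul, map_mul, hp, MvPolynomial.aeval_X, MvPolynomial.eval_X]
    congr 1
    fin_cases i <;> simp [scaledParams]

theorem HoldsGenerically.exists_scaledParams {Q : (Fin 6 → ℂ) → Prop} (hQ : HoldsGenerically Q) :
    ∃ h : ℂ, h ≠ 0 ∧ HoldsGenerically fun x : Fin 5 → ℂ =>
      Q (scaledParams h (x 0) (x 1) (x 2) (x 3) (x 4)) := by
  obtain ⟨G, hG, h⟩ := hQ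
  obtain ⟨x, hx, hx5⟩ := (HoldsGenerically.and (Q := fun x : Fin 6 → ℂ =>
    ∀ i, MvPolynomial.eval x (G i) ≠ 0) ⟨G, hG, fun _ hx => hx⟩ (HoldsGenerically.of_eval_ne_zero
      (MvPolynomial.X 5) (fun _ => 1) (by simp))).exists_point
  rw [MvPolynomial.eval_X] at hx5
  refine ⟨x 5, hx5, fun i => MvPolynomial.aeval (scaledParams (MvPolynomial.C (x 5))
    (MvPolynomial.X 0) (MvPolynomial.X 1) (MvPolynomial.X 2) (MvPolynomial.X 3)
    (MvPolynomial.X 4)) (G i), fun i h0 => hx i ?_, fun y hy => h _ fun i => ?_⟩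
  · have h1 := eval_aeval_scaledParams (x 5) ![x 0 / x 5, x 1, x 2 / x 5, x 3, x 4] (G i)
    rw [← h1.symm.trans ((congrArg _ h0).trans (map_zero _))]
    congr 2
    funext j
    fin_cases j <;> simp [scaledParams, mul_div_cancel₀ _ hx5]
  · have := hy i
    rwa [eval_aeval_scaledParams] at this

end Genericity

/-! ### The polynomial for `θ₁` -/

section ApparentPolynomial

open MvPolynomial

/-- The polynomial whose roots are the values `θ₁` of the hypergeometric cases, with an auxiliary
scaling parameter `h`. -/
noncomputable def apparentTheta (k l : ℕ) (h : ℂ) : Polynomial (MvPolynomial (Fin 5) ℂ) :=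
  ((eliminant k l (X : Fin 6 → MvPolynomial (Fin 6) ℂ)).map
    (aeval (scaledParams (C h) (X 0) (X 1) (X 2) (X 3) (X 4)) :
      MvPolynomial (Fin 6) ℂ →ₐ[ℂ] MvPolynomial (Fin 5) ℂ).toRingHom).comp
    (.C (-(C h * (X 3 - X 4))) * .X + .C (C h * (X 3 - X 4) * (X 0 * X 1 * (X 3 + X 4))))

theorem Polynomial.Separable.comp_linear {p : Polynomial ℂ} (hp : p.Separable) {c : ℂ} (hc : c ≠ 0)
    (d : ℂ) : (p.comp (.C c * .X + .C d)).Separable := by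
  obtain ⟨a, b, h⟩ := hp
  refine ⟨a.comp (.C c * .X + .C d), b.comp (.C c * .X + .C d) * .C c⁻¹, ?_⟩
  have h1 := congrArg (fun q : Polynomial ℂ => q.comp (.C c * .X + .C d)) h
  simp only [Polynomial.add_comp, Polynomial.mul_comp, Polynomial.one_comp] at h1
  rw [Polynomial.derivative_comp]
  have h2 : (.C c * .X + .C d : Polynomial ℂ).derivative = .C c := by simp
  have h3 : (.C c⁻¹ * .C c : Polynomial ℂ) = 1 := by
    rw [← Polynomial.C_mul, inv_mul_cancel₀ hc, Polynomial.C_1]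
  rw [h2]
  linear_combination h1 + b.comp (.C c * .X + .C d) * p.derivative.comp (.C c * .X + .C d) * h3

variable {k l : ℕ} {h : ℂ} (x : Fin 5 → ℂ)

/-- The inner linear polynomial is `h (Y - Y₁) = h (a - a₁)(αβ(a + a₁) - θ₁)`. Its slope is nonzero
for `h ≠ 0` and `a ≠ a₁`, so degree and separability pass over from the eliminant. -/
theorem map_apparentTheta : (apparentTheta k l h).map (eval x) =
    ((eliminant k l (X : Fin 6 → MvPolynomial (Fin 6) ℂ)).map
      (eval (scaledParams h (x 0) (x 1) (x 2) (x 3) (x 4)))).comp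
      (.C (-(h * (x 3 - x 4))) * .X + .C (h * (x 3 - x 4) * (x 0 * x 1 * (x 3 + x 4)))) := by
  rw [apparentTheta, Polynomial.map_comp, Polynomial.map_map]
  congr 1
  · congr 1
    exact RingHom.ext fun g => eval_aeval_scaledParams h x g
  · simp

theorem natDegree_map_apparentTheta_le :
    ((apparentTheta k l h).map (eval x)).natDegree ≤ (k + 1) * (l + 1) := by
  rw [map_apparentTheta]
  refine (Polynomial.natDegree_comp_le).trans ?_
  exact (Nat.mul_le_mul (natDegree_map_eliminant_le _ k l _) Polynomial.natDegree_linear_le).trans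
    (mul_one _).le

theorem natDegree_apparentTheta_le : (apparentTheta k l h).natDegree ≤ (k + 1) * (l + 1) := by
  refine Polynomial.natDegree_le_iff_coeff_eq_zero.2 fun n hn => MvPolynomial.funext fun x => ?_
  rw [← Polynomial.coeff_map, map_zero]
  exact Polynomial.coeff_eq_zero_of_natDegree_lt ((natDegree_map_apparentTheta_le x).trans_lt hn)

variable {x}

theorem natDegree_map_apparentTheta (hh : h ≠ 0) (hx : x 3 ≠ x 4)
    (hg : IsGoodPoint k l (scaledParams h (x 0) (x 1) (x 2) (x 3) (x 4))) :
    ((apparentTheta k l h).map (eval x)).natDegree = (k + 1) * (l + 1) := by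
  rw [map_apparentTheta, Polynomial.natDegree_comp, hg.1.1, Polynomial.natDegree_linear, mul_one]
  exact neg_ne_zero.2 (mul_ne_zero hh (sub_ne_zero.2 hx))

theorem separable_map_apparentTheta (hh : h ≠ 0) (hx : x 3 ≠ x 4)
    (hg : IsGoodPoint k l (scaledParams h (x 0) (x 1) (x 2) (x 3) (x 4))) :
    ((apparentTheta k l h).map (eval x)).Separable := by
  rw [map_apparentTheta]
  exact hg.1.2.comp_linear (neg_ne_zero.2 (mul_ne_zero hh (sub_ne_zero.2 hx))) _

theorem isRoot_map_eliminant_iff (v : Fin 6 → ℂ) (t : ℂ) :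
    ((eliminant k l (X : Fin 6 → MvPolynomial (Fin 6) ℂ)).map (eval v)).IsRoot t ↔
      ∃ y, IsApparentPair k l v y (y - t) := by
  rw [Polynomial.IsRoot, eval_map_eliminant, lineResultant_eq_zero_iff,
    show (eval v : MvPolynomial (Fin 6) ℂ → ℂ) ∘ X = v by funext i; simp]

/-- `θ₁` selects the line, and a point `y` on it corresponds to `θ₀ = αβa² - θ₁a - y/h`. -/
theorem isRoot_map_apparentTheta_iff (hh : h ≠ 0) (α β γ a a₁ θ₁ : ℂ) :
    ((apparentTheta k l h).map (eval ![α, β, γ, a, a₁])).IsRoot θ₁ ↔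
      ∃ θ₀, IsApparentPair k l (fuchsianCase k l α β γ a a₁ θ₀ θ₁).vec
        (fuchsianCase k l α β γ a a₁ θ₀ θ₁).accessory
        (fuchsianCase k l α β γ a a₁ θ₀ θ₁).swap.accessory := by
  rw [map_apparentTheta, Polynomial.IsRoot, Polynomial.eval_comp, ← Polynomial.IsRoot,
    isRoot_map_eliminant_iff]
  change (∃ y, IsApparentPair k l (scaledParams h α β γ a a₁) _ _) ↔
    ∃ θ₀, IsApparentPair k l (scaledParams 1 α β γ a a₁) _ _
  simp only [← isApparentPair_scaledParams hh, FuchsianParams.accessory, FuchsianParams.swap,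
    fuchsianCase]
  constructor
  · rintro ⟨y, hy⟩
    refine ⟨α * β * a ^ 2 - θ₁ * a - y / h, ?_⟩
    convert hy using 1
    · field_simp
      ring
    · simp
      field_simp
      ring
  · rintro ⟨θ₀, hθ⟩
    refine ⟨h * (α * β * a ^ 2 - θ₁ * a - θ₀), ?_⟩
    convert hθ using 1
    simp
    ring

theorem theta0_unique (hh : h ≠ 0) {α β γ a a₁ θ₁ θ₀ θ₀' : ℂ}
    (hg : IsGoodPoint k l (scaledParams h α β γ a a₁))
    (h1 : IsApparentPair k l (fuchsianCase k l α β γ a a₁ θ₀ θ₁).vec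
      (fuchsianCase k l α β γ a a₁ θ₀ θ₁).accessory
      (fuchsianCase k l α β γ a a₁ θ₀ θ₁).swap.accessory)
    (h2 : IsApparentPair k l (fuchsianCase k l α β γ a a₁ θ₀' θ₁).vec
      (fuchsianCase k l α β γ a a₁ θ₀' θ₁).accessory
      (fuchsianCase k l α β γ a a₁ θ₀' θ₁).swap.accessory) : θ₀' = θ₀ := by
  have e : ∀ θ : ℂ, h * (fuchsianCase k l α β γ a a₁ θ θ₁).swap.accessory =
      h * (fuchsianCase k l α β γ a a₁ θ θ₁).accessory -
        h * ((a - a₁) * (α * β * (a + a₁) - θ₁)) := by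
    intro θ
    simp only [FuchsianParams.accessory, FuchsianParams.swap, fuchsianCase]
    ring
  have h1' := (isApparentPair_scaledParams hh α β γ a a₁ _ _).2 h1
  have h2' := (isApparentPair_scaledParams hh α β γ a a₁ _ _).2 h2
  rw [e] at h1' h2'
  have := mul_left_cancel₀ hh
    (eq_of_isApparentPair (isRoot_map_eliminant_iff _) hg.1.1 hg.1.2 h1' h2')
  simp only [FuchsianParams.accessory, fuchsianCase] at this
  linear_combination this

theorem originRec_ne_zero_of_isGoodPoint (hh : h ≠ 0) {α β γ a a₁ y y₁ : ℂ}
    (hg : IsGoodPoint k l (scaledParams h α β γ a a₁))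
    (h1 : IsApparentPair k l (scaledParams 1 α β γ a a₁) y y₁) (n : ℕ) :
    originRec k l (scaledParams 1 α β γ a a₁) y y₁ n ≠ 0 := by
  have := hg.2 n _ _ ((isApparentPair_scaledParams hh α β γ a a₁ _ _).2 h1)
  rw [originRec_scaledParams] at this
  exact right_ne_zero_of_mul this

/-- The parameter values to which the description of the hypergeometric cases applies. -/
structure IsAdmissible (k l : ℕ) (h α β γ a a₁ : ℂ) : Prop where
  distinctPoints : a ≠ 0 ∧ a ≠ 1 ∧ a₁ ≠ 0 ∧ a₁ ≠ 1 ∧ a ≠ a₁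
  nonIntegral : ∀ m : ℤ, α ≠ m ∧ β ≠ m ∧ γ - α ≠ m ∧ γ - β ≠ m
  γ_ne : ∀ m : ℕ, γ ≠ -m
  δ_ne : 1 + α + β - γ + k + l ≠ 0
  add_ne : α + β ≠ 1
  isGoodPoint : IsGoodPoint k l (scaledParams h α β γ a a₁)

theorem exists_holdsGenerically_isAdmissible (k l : ℕ) : ∃ h : ℂ, h ≠ 0 ∧
    HoldsGenerically fun x : Fin 5 → ℂ => IsAdmissible k l h (x 0) (x 1) (x 2) (x 3) (x 4) := by
  obtain ⟨h, hh, hg⟩ := (holdsGenerically_isGoodPoint k l).exists_scaledParams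
  -- Each exceptional polynomial is shown to be nonzero by a point where it takes the value 1.
  have key : ∀ (g : MvPolynomial (Fin 5) ℂ) (x₀ : Fin 5 → ℂ), eval x₀ g = 1 →
      HoldsGenerically fun x => eval x g ≠ 0 := fun g x₀ h1 =>
    .of_eval_ne_zero g x₀ (h1 ▸ one_ne_zero)
  refine ⟨h, hh, ((((((key (X 3) ![0, 0, 0, 1, 0] (by simp)).and
    (key (X 3 - 1) ![0, 0, 0, 2, 0] (by simp; norm_num))).and
    ((key (X 4) ![0, 0, 0, 0, 1] (by simp)).and
    (key (X 4 - 1) ![0, 0, 0, 0, 2] (by simp; norm_num)))).and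
    ((key (X 3 - X 4) ![0, 0, 0, 1, 0] (by simp)).and
    (HoldsGenerically.all fun m : ℤ => ((key (X 0 - C (m : ℂ)) ![m + 1, 0, 0, 0, 0] (by simp)).and
      (key (X 1 - C (m : ℂ)) ![0, m + 1, 0, 0, 0] (by simp))).and
      ((key (X 2 - X 0 - C (m : ℂ)) ![0, 0, m + 1, 0, 0] (by simp)).and
      (key (X 2 - X 1 - C (m : ℂ)) ![0, 0, m + 1, 0, 0] (by simp)))))).and
    ((HoldsGenerically.all fun m : ℕ => key (X 2 + C (m : ℂ)) ![0, 0, 1 - m, 0, 0] (by simp)).and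
    ((key (1 + X 0 + X 1 - X 2 + C (k : ℂ) + C (l : ℂ)) ![0, 0, k + l, 0, 0] (by simp; ring)).and
    (key (X 0 + X 1 - 1) ![2, 0, 0, 0, 0] (by simp; norm_num))))).and hg).mono ?_⟩
  rintro x ⟨⟨⟨⟨⟨h1, h2⟩, h3, h4⟩, h5, h6⟩, h7, h8, h9⟩, h10⟩
  simp only [map_sub, map_add, map_one, eval_X, eval_C] at h1 h2 h3 h4 h5 h6 h7 h8 h9
  exact ⟨⟨h1, sub_ne_zero.1 h2, h3, sub_ne_zero.1 h4, sub_ne_zero.1 h5⟩,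
    fun m => ⟨sub_ne_zero.1 (h6 m).1.1, sub_ne_zero.1 (h6 m).1.2, sub_ne_zero.1 (h6 m).2.1,
      sub_ne_zero.1 (h6 m).2.2⟩, fun m hm => h7 m (by rw [hm, neg_add_cancel]), h8,
    fun h => h9 (by rw [h, sub_self]), h10⟩

theorem fuchsRelation_fuchsianCase (k l : ℕ) (α β γ a a₁ θ₀ θ₁ : ℂ) :
    (fuchsianCase k l α β γ a a₁ θ₀ θ₁).FuchsRelation := by
  simp only [FuchsianParams.FuchsRelation, fuchsianCase]
  ring

namespace IsAdmissible

variable {α β γ a a₁ θ₀ θ₁ : ℂ} (hx : IsAdmissible k l h α β γ a a₁)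

include hx

theorem isRoot_iff (hh : h ≠ 0) : ((apparentTheta k l h).map (eval ![α, β, γ, a, a₁])).IsRoot θ₁ ↔
    ∃ (θ₀ : ℂ) (e : Fin (k + l) → ℂ),
      (fuchsianCase k l α β γ a a₁ θ₀ θ₁).IsHypergeometricSolution e := by
  rw [isRoot_map_apparentTheta_iff hh]
  refine exists_congr fun θ₀ => ⟨fun h1 => ?_, ?_⟩
  · exact exists_isHypergeometricSolution (fuchsRelation_fuchsianCase k l α β γ a a₁ θ₀ θ₁)
      hx.distinctPoints hx.nonIntegral hx.γ_ne rfl rfl h1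
      (originRec_ne_zero_of_isGoodPoint hh hx.isGoodPoint h1)
  · rintro ⟨e, he⟩
    exact he.isApparentPair (fuchsRelation_fuchsianCase k l α β γ a a₁ θ₀ θ₁) hx.distinctPoints
      hx.nonIntegral rfl rfl

theorem hasFiveRegularSingularPoints (hk : 1 ≤ k) (hl : 1 ≤ l) :
    (fuchsianCase k l α β γ a a₁ θ₀ θ₁).HasFiveRegularSingularPoints :=
  _root_.hasFiveRegularSingularPoints (fuchsRelation_fuchsianCase k l α β γ a a₁ θ₀ θ₁)
    hx.distinctPoints (by simpa [fuchsianCase] using hx.γ_ne 0) hx.δ_ne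
    (neg_ne_zero.2 (Nat.cast_ne_zero.2 (by omega))) (neg_ne_zero.2 (Nat.cast_ne_zero.2 (by omega)))
    hx.add_ne

theorem unique (hh : h ≠ 0) {e : Fin (k + l) → ℂ}
    (he : (fuchsianCase k l α β γ a a₁ θ₀ θ₁).IsHypergeometricSolution e) {θ₀' : ℂ}
    {e' : Fin (k + l) → ℂ}
    (he' : (fuchsianCase k l α β γ a a₁ θ₀' θ₁).IsHypergeometricSolution e') :
    θ₀' = θ₀ ∧ ∃ π : Equiv.Perm (Fin (k + l)), e' = e ∘ π := by
  have hP := fun θ => fuchsRelation_fuchsianCase k l α β γ a a₁ θ θ₁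
  obtain rfl := theta0_unique hh hx.isGoodPoint
    (he.isApparentPair (hP _) hx.distinctPoints hx.nonIntegral rfl rfl)
    (he'.isApparentPair (hP _) hx.distinctPoints hx.nonIntegral rfl rfl)
  exact ⟨rfl, he.exists_perm he' (hP _) hx.distinctPoints hx.nonIntegral rfl rfl⟩

end IsAdmissible

end ApparentPolynomial

/-! ### Conclusion -/

/-- A finite set of cases would involve finitely many values of `α`; avoiding these is one more
generic condition. -/
theorem infinite_hypergeometric_cases (k l : ℕ) (hk : 1 ≤ k) (hl : 1 ≤ l) :
    {P : FuchsianParams | P.ε = -(k : ℂ) ∧ P.ε₁ = -(l : ℂ) ∧ P.FuchsRelation ∧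
      P.HasFiveRegularSingularPoints ∧
      ∃ e : Fin (k + l) → ℂ, P.IsHypergeometricSolution e}.Infinite := by
  intro hfin
  obtain ⟨h, hh, hgen⟩ := exists_holdsGenerically_isAdmissible k l
  set S := (hfin.image FuchsianParams.α).toFinset with hS
  obtain ⟨t, ht⟩ := Infinite.exists_notMem_finset S
  obtain ⟨x, hx, hxS⟩ := (hgen.and (HoldsGenerically.of_eval_ne_zero
    (∏ s ∈ S, (MvPolynomial.X 0 - MvPolynomial.C s)) (fun _ => t) (by
      rw [map_prod]
      refine Finset.prod_ne_zero_iff.2 fun s hs => ?_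
      simp only [map_sub, MvPolynomial.eval_X, MvPolynomial.eval_C]
      exact sub_ne_zero.2 fun h => ht (h ▸ hs)))).exists_point
  rw [map_prod, Finset.prod_ne_zero_iff] at hxS
  obtain ⟨θ₁, hθ⟩ := IsAlgClosed.exists_root ((apparentTheta k l h).map
    (MvPolynomial.eval ![x 0, x 1, x 2, x 3, x 4])) (by
      refine (Polynomial.natDegree_pos_iff_degree_pos.1 ?_).ne'
      rw [natDegree_map_apparentTheta (x := ![x 0, x 1, x 2, x 3, x 4]) hh
        hx.distinctPoints.2.2.2.2 hx.isGoodPoint]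
      positivity)
  obtain ⟨θ₀, he⟩ := (hx.isRoot_iff hh).1 hθ
  have hmem : x 0 ∈ S := by
    rw [hS, Set.Finite.mem_toFinset]
    exact ⟨_, ⟨rfl, rfl, fuchsRelation_fuchsianCase k l _ _ _ _ _ θ₀ θ₁,
      hx.hasFiveRegularSingularPoints hk hl, he⟩, rfl⟩
  exact hxS _ hmem (by simp)

theorem mainTheorem1 :
    -- (i) the restrictions are necessary
    (∀ (N : ℕ) (P : FuchsianParams) (e : Fin N → ℂ),
      P.FuchsRelation → P.DistinctPoints →
      (∀ m : ℤ, P.α ≠ m ∧ P.β ≠ m ∧ P.γ - P.α ≠ m ∧ P.γ - P.β ≠ m) →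
      P.IsHypergeometricSolution e →
        (∃ k l : ℕ, P.ε = -(k : ℂ) ∧ P.ε₁ = -(l : ℂ) ∧ k + l = N) ∧
        P.Theta0Formula e) ∧
    -- (ii) for all `k + l = N` and generic `α, β, γ, a, a₁` the solutions exist, they correspond
    -- to the roots `θ₁` of a polynomial, and each root fixes `θ₀` and `e_1, …, e_N`
    (∀ k l : ℕ,
      ∃ T : Polynomial (MvPolynomial (Fin 5) ℂ), T.natDegree = (k + 1) * (l + 1) ∧
      ∃ G : ℕ → MvPolynomial (Fin 5) ℂ, (∀ i, G i ≠ 0) ∧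
      ∀ α β γ a a₁ : ℂ, (∀ i, MvPolynomial.eval ![α, β, γ, a, a₁] (G i) ≠ 0) →
        (T.map (MvPolynomial.eval ![α, β, γ, a, a₁])).natDegree = (k + 1) * (l + 1) ∧
        (T.map (MvPolynomial.eval ![α, β, γ, a, a₁])).Separable ∧
        (∀ θ₁ : ℂ, (T.map (MvPolynomial.eval ![α, β, γ, a, a₁])).IsRoot θ₁ ↔
          ∃ (θ₀ : ℂ) (e : Fin (k + l) → ℂ),
            (fuchsianCase k l α β γ a a₁ θ₀ θ₁).IsHypergeometricSolution e) ∧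
        (∀ (θ₁ θ₀ : ℂ) (e : Fin (k + l) → ℂ),
          (fuchsianCase k l α β γ a a₁ θ₀ θ₁).IsHypergeometricSolution e →
            (fuchsianCase k l α β γ a a₁ θ₀ θ₁).DistinctPoints ∧
            (fuchsianCase k l α β γ a a₁ θ₀ θ₁).Theta0Formula e ∧
            (1 ≤ k → 1 ≤ l →
              (fuchsianCase k l α β γ a a₁ θ₀ θ₁).HasFiveRegularSingularPoints) ∧
            ∀ (θ₀' : ℂ) (e' : Fin (k + l) → ℂ),
              (fuchsianCase k l α β γ a a₁ θ₀' θ₁).IsHypergeometricSolution e' →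
                θ₀' = θ₀ ∧ ∃ π : Equiv.Perm (Fin (k + l)), e' = e ∘ π)) ∧
    -- (iii) infinitely many cases with five irreducible singularities
    (∀ k l : ℕ, 1 ≤ k → 1 ≤ l →
      {P : FuchsianParams | P.ε = -(k : ℂ) ∧ P.ε₁ = -(l : ℂ) ∧ P.FuchsRelation ∧
        P.HasFiveRegularSingularPoints ∧
        ∃ e : Fin (k + l) → ℂ, P.IsHypergeometricSolution e}.Infinite) := by
  refine ⟨fun N P e hP hd hint he => ⟨he.exists_exponents hP hd hint, he.theta0Formula hP⟩,
    fun k l => ?_, infinite_hypergeometric_cases⟩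
  obtain ⟨h, hh, hgen⟩ := exists_holdsGenerically_isAdmissible k l
  refine ⟨apparentTheta k l h, ?_, ?_⟩
  -- One admissible specialization of full degree already forces the degree of `T` itself.
  · obtain ⟨x, hx⟩ := hgen.exists_point
    refine le_antisymm natDegree_apparentTheta_le ?_
    rw [← natDegree_map_apparentTheta hh hx.distinctPoints.2.2.2.2 hx.isGoodPoint]
    exact Polynomial.natDegree_map_le
  obtain ⟨G, hG, hgood⟩ := hgen
  refine ⟨G, hG, fun α β γ a a₁ hne => ?_⟩
  have hx : IsAdmissible k l h α β γ a a₁ := hgood _ hne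
  refine ⟨natDegree_map_apparentTheta hh hx.distinctPoints.2.2.2.2 hx.isGoodPoint,
    separable_map_apparentTheta hh hx.distinctPoints.2.2.2.2 hx.isGoodPoint,
    fun θ₁ => hx.isRoot_iff hh, fun θ₁ θ₀ e he => ⟨hx.distinctPoints,
      he.theta0Formula (fuchsRelation_fuchsianCase k l α β γ a a₁ θ₀ θ₁),
      fun hk hl => hx.hasFiveRegularSingularPoints hk hl, fun θ₀' e' he' => hx.unique hh he he'⟩⟩
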